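/- **The game.** Let $a,b$ be positive integers and $n$ an even positive integer. The $(a:b)$ perfect matching game against PhantomBreaker is played on the edge set of the complete graph $K_n$, all of whose edges are initially unclaimed. In each round, Maker first makes $a$ attempts, one after another. In each attempt she names an edge. If it is unclaimed she claims it. If it is already claimed the attempt is lost. She is told the outcome before her next attempt. Then PhantomBreaker claims $b$ unclaimed edges (all of them, if fewer than $b$ remain). PhantomBreaker sees the whole history of the play, while Maker sees only her own attempts and their outcomes. Maker wins if she claims all the edges of some perfect matching of $K_n$. A randomized strategy chooses the distribution of the player's next move as a function of what the player has observed so far. **Theorem.** Let $a,b$ be positive integers. (a) If $b>2a$, then there is a constant $c>0$, depending only on $a$ and $b$, such that for every sufficiently large even $n$ Maker has a randomized strategy which wins with probability at least $c$ against every (randomized) strategy of PhantomBreaker. (b) If $b\le 2a$, then there are a constant $C$ and a sequence $\delta(n)\to 0$, depending only on $a$ and $b$, such that for every sufficiently large even $n$ Maker has a randomized strategy which, against every (randomized) strategy of PhantomBreaker, wins with probability at least $1-\delta(n)$ (that is, asymptotically almost surely), and moreover, with probability at least $1-\delta(n)$, wins within $\frac{n}{2a}+C\,n^{0.8}$ rounds.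 -/

import Mathlib

open Filter Topology

noncomputable section

namespace PhantomGame

/-- The board of the game: the edges of the complete graph on `Fin n`. -/
abbrev Edge (n : ℕ) := (⊤ : SimpleGraph (Fin n)).edgeSet

/-- One event of a play. `attempt e s` : Maker tried to claim the edge `e`, with `s = true` if
the edge was unclaimed (so that she now owns it) and `s = false` if it was already claimed (and
her move is lost). `reply s` : in his turn Breaker claimed the set of edges `s`. -/
inductive Event (n : ℕ) : Type
  | attempt (e : Edge n) (success : Bool)
  | reply (s : Finset (Edge n))

/-- The complete record of a play, the most recent event first. -/
abbrev History (n : ℕ) := List (Event n)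

/-- The edges claimed by Maker. -/
def makerEdges {n : ℕ} : History n → Finset (Edge n)
  | [] => ∅
  | Event.attempt e true :: h => insert e (makerEdges h)
  | Event.attempt _ false :: h => makerEdges h
  | Event.reply _ :: h => makerEdges h

/-- The edges claimed by Breaker. -/
def breakerEdges {n : ℕ} : History n → Finset (Edge n)
  | [] => ∅
  | Event.attempt _ _ :: h => breakerEdges h
  | Event.reply s :: h => s ∪ breakerEdges h

/-- The unclaimed edges. -/
def freeEdges {n : ℕ} (h : History n) : Finset (Edge n) :=
  Finset.univ \ (makerEdges h ∪ breakerEdges h)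

/-- What Maker knows: her own attempts and whether each of them was successful
(most recent first). She sees nothing else of Breaker's moves. -/
def observation {n : ℕ} : History n → List (Edge n × Bool)
  | [] => []
  | Event.attempt e s :: h => (e, s) :: observation h
  | Event.reply _ :: h => observation h

/-- A randomized strategy of Maker: the distribution of the edge that she tries to claim next,
as a function of what she has observed so far. -/
def MakerStrategy (n : ℕ) := List (Edge n × Bool) → PMF (Edge n)

/-- A randomized strategy of PhantomBreaker with bias `b`: the distribution of the set of edges
that he claims in his turn, as a function of the whole history of the play. He has to claim
exactly `b` unclaimed edges, or all unclaimed edges if fewer than `b` are left. -/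
structure BreakerStrategy (n b : ℕ) where
  move : History n → PMF (Finset (Edge n))
  legal : ∀ h, ∀ s ∈ (move h).support,
    s ⊆ freeEdges h ∧ s.card = min b (freeEdges h).card

/-- One attempt of Maker to claim an edge; it succeeds exactly if the edge is unclaimed. -/
def makerAttempt {n : ℕ} (σ : MakerStrategy n) (h : History n) : PMF (History n) :=
  (σ (observation h)).map fun e => Event.attempt e (decide (e ∈ freeEdges h)) :: h

/-- `k` consecutive attempts of Maker; she learns the result of each before the next one. -/
def makerTurn {n : ℕ} (σ : MakerStrategy n) : ℕ → History n → PMF (History n)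
  | 0, h => PMF.pure h
  | k + 1, h => (makerAttempt σ h).bind (makerTurn σ k)

/-- Breaker's turn. -/
def breakerTurn {n b : ℕ} (τ : BreakerStrategy n b) (h : History n) : PMF (History n) :=
  (τ.move h).map fun s => Event.reply s :: h

/-- One round of the `(a : b)` game: `a` attempts of Maker, followed by Breaker's turn. -/
def round {n b : ℕ} (a : ℕ) (σ : MakerStrategy n) (τ : BreakerStrategy n b) (h : History n) :
    PMF (History n) :=
  (makerTurn σ a h).bind (breakerTurn τ)

/-- The distribution of the history after the given number of rounds of the `(a : b)` game. (Once
all the edges are claimed, further rounds do not change the position.) -/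
def play {n b : ℕ} (a : ℕ) (σ : MakerStrategy n) (τ : BreakerStrategy n b) : ℕ → PMF (History n)
  | 0 => PMF.pure []
  | t + 1 => (play a σ τ t).bind (round a σ τ)

/-- Maker has claimed all the edges of some perfect matching of the complete graph. -/
def HasPerfectMatching {n : ℕ} (h : History n) : Prop :=
  ∃ M : (⊤ : SimpleGraph (Fin n)).Subgraph,
    M.IsPerfectMatching ∧ ∀ e : Edge n, (e : Sym2 (Fin n)) ∈ M.edgeSet → e ∈ makerEdges h

/-- The probability that Maker wins the `(a : b)` perfect matching game within `t` rounds. -/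
def winProbWithin {n b : ℕ} (a : ℕ) (σ : MakerStrategy n) (τ : BreakerStrategy n b) (t : ℕ) : ℝ :=
  ((play a σ τ t).toOuterMeasure {h | HasPerfectMatching h}).toReal

/-- The probability that Maker wins the `(a : b)` perfect matching game. For `b ≥ 1`, Breaker
claims at least one edge in each round as long as there is an unclaimed one, so that all the
edges are claimed, and the game is over, after `n.choose 2` rounds. -/
def winProb {n b : ℕ} (a : ℕ) (σ : MakerStrategy n) (τ : BreakerStrategy n b) : ℝ :=
  winProbWithin a σ τ (n.choose 2)

end PhantomGame

end

/-! Maker builds a random matching pair by pair and repairs the few failures by short augmenting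
paths. She cannot see Breaker's edges, so each attempt is a uniform draw from a set computed from
her own observations (`moveSet`), and its purpose depends only on its number (`sched`). There are
three purposes.

Exposing: she tries a random pair of unexposed vertices. With `M` vertices unexposed and total
claimed degree `D` at them, the pair is already claimed with probability at most `D / (M (M - 1))`,
while the average degree `D / M` drifts upward only by `O(1 / M)`. Both contributions sum
harmonically, so polylogarithmically many failures are expected (`run_failed_le`, `run_load_le`).

Attaching: at every vertex of a failed pair she makes many random attempts and gains `k` edges,
provided that a small fraction of the star is still free (`le_run_attach`).

Fixing: for a failed pair `v, w`, Maker's edges `vx` and `wz` together with the matching edges `xp`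
and `zq` turn any free edge `pq` into an augmenting path `v x p q z w`. There are about `k ^ 2`
candidates `pq`, far more than the `O(n)` claimed edges, so a random one is very likely free
(`PartialRepair.succ_of_claim`, `le_step_fix`).

What remains is to ensure that failed vertices have free edges when they are attached. If `b ≤ 2 a`,
then after `ℓ` exposures Breaker owns at most `2 ℓ` edges. Pausing about `n ^ 0.8` pairs before the
end therefore leaves free edges at every vertex; the vertices still unexposed have small total
degree, so the last exposures are safe as well (`le_run_of_le_two_mul`). For a win with constant
probability the exposures are cut into `4 (b + 1)` windows and a short remainder. At the start of a
window at most `8 (b + 1)` vertices have degree above `n / 4`, and with probability bounded below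
all the unexposed ones among them are exposed within the window (`run_hit_le`). Hence the unexposed
vertices never start a window with degree above `n / 2` (`le_run_of_two_mul_lt`).

Probabilities are bounded by supermartingales and Markov's inequality (`run_le_of_potential`). The
one-step inequalities hold for every reply of Breaker (`Next`), so his randomization plays no role.
-/

noncomputable section

namespace PhantomGame

open scoped ENNReal

/-! ### Expectations, and the play as a chain of single attempts against a worst-case Breaker -/

section

/-! ### Expectations of nonnegative functions under a `PMF` -/

/-- The expectation of a nonnegative function. -/
def expect {α : Type*} (p : PMF α) (f : α → ℝ≥0∞) : ℝ≥0∞ := ∑' x, p x * f x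

theorem expect_pure {α : Type*} (x : α) (f : α → ℝ≥0∞) : expect (PMF.pure x) f = f x := by
  unfold expect
  rw [tsum_eq_single x]
  · simp
  · intro y hy
    simp [PMF.pure_apply, hy]

theorem expect_bind {α β : Type*} (p : PMF α) (g : α → PMF β) (f : β → ℝ≥0∞) :
    expect (p.bind g) f = expect p fun x => expect (g x) f := by
  unfold expect
  simp only [PMF.bind_apply, ← ENNReal.tsum_mul_right, ← ENNReal.tsum_mul_left, mul_assoc]
  exact ENNReal.tsum_comm

theorem expect_map {α β : Type*} (p : PMF α) (g : α → β) (f : β → ℝ≥0∞) :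
    expect (p.map g) f = expect p fun x => f (g x) := by
  rw [← PMF.bind_pure_comp, expect_bind]
  simp [expect_pure]

theorem expect_mono {α : Type*} {p : PMF α} {f g : α → ℝ≥0∞}
    (h : ∀ x ∈ p.support, f x ≤ g x) : expect p f ≤ expect p g := by
  refine ENNReal.tsum_le_tsum fun x => ?_
  by_cases hx : x ∈ p.support
  · gcongr
    exact h x hx
  · simp [(p.apply_eq_zero_iff x).2 hx]

theorem expect_const {α : Type*} (p : PMF α) (c : ℝ≥0∞) : expect p (fun _ => c) = c := by
  unfold expect
  rw [ENNReal.tsum_mul_right, p.tsum_coe, one_mul]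

theorem expect_le_of_forall {α : Type*} {p : PMF α} {f : α → ℝ≥0∞} {c : ℝ≥0∞}
    (h : ∀ x ∈ p.support, f x ≤ c) : expect p f ≤ c :=
  (expect_mono h).trans_eq (expect_const p c)

theorem toOuterMeasure_le_expect {α : Type*} {p : PMF α} {s : Set α} {f : α → ℝ≥0∞}
    (h : ∀ x ∈ p.support, x ∈ s → 1 ≤ f x) : p.toOuterMeasure s ≤ expect p f := by
  rw [PMF.toOuterMeasure_apply]
  refine ENNReal.tsum_le_tsum fun x => ?_
  by_cases hs : x ∈ s
  · rw [Set.indicator_of_mem hs]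
    by_cases hx : x ∈ p.support
    · exact le_mul_of_one_le_right' (h x hx hs)
    · simp [(p.apply_eq_zero_iff x).2 hx]
  · simp [hs]

theorem one_sub_le_toOuterMeasure {α : Type*} (p : PMF α) {s : Set α} {ε : ℝ≥0∞}
    (h : p.toOuterMeasure sᶜ ≤ ε) : 1 - ε ≤ p.toOuterMeasure s := by
  rw [tsub_le_iff_right]
  have h1 : p.toOuterMeasure (s ∪ sᶜ) = 1 := by
    rw [PMF.toOuterMeasure_apply_eq_one_iff]; simp
  calc (1 : ℝ≥0∞) = p.toOuterMeasure (s ∪ sᶜ) := h1.symm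
    _ ≤ p.toOuterMeasure s + p.toOuterMeasure sᶜ := MeasureTheory.measure_union_le _ _
    _ ≤ _ := by gcongr

theorem toOuterMeasure_le_one {α : Type*} (p : PMF α) (s : Set α) : p.toOuterMeasure s ≤ 1 := by
  have h1 : p.toOuterMeasure Set.univ = 1 := by
    rw [PMF.toOuterMeasure_apply_eq_one_iff]; simp
  exact (MeasureTheory.measure_mono (Set.subset_univ s)).trans_eq h1

theorem mul_le_toOuterMeasure_bind {α β : Type*} (p : PMF α) (g : α → PMF β) {s : Set α}
    {t : Set β} {c d : ℝ≥0∞} (hs : c ≤ p.toOuterMeasure s)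
    (ht : ∀ x ∈ p.support, x ∈ s → d ≤ (g x).toOuterMeasure t) :
    c * d ≤ (p.bind g).toOuterMeasure t := by
  rw [PMF.toOuterMeasure_bind_apply]
  calc c * d ≤ p.toOuterMeasure s * d := by gcongr
    _ = ∑' x, s.indicator p x * d := by rw [PMF.toOuterMeasure_apply, ENNReal.tsum_mul_right]
    _ ≤ _ := by
      refine ENNReal.tsum_le_tsum fun x => ?_
      by_cases hxs : x ∈ s
      · rw [Set.indicator_of_mem hxs]
        by_cases hx : x ∈ p.support
        · gcongr
          exact ht x hx hxs
        · simp [(p.apply_eq_zero_iff x).2 hx]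
      · simp [hxs]

theorem expect_uniformOfFinset {α : Type*} {s : Finset α} (hs : s.Nonempty) (f : α → ℝ≥0∞) :
    expect (PMF.uniformOfFinset s hs) f = (∑ x ∈ s, f x) / s.card := by
  unfold expect
  rw [tsum_eq_sum (s := s)]
  · rw [ENNReal.div_eq_inv_mul, Finset.mul_sum]
    refine Finset.sum_congr rfl fun x hx => ?_
    rw [PMF.uniformOfFinset_apply_of_mem hs hx]
  · intro x hx
    rw [PMF.uniformOfFinset_apply_of_notMem hs hx, zero_mul]

theorem expect_uniformOfFinset_le {α : Type*} {s : Finset α} (hs : s.Nonempty) {f : α → ℝ≥0∞}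
    {ψ : α → ℝ} {B : ℝ} (hf : ∀ x ∈ s, f x ≤ ENNReal.ofReal (ψ x)) (h0 : ∀ x ∈ s, 0 ≤ ψ x)
    (hB : ∑ x ∈ s, ψ x ≤ B * s.card) :
    expect (PMF.uniformOfFinset s hs) f ≤ ENNReal.ofReal B := by
  have hc : (0 : ℝ) < s.card := by exact_mod_cast hs.card_pos
  rw [expect_uniformOfFinset, ENNReal.div_le_iff_le_mul (by simp [hs.ne_empty]) (by simp)]
  calc ∑ x ∈ s, f x ≤ ∑ x ∈ s, ENNReal.ofReal (ψ x) := Finset.sum_le_sum hf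
    _ = ENNReal.ofReal (∑ x ∈ s, ψ x) := (ENNReal.ofReal_sum_of_nonneg h0).symm
    _ ≤ ENNReal.ofReal (B * s.card) := ENNReal.ofReal_le_ofReal hB
    _ = ENNReal.ofReal B * s.card := by
      rw [ENNReal.ofReal_mul' hc.le, ENNReal.ofReal_natCast]

/-! ### The play as a Markov chain of single attempts -/

variable {n a b : ℕ}

/-- The history after Maker has attempted to claim the edge `e`. -/
def attempted (h : History n) (e : Edge n) : History n :=
  Event.attempt e (decide (e ∈ freeEdges h)) :: h

/-- Breaker moves if Maker has finished her turn. -/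
def respond (a : ℕ) (τ : BreakerStrategy n b) (h : History n) : PMF (History n) :=
  if a ∣ (observation h).length then breakerTurn τ h else PMF.pure h

/-- One attempt of Maker, followed by Breaker's turn if it was the last one of Maker's turn. -/
def step (a : ℕ) (σ : MakerStrategy n) (τ : BreakerStrategy n b) (h : History n) :
    PMF (History n) :=
  (makerAttempt σ h).bind (respond a τ)

/-- The distribution of the history `j` attempts after the history `h`. -/
def run (a : ℕ) (σ : MakerStrategy n) (τ : BreakerStrategy n b) : ℕ → History n → PMF (History n)
  | 0, h => PMF.pure h
  | j + 1, h => (run a σ τ j h).bind (step a σ τ)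

theorem run_add (σ : MakerStrategy n) (τ : BreakerStrategy n b) (i j : ℕ) (h : History n) :
    run a σ τ (i + j) h = (run a σ τ i h).bind (run a σ τ j) := by
  induction j with
  | zero => simp [run]
  | succ j ih => rw [← add_assoc, run, ih, PMF.bind_bind]; rfl

theorem run_one (σ : MakerStrategy n) (τ : BreakerStrategy n b) (h : History n) :
    run a σ τ 1 h = step a σ τ h := by
  simp [run]

@[simp] theorem observation_attempted (h : History n) (e : Edge n) :
    observation (attempted h e) = (e, decide (e ∈ freeEdges h)) :: observation h := rfl

theorem step_eq (σ : MakerStrategy n) (τ : BreakerStrategy n b) (h : History n) :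
    step a σ τ h = (σ (observation h)).bind fun e => respond a τ (attempted h e) := by
  unfold step makerAttempt
  rw [PMF.bind_map]
  rfl

/-- As `k + 1 ≤ a`, no attempt before the last one of the turn brings the number of attempts to a
multiple of `a`, so `respond` lets Breaker move exactly once, at the end. -/
theorem makerTurn_bind_breakerTurn (σ : MakerStrategy n) (τ : BreakerStrategy n b) (k : ℕ) :
    ∀ h : History n, k + 1 ≤ a → a ∣ (observation h).length + (k + 1) →
      (makerTurn σ (k + 1) h).bind (breakerTurn τ) = run a σ τ (k + 1) h := by
  induction k with
  | zero =>
    intro h _ hd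
    have hm : makerTurn σ 1 h = makerAttempt σ h := by
      simp only [makerTurn]
      exact PMF.bind_pure _
    rw [zero_add, run_one, hm, step_eq, makerAttempt, PMF.bind_map]
    congr 1
    ext1 e
    change breakerTurn τ (attempted h e) = _
    rw [respond, if_pos (by simpa using hd)]
  | succ k ih =>
    intro h hk hd
    rw [add_comm (k + 1) 1, run_add, run_one, step_eq, add_comm 1 (k + 1), makerTurn,
      PMF.bind_bind, makerAttempt, PMF.bind_map, PMF.bind_bind]
    congr 1
    ext1 e
    change (makerTurn σ (k + 1) (attempted h e)).bind _ = _
    have hnd : ¬ a ∣ (observation (attempted h e)).length := by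
      intro hd'
      simp only [observation_attempted, List.length_cons] at hd'
      have h1 : a ∣ k + 1 := by
        have := (Nat.dvd_add_right hd').1 (by convert hd using 1; ring :
          a ∣ (observation h).length + 1 + (k + 1))
        exact this
      exact absurd (Nat.le_of_dvd (by omega) h1) (by omega)
    rw [respond, if_neg hnd, PMF.pure_bind]
    apply ih _ (by omega)
    simp only [observation_attempted, List.length_cons]
    convert hd using 1
    ring

/-! ### Histories that can arise -/

/-- The history `h'` may arise from `h` by an attempt to claim `e` and Breaker's answer. -/
def Next (a b : ℕ) (h : History n) (e : Edge n) (h' : History n) : Prop :=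
  h' = attempted h e ∨ (a ∣ (observation h).length + 1 ∧
    ∃ s : Finset (Edge n), s.card ≤ b ∧ h' = Event.reply s :: attempted h e)

theorem next_of_mem_support {τ : BreakerStrategy n b} {h h' : History n} {e : Edge n}
    (hh : h' ∈ (respond a τ (attempted h e)).support) : Next a b h e h' := by
  unfold respond at hh
  split_ifs at hh with hd
  · right
    refine ⟨by simpa using hd, ?_⟩
    unfold breakerTurn at hh
    rw [PMF.mem_support_map_iff] at hh
    obtain ⟨s, hs, rfl⟩ := hh
    exact ⟨s, by rw [(τ.legal _ s hs).2]; exact min_le_left _ _, rfl⟩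
  · left
    simpa using hh

theorem Next.observation_eq {h h' : History n} {e : Edge n} (hn : Next a b h e h') :
    observation h' = (e, decide (e ∈ freeEdges h)) :: observation h := by
  rcases hn with rfl | ⟨_, s, _, rfl⟩ <;> rfl

/-- The history `h'` may arise from `h` by `j` attempts of Maker playing the strategy `σ`. -/
inductive Ext (a b : ℕ) (σ : MakerStrategy n) (h : History n) : ℕ → History n → Prop
  | refl : Ext a b σ h 0 h
  | step {j : ℕ} {h' h'' : History n} {e : Edge n} : Ext a b σ h j h' →
      e ∈ (σ (observation h')).support → Next a b h' e h'' → Ext a b σ h (j + 1) h''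

theorem Ext.trans {σ : MakerStrategy n} {h h' h'' : History n} {i j : ℕ}
    (h1 : Ext a b σ h i h') (h2 : Ext a b σ h' j h'') : Ext a b σ h (i + j) h'' := by
  induction h2 with
  | refl => exact h1
  | step _ he hn ih => exact ih.step he hn

theorem Ext.length_observation {σ : MakerStrategy n} {h h' : History n} {j : ℕ}
    (hx : Ext a b σ h j h') : (observation h').length = (observation h).length + j := by
  induction hx with
  | refl => rfl
  | step _ _ hn ih => rw [hn.observation_eq, List.length_cons, ih]; ring

theorem ext_of_mem_support {σ : MakerStrategy n} {τ : BreakerStrategy n b} {h h' : History n}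
    {j : ℕ} (hh : h' ∈ (run a σ τ j h).support) : Ext a b σ h j h' := by
  induction j generalizing h' with
  | zero =>
    have : h' = h := by simpa [run] using hh
    exact this ▸ Ext.refl
  | succ j ih =>
    rw [run, PMF.mem_support_bind_iff] at hh
    obtain ⟨h₁, h1, h2⟩ := hh
    rw [step_eq, PMF.mem_support_bind_iff] at h2
    obtain ⟨e, he, h3⟩ := h2
    exact (ih h1).step he (next_of_mem_support h3)

/-- A round agrees with `a` steps only from histories whose number of attempts is a multiple of `a`;
the histories in the support have this property, and the others carry no mass. -/
theorem play_eq_run (ha : 0 < a) (σ : MakerStrategy n) (τ : BreakerStrategy n b) (t : ℕ) :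
    play a σ τ t = run a σ τ (a * t) [] := by
  induction t with
  | zero => rfl
  | succ t ih =>
    rw [play, ih, mul_add, mul_one, run_add]
    ext1 x
    rw [PMF.bind_apply, PMF.bind_apply]
    refine tsum_congr fun h => ?_
    by_cases hh : h ∈ (run a σ τ (a * t) []).support
    · congr 2
      have hl := (ext_of_mem_support hh).length_observation
      obtain ⟨k, rfl⟩ : ∃ k, a = k + 1 := ⟨a - 1, by omega⟩
      refine makerTurn_bind_breakerTurn σ τ k h le_rfl ?_
      rw [hl]
      simp only [observation, List.length_nil, zero_add]
      exact (dvd_mul_right _ _).add dvd_rfl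
    · rw [(PMF.apply_eq_zero_iff _ h).2 hh, zero_mul, zero_mul]

/-! ### Potential functions -/

/-- The one-step inequalities telescope. They are needed only along `Ext`, where deterministic facts
about reachable histories are available. -/
theorem expect_run_le {σ : MakerStrategy n} {τ : BreakerStrategy n b} {h : History n} {j : ℕ}
    (Φ : ℕ → History n → ℝ≥0∞)
    (hΦ : ∀ i < j, ∀ h', Ext a b σ h i h' → expect (step a σ τ h') (Φ (i + 1)) ≤ Φ i h') :
    expect (run a σ τ j h) (Φ j) ≤ Φ 0 h := by
  induction j with
  | zero => rw [run, expect_pure]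
  | succ j ih =>
    rw [run, expect_bind]
    exact (expect_mono fun h' hh => hΦ j (by omega) h' (ext_of_mem_support hh)).trans
      (ih fun i hi => hΦ i (by omega))

/-- Success probabilities of consecutive segments multiply when the second bound holds from every
reachable state of the first event. This is how the segments of the schedule are glued. -/
theorem mul_le_run_add {σ : MakerStrategy n} {τ : BreakerStrategy n b} {h : History n}
    {i j : ℕ} {s t : Set (History n)} {c d : ℝ≥0∞}
    (hs : c ≤ (run a σ τ i h).toOuterMeasure s)
    (ht : ∀ h', Ext a b σ h i h' → h' ∈ s → d ≤ (run a σ τ j h').toOuterMeasure t) :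
    c * d ≤ (run a σ τ (i + j) h).toOuterMeasure t := by
  rw [run_add]
  exact mul_le_toOuterMeasure_bind _ _ hs fun x hx => ht x (ext_of_mem_support hx)

theorem le_run_of_subset {σ : MakerStrategy n} {τ : BreakerStrategy n b} {h : History n}
    {j : ℕ} {s t : Set (History n)} {c : ℝ≥0∞}
    (hs : c ≤ (run a σ τ j h).toOuterMeasure s) (hst : ∀ h', Ext a b σ h j h' → h' ∈ s → h' ∈ t) :
    c ≤ (run a σ τ j h).toOuterMeasure t :=
  hs.trans (PMF.toOuterMeasure_mono _ fun x hx => hst x (ext_of_mem_support hx.2) hx.1)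

/-! ### Sampling from a set of pairs of vertices -/

/-- The edge with the given endpoints (`e₀` if these coincide). -/
def toEdge (e₀ : Edge n) (p : Fin n × Fin n) : Edge n :=
  if hp : p.1 ≠ p.2 then ⟨s(p.1, p.2), by simpa using hp⟩ else e₀

theorem coe_toEdge (e₀ : Edge n) {p : Fin n × Fin n} (hp : p.1 ≠ p.2) :
    (toEdge e₀ p : Sym2 (Fin n)) = s(p.1, p.2) := by
  rw [toEdge, dif_pos hp]

/-- The edge spanned by a uniformly random element of `s` (`e₀` if `s` is empty). -/
def sample (e₀ : Edge n) (s : Finset (Fin n × Fin n)) : PMF (Edge n) :=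
  if hs : s.Nonempty then (PMF.uniformOfFinset s hs).map (toEdge e₀) else PMF.pure e₀

theorem exists_of_mem_support_sample {e₀ e : Edge n} {s : Finset (Fin n × Fin n)}
    (hs : s.Nonempty) (he : e ∈ (sample e₀ s).support) : ∃ p ∈ s, toEdge e₀ p = e := by
  rw [sample, dif_pos hs, PMF.mem_support_map_iff] at he
  simpa using he

/-- The function `ψ` dominates the new potential whatever Breaker replies, so only the average over
Maker's uniform draw is left, a finite sum over pairs. -/
theorem expect_step_le {σ : MakerStrategy n} {τ : BreakerStrategy n b} {h : History n}
    {e₀ : Edge n} {s : Finset (Fin n × Fin n)} (hs : s.Nonempty)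
    (hσ : σ (observation h) = sample e₀ s) {Φ : History n → ℝ} {ψ : Fin n × Fin n → ℝ} {B : ℝ}
    (hΦ : ∀ p ∈ s, ∀ h', Next a b h (toEdge e₀ p) h' → Φ h' ≤ ψ p) (h0 : ∀ p ∈ s, 0 ≤ ψ p)
    (hB : ∑ p ∈ s, ψ p ≤ B * s.card) :
    expect (step a σ τ h) (fun h' => ENNReal.ofReal (Φ h')) ≤ ENNReal.ofReal B := by
  rw [step_eq, expect_bind, hσ, sample, dif_pos hs, expect_map]
  refine expect_uniformOfFinset_le hs (fun p hp => ?_) h0 hB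
  exact expect_le_of_forall fun h' hh =>
    ENNReal.ofReal_le_ofReal (hΦ p hp h' (next_of_mem_support hh))

end

/-! ### Claimed degrees, and Maker's scheduled strategy -/

section

variable {n a b : ℕ}

/-! ### Degrees in a set of edges -/

/-- The number of edges of `s` at the vertex `v`. -/
def deg (s : Finset (Edge n)) (v : Fin n) : ℕ := (s.filter fun e : Edge n => v ∈ (e : Sym2 (Fin n))).card

/-- The vertices `x` and `y` span an edge of `s`. -/
def Joined (s : Finset (Edge n)) (x y : Fin n) : Prop := ∃ e ∈ s, (e : Sym2 (Fin n)) = s(x, y)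

theorem Joined.symm {s : Finset (Edge n)} {x y : Fin n} (h : Joined s x y) : Joined s y x := by
  obtain ⟨e, he, h⟩ := h
  exact ⟨e, he, h.trans Sym2.eq_swap⟩

theorem Joined.mono {s t : Finset (Edge n)} {x y : Fin n} (h : Joined s x y) (hst : s ⊆ t) :
    Joined t x y := by
  obtain ⟨e, he, h⟩ := h
  exact ⟨e, hst he, h⟩

theorem Joined.ne {s : Finset (Edge n)} {x y : Fin n} (h : Joined s x y) : x ≠ y := by
  obtain ⟨e, he, h⟩ := h
  have := e.2
  rw [h] at this
  simpa using this

theorem toEdge_mem_iff {e₀ : Edge n} {s : Finset (Edge n)} {p : Fin n × Fin n} (hp : p.1 ≠ p.2) :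
    toEdge e₀ p ∈ s ↔ Joined s p.1 p.2 := by
  constructor
  · exact fun h => ⟨_, h, coe_toEdge e₀ hp⟩
  · rintro ⟨e, he, h⟩
    rwa [show toEdge e₀ p = e from Subtype.ext ((coe_toEdge e₀ hp).trans h.symm)]

theorem deg_mono {s t : Finset (Edge n)} (hst : s ⊆ t) (v : Fin n) : deg s v ≤ deg t v :=
  Finset.card_le_card (Finset.filter_subset_filter _ hst)

theorem deg_le_card (s : Finset (Edge n)) (v : Fin n) : deg s v ≤ s.card :=
  Finset.card_filter_le _ _

theorem deg_union_le (s r : Finset (Edge n)) (v : Fin n) : deg (s ∪ r) v ≤ deg s v + deg r v := by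
  unfold deg
  rw [Finset.filter_union]
  exact Finset.card_union_le _ _

theorem sum_deg_le (U : Finset (Fin n)) (s : Finset (Edge n)) : ∑ v ∈ U, deg s v ≤ 2 * s.card := by
  have h1 : ∑ v ∈ U, deg s v = ∑ e ∈ s, {v ∈ U | v ∈ (e : Sym2 (Fin n))}.card := by
    simp only [deg, Finset.card_filter]
    exact Finset.sum_comm
  rw [h1, mul_comm]
  refine Finset.sum_le_card_nsmul _ _ _ fun e _ => ?_
  obtain ⟨⟨x, y⟩, hxy⟩ := Quot.exists_rep (e : Sym2 (Fin n))
  change s(x, y) = _ at hxy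
  rw [← hxy]
  refine (Finset.card_le_card (t := {x, y}) fun v hv => ?_).trans Finset.card_le_two
  simpa using (Finset.mem_filter.1 hv).2

open Classical in
theorem card_joined (s : Finset (Edge n)) (v : Fin n) :
    (Finset.univ.filter (Joined s v)).card = deg s v := by
  unfold deg
  symm
  refine Finset.card_bij (fun e he => Sym2.Mem.other (Finset.mem_filter.1 he).2) ?_ ?_ ?_
  · intro e he
    simp only [Finset.mem_filter, Finset.mem_univ, true_and]
    exact ⟨e, (Finset.mem_filter.1 he).1, (Sym2.other_spec _).symm⟩
  · intro e he e' he' heq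
    apply Subtype.ext
    have h1 := Sym2.other_spec (Finset.mem_filter.1 he).2
    have h2 := Sym2.other_spec (Finset.mem_filter.1 he').2
    rw [← h1, ← h2, heq]
  · intro y hy
    obtain ⟨e, he, hey⟩ := (Finset.mem_filter.1 hy).2
    refine ⟨e, Finset.mem_filter.2 ⟨he, by rw [hey]; exact Sym2.mem_mk_left _ _⟩, ?_⟩
    have hv : v ∈ (e : Sym2 (Fin n)) := by rw [hey]; exact Sym2.mem_mk_left _ _
    exact Sym2.congr_right.1 ((Sym2.other_spec hv).trans hey)

open Classical in
/-- The number of ordered pairs of vertices that span an edge of `s`. -/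
theorem card_filter_joined_le (s : Finset (Edge n)) (U : Finset (Fin n))
    (P : Finset (Fin n × Fin n)) (hP : ∀ p ∈ P, p.1 ∈ U) :
    (P.filter fun p => Joined s p.1 p.2).card ≤ ∑ v ∈ U, deg s v := by
  have h1 : P.filter (fun p => Joined s p.1 p.2) ⊆
      U.biUnion fun v => (Finset.univ.filter (Joined s v)).image (Prod.mk v) := by
    intro p hp
    rw [Finset.mem_filter] at hp
    simp only [Finset.mem_biUnion, Finset.mem_image, Finset.mem_filter, Finset.mem_univ, true_and]
    exact ⟨p.1, hP p hp.1, p.2, hp.2, rfl⟩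
  refine (Finset.card_le_card h1).trans (Finset.card_biUnion_le.trans ?_)
  refine Finset.sum_le_sum fun v _ => ?_
  exact Finset.card_image_le.trans (card_joined s v).le

/-! ### The claimed edges -/

/-- The claimed edges. -/
def claimed (h : History n) : Finset (Edge n) := makerEdges h ∪ breakerEdges h

theorem mem_freeEdges {h : History n} {e : Edge n} : e ∈ freeEdges h ↔ e ∉ claimed h := by
  simp [freeEdges, claimed]

theorem makerEdges_attempted (h : History n) (e : Edge n) :
    makerEdges (attempted h e) = if e ∈ claimed h then makerEdges h else insert e (makerEdges h) := by
  unfold attempted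
  by_cases he : e ∈ claimed h
  · simp [mem_freeEdges, he, makerEdges]
  · simp [mem_freeEdges, he, makerEdges]

theorem Next.makerEdges_eq {h h' : History n} {e : Edge n} (hn : Next a b h e h') :
    makerEdges h' = if e ∈ claimed h then makerEdges h else insert e (makerEdges h) := by
  rw [← makerEdges_attempted]
  rcases hn with rfl | ⟨_, s, _, rfl⟩ <;> rfl

theorem Next.makerEdges_subset {h h' : History n} {e : Edge n} (hn : Next a b h e h') :
    makerEdges h ⊆ makerEdges h' := by
  rw [hn.makerEdges_eq]
  split_ifs
  · exact subset_rfl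
  · exact Finset.subset_insert _ _

theorem Next.exists_breakerEdges {h h' : History n} {e : Edge n} (hn : Next a b h e h') :
    ∃ r : Finset (Edge n), r.card ≤ b ∧ breakerEdges h' = breakerEdges h ∪ r := by
  rcases hn with rfl | ⟨_, s, hs, rfl⟩
  · exact ⟨∅, by simp, by simp [attempted, breakerEdges]⟩
  · exact ⟨s, hs, by simp [attempted, breakerEdges, Finset.union_comm]⟩

theorem Next.exists_claimed {h h' : History n} {e : Edge n} (hn : Next a b h e h') :
    ∃ r : Finset (Edge n), r.card ≤ b + 1 ∧ claimed h' = claimed h ∪ r := by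
  obtain ⟨r, hr, hb⟩ := hn.exists_breakerEdges
  refine ⟨insert e r, (Finset.card_insert_le _ _).trans (by omega), ?_⟩
  have hm := hn.makerEdges_eq
  ext x
  by_cases he : e ∈ claimed h
  · rw [if_pos he] at hm
    simp only [claimed, hb, hm, Finset.mem_union, Finset.mem_insert] at he ⊢
    constructor
    · tauto
    · rintro (h1 | rfl | h1) <;> tauto
  · rw [if_neg he] at hm
    simp only [claimed, hb, hm, Finset.mem_union, Finset.mem_insert]
    tauto

theorem Ext.exists_claimed {σ : MakerStrategy n} {h h' : History n} {j : ℕ}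
    (hx : Ext a b σ h j h') :
    ∃ r : Finset (Edge n), r.card ≤ (b + 1) * j ∧ claimed h' = claimed h ∪ r := by
  induction hx with
  | refl => exact ⟨∅, by simp, by simp⟩
  | step _ _ hn ih =>
    obtain ⟨r, hr, h1⟩ := ih
    obtain ⟨r', hr', h2⟩ := hn.exists_claimed
    refine ⟨r ∪ r', (Finset.card_union_le _ _).trans ?_, by rw [h2, h1, Finset.union_assoc]⟩
    rw [mul_add, mul_one]
    omega

theorem Ext.makerEdges_subset {σ : MakerStrategy n} {h h' : History n} {j : ℕ}
    (hx : Ext a b σ h j h') : makerEdges h ⊆ makerEdges h' := by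
  induction hx with
  | refl => exact subset_rfl
  | step _ _ hn ih => exact ih.trans hn.makerEdges_subset

theorem Ext.deg_claimed_le {σ : MakerStrategy n} {h h' : History n} {j : ℕ}
    (hx : Ext a b σ h j h') (v : Fin n) :
    deg (claimed h') v ≤ deg (claimed h) v + (b + 1) * j := by
  obtain ⟨r, hr, h1⟩ := hx.exists_claimed
  rw [h1]
  exact (deg_union_le _ _ _).trans (Nat.add_le_add_left ((deg_le_card _ _).trans hr) _)

theorem Ext.deg_breakerEdges_le {σ : MakerStrategy n} {h h' : History n} {j : ℕ}
    (hx : Ext a b σ h j h') (v : Fin n) :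
    deg (breakerEdges h') v ≤ deg (breakerEdges h) v + b * j := by
  induction hx with
  | refl => simp
  | step _ _ hn ih =>
    obtain ⟨r, hr, h1⟩ := hn.exists_breakerEdges
    rw [h1, mul_add, mul_one]
    refine (deg_union_le _ r v).trans ?_
    have := deg_le_card r v
    omega

theorem sum_deg_union_le (U : Finset (Fin n)) (s r : Finset (Edge n)) :
    ∑ v ∈ U, deg (s ∪ r) v ≤ ∑ v ∈ U, deg s v + 2 * r.card := by
  calc ∑ v ∈ U, deg (s ∪ r) v ≤ ∑ v ∈ U, (deg s v + deg r v) :=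
        Finset.sum_le_sum fun v _ => deg_union_le s r v
    _ = ∑ v ∈ U, deg s v + ∑ v ∈ U, deg r v := Finset.sum_add_distrib
    _ ≤ _ := Nat.add_le_add_left (sum_deg_le U r) _

theorem Ext.card_claimed_le {σ : MakerStrategy n} {h : History n} {j : ℕ}
    (hx : Ext a b σ [] j h) : (claimed h).card ≤ (b + 1) * j := by
  obtain ⟨r, hr, h1⟩ := hx.exists_claimed
  rw [h1]
  simpa [claimed, makerEdges, breakerEdges] using hr

/-- Breaker answers once per `a` attempts. The cruder bounds on claimed edges lose this division by
`a`; the case `b ≤ 2 * a` depends on it. -/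
theorem Ext.card_breakerEdges_le {σ : MakerStrategy n} {h : History n} {j : ℕ}
    (hx : Ext a b σ [] j h) : (breakerEdges h).card ≤ b * (j / a) := by
  induction hx with
  | refl => simp [breakerEdges]
  | @step j h' h'' e hx _ hn ih =>
    have hl := hx.length_observation
    simp only [observation, List.length_nil, zero_add] at hl
    rcases hn with rfl | ⟨hd, s, hs, rfl⟩
    · refine ih.trans ?_
      gcongr
      omega
    · rw [hl] at hd
      rw [Nat.succ_div_of_dvd hd, mul_add, mul_one]
      change (s ∪ breakerEdges h').card ≤ _
      exact (Finset.card_union_le _ _).trans (by omega)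

/-! ### Maker's strategy -/

/-- The purpose of an attempt: to expose a random pair of the vertices that are not yet exposed,
to gain edges at a vertex whose exposure failed, or to repair a failure. -/
inductive Phase : Type
  | main
  | attach (i : ℕ)
  | fix (i : ℕ)

/-- The edges that Maker has won. -/
def won : List (Edge n × Bool) → Finset (Edge n)
  | [] => ∅
  | (e, true) :: o => insert e (won o)
  | (_, false) :: o => won o

theorem won_observation (h : History n) : won (observation h) = makerEdges h := by
  induction h with
  | nil => rfl
  | cons x h ih =>
    match x with
    | Event.attempt e true => simp only [observation, won, makerEdges, ih]
    | Event.attempt e false => simp only [observation, won, makerEdges, ih]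
    | Event.reply s => simp only [observation, makerEdges, ih]

variable (sched : ℕ → Phase)

/-- The attempts that served to expose a pair of vertices. -/
def exposures : List (Edge n × Bool) → List (Edge n × Bool)
  | [] => []
  | p :: o => match sched o.length with
    | Phase.main => p :: exposures o
    | _ => exposures o

/-- The vertices that are not yet exposed. -/
def unexposed (o : List (Edge n × Bool)) : Finset (Fin n) :=
  {v | ∀ p ∈ exposures sched o, v ∉ (p.1 : Sym2 (Fin n))}

/-- The exposed pairs that could not be claimed. -/
def failed (o : List (Edge n × Bool)) : List (Edge n) :=
  ((exposures sched o).filter fun p => !p.2).map Prod.fst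

/-- The vertices of the exposed pairs that could not be claimed. -/
def failedVerts (o : List (Edge n × Bool)) : Finset (Fin n) :=
  {v | ∃ e ∈ failed sched o, v ∈ (e : Sym2 (Fin n))}

/-- The vertices `x` and `y` form an exposed pair that was claimed. -/
def IsMate (o : List (Edge n × Bool)) (x y : Fin n) : Prop :=
  ∃ p ∈ exposures sched o, p.2 = true ∧ (p.1 : Sym2 (Fin n)) = s(x, y)

open Classical in
/-- The vertex that forms a claimed exposed pair with `x` (and `x` itself if there is none). -/
def mate (o : List (Edge n × Bool)) (x : Fin n) : Fin n :=
  if h : ∃ y, IsMate sched o x y then h.choose else x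

/-- The vertices touched by attempts to repair a failure. -/
def touched : List (Edge n × Bool) → Finset (Fin n)
  | [] => ∅
  | p :: o => match sched o.length with
    | Phase.fix _ => Finset.univ.filter (fun v => v ∈ (p.1 : Sym2 (Fin n))) ∪ touched o
    | _ => touched o

/-- The vertex `y` may be used to repair a failure. -/
def Available (o : List (Edge n × Bool)) (y : Fin n) : Prop :=
  y ∉ failedVerts sched o ∧ y ∉ touched sched o ∧ mate sched o y ∉ touched sched o

open Classical in
/-- The pairs `(p, q)` such that an edge between them completes an augmenting path from `v` to
`w`. -/
def repairSet (o : List (Edge n × Bool)) (v w : Fin n) : Finset (Fin n × Fin n) :=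
  Finset.univ.filter fun p => p.1 ≠ p.2 ∧ mate sched o p.1 ≠ p.2 ∧
    Available sched o p.1 ∧ Available sched o p.2 ∧
    Joined (won o) v (mate sched o p.1) ∧ Joined (won o) w (mate sched o p.2)

/-- The pairs of vertices from which Maker chooses. -/
def moveSet (o : List (Edge n × Bool)) : Finset (Fin n × Fin n) :=
  match sched o.length with
  | Phase.main => (unexposed sched o).offDiag
  | Phase.attach i =>
    match (failedVerts sched o).toList[i]? with
    | some v => {v} ×ˢ Finset.univ.erase v
    | none => ∅
  | Phase.fix i =>
    match (failed sched o)[i]? with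
    | some e => repairSet sched o (e : Sym2 (Fin n)).out.1 (e : Sym2 (Fin n)).out.2
    | none => ∅

/-- Maker chooses a uniformly random pair of vertices from the current move set. -/
def strategy (e₀ : Edge n) : MakerStrategy n := fun o => sample e₀ (moveSet sched o)

variable {sched}

theorem exposures_cons_main {o : List (Edge n × Bool)} (p : Edge n × Bool)
    (ho : sched o.length = Phase.main) : exposures sched (p :: o) = p :: exposures sched o := by
  rw [exposures, ho]

theorem exposures_cons_of_ne {o : List (Edge n × Bool)} (p : Edge n × Bool)
    (ho : sched o.length ≠ Phase.main) : exposures sched (p :: o) = exposures sched o := by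
  rw [exposures]
  split
  · contradiction
  · rfl

theorem touched_cons_fix {o : List (Edge n × Bool)} (p : Edge n × Bool) {i : ℕ}
    (ho : sched o.length = Phase.fix i) :
    touched sched (p :: o) = Finset.univ.filter (fun v => v ∈ (p.1 : Sym2 (Fin n))) ∪ touched sched o := by
  rw [touched, ho]

theorem touched_cons_of_ne {o : List (Edge n × Bool)} (p : Edge n × Bool)
    (ho : ∀ i, sched o.length ≠ Phase.fix i) : touched sched (p :: o) = touched sched o := by
  rw [touched]
  split
  · exact absurd (by assumption) (ho _)
  · rfl

theorem moveSet_main {o : List (Edge n × Bool)} (ho : sched o.length = Phase.main) :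
    moveSet sched o = (unexposed sched o).offDiag := by
  rw [moveSet, ho]

theorem moveSet_attach {o : List (Edge n × Bool)} {i : ℕ} (ho : sched o.length = Phase.attach i)
    {v : Fin n} (hv : (failedVerts sched o).toList[i]? = some v) :
    moveSet sched o = {v} ×ˢ Finset.univ.erase v := by
  rw [moveSet, ho]
  simp only [hv]

theorem moveSet_fix {o : List (Edge n × Bool)} {i : ℕ} (ho : sched o.length = Phase.fix i)
    {e : Edge n} (he : (failed sched o)[i]? = some e) :
    moveSet sched o = repairSet sched o (e : Sym2 (Fin n)).out.1 (e : Sym2 (Fin n)).out.2 := by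
  rw [moveSet, ho]
  simp only [he]

end

/-! ### Exposing random pairs: failures, average degree, hitting a given set -/

section

variable {n a b : ℕ} {sched : ℕ → Phase} {e₀ : Edge n}

/-! ### The structure of the exposures -/

theorem exposures_next_main {h h' : History n} {e : Edge n} (hn : Next a b h e h')
    (hs : sched (observation h).length = Phase.main) :
    exposures sched (observation h') =
      (e, decide (e ∈ freeEdges h)) :: exposures sched (observation h) := by
  rw [hn.observation_eq, exposures_cons_main _ hs]

theorem exposures_next_of_ne {h h' : History n} {e : Edge n} (hn : Next a b h e h')
    (hs : sched (observation h).length ≠ Phase.main) :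
    exposures sched (observation h') = exposures sched (observation h) := by
  rw [hn.observation_eq, exposures_cons_of_ne _ hs]

theorem mem_unexposed {o : List (Edge n × Bool)} {v : Fin n} :
    v ∈ unexposed sched o ↔ ∀ p ∈ exposures sched o, v ∉ (p.1 : Sym2 (Fin n)) := by
  simp [unexposed]

theorem mem_failedVerts {o : List (Edge n × Bool)} {v : Fin n} :
    v ∈ failedVerts sched o ↔ ∃ e ∈ failed sched o, v ∈ (e : Sym2 (Fin n)) := by
  simp [failedVerts]

theorem mem_failed {o : List (Edge n × Bool)} {e : Edge n} :
    e ∈ failed sched o ↔ (e, false) ∈ exposures sched o := by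
  simp [failed]

theorem unexposed_nil : unexposed sched (observation ([] : History n)) = Finset.univ := by
  ext v
  simp [mem_unexposed, observation, exposures]

theorem failed_nil : failed sched (observation ([] : History n)) = [] := rfl

theorem unexposed_next_main {h h' : History n} {p : Fin n × Fin n}
    (hn : Next a b h (toEdge e₀ p) h') (hs : sched (observation h).length = Phase.main)
    (hp : p.1 ≠ p.2) :
    unexposed sched (observation h') = unexposed sched (observation h) \ {p.1, p.2} := by
  ext v
  simp only [mem_unexposed, exposures_next_main hn hs, List.forall_mem_cons, coe_toEdge e₀ hp,
    Finset.mem_sdiff, Finset.mem_insert, Finset.mem_singleton, Sym2.mem_iff]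
  tauto

theorem card_unexposed_next_main {h h' : History n} {p : Fin n × Fin n}
    (hn : Next a b h (toEdge e₀ p) h') (hs : sched (observation h).length = Phase.main)
    (hp : p ∈ (unexposed sched (observation h)).offDiag) :
    (unexposed sched (observation h')).card = (unexposed sched (observation h)).card - 2 := by
  rw [Finset.mem_offDiag] at hp
  rw [unexposed_next_main hn hs hp.2.2, Finset.card_sdiff_of_subset, Finset.card_pair hp.2.2]
  intro v hv
  rw [Finset.mem_insert, Finset.mem_singleton] at hv
  rcases hv with rfl | rfl
  exacts [hp.1, hp.2.1]

theorem failed_next_main {h h' : History n} {e : Edge n} (hn : Next a b h e h')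
    (hs : sched (observation h).length = Phase.main) :
    failed sched (observation h') =
      if e ∈ claimed h then e :: failed sched (observation h) else failed sched (observation h) := by
  unfold failed
  rw [exposures_next_main hn hs]
  by_cases he : e ∈ claimed h <;> simp [mem_freeEdges, he]

theorem card_failedVerts_le (o : List (Edge n × Bool)) :
    (failedVerts sched o).card ≤ 2 * (failed sched o).length := by
  have h1 : failedVerts sched o ⊆ (failed sched o).toFinset.biUnion fun e =>
      {(e : Sym2 (Fin n)).out.1, (e : Sym2 (Fin n)).out.2} := by
    intro v hv
    obtain ⟨e, he, hve⟩ := mem_failedVerts.1 hv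
    rw [Finset.mem_biUnion]
    refine ⟨e, List.mem_toFinset.2 he, ?_⟩
    rw [← Quot.out_eq (e : Sym2 (Fin n))] at hve
    have : v ∈ s((e : Sym2 (Fin n)).out.1, (e : Sym2 (Fin n)).out.2) := hve
    simpa using this
  refine (Finset.card_le_card h1).trans (Finset.card_biUnion_le.trans ?_)
  refine (Finset.sum_le_card_nsmul _ _ 2 fun e _ => Finset.card_le_two).trans ?_
  rw [smul_eq_mul, mul_comm]
  exact Nat.mul_le_mul_left _ (List.toFinset_card_le _)

/-- The exposed pairs are disjoint, and Maker owns those that she was able to claim. -/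
structure WellFormed (sched : ℕ → Phase) (h : History n) : Prop where
  disjoint : (exposures sched (observation h)).Pairwise
    fun p q => ∀ v, v ∈ (p.1 : Sym2 (Fin n)) → v ∉ (q.1 : Sym2 (Fin n))
  owned : ∀ p ∈ exposures sched (observation h), p.2 = true → p.1 ∈ makerEdges h

theorem wellFormed_nil : WellFormed sched ([] : History n) :=
  ⟨List.Pairwise.nil, fun p hp => by simp [observation, exposures] at hp⟩

theorem offDiag_nonempty {U : Finset (Fin n)} (hU : 2 ≤ U.card) : U.offDiag.Nonempty := by
  obtain ⟨x, hx, y, hy, hxy⟩ := Finset.one_lt_card.1 (show 1 < U.card by omega)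
  exact ⟨(x, y), by simp [hx, hy, hxy]⟩

/-- Every exposure draws two distinct unexposed vertices. The third clause matters most: a vertex
that fails in the segment was unexposed at its start, so degree bounds for unexposed vertices carry
over to the new failures. -/
theorem Ext.main_segment {h h' : History n} {j : ℕ} (hx : Ext a b (strategy sched e₀) h j h')
    (hs : ∀ i < j, sched ((observation h).length + i) = Phase.main)
    (hU : 2 * j ≤ (unexposed sched (observation h)).card) :
    (unexposed sched (observation h')).card + 2 * j = (unexposed sched (observation h)).card ∧
    unexposed sched (observation h') ⊆ unexposed sched (observation h) ∧
    failedVerts sched (observation h') ⊆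
      failedVerts sched (observation h) ∪ unexposed sched (observation h) ∧
    (WellFormed sched h → WellFormed sched h') := by
  induction hx with
  | refl => exact ⟨rfl, subset_rfl, Finset.subset_union_left, id⟩
  | @step j h₁ h₂ e hx he hn ih =>
    obtain ⟨ih1, ih2, ih3, ih4⟩ := ih (fun i hi => hs i (by omega)) (by omega)
    have hs' : sched (observation h₁).length = Phase.main := by
      rw [hx.length_observation]; exact hs j (by omega)
    rw [strategy, moveSet_main hs'] at he
    obtain ⟨p, hp, rfl⟩ := exists_of_mem_support_sample (offDiag_nonempty (by omega)) he
    have hp' := Finset.mem_offDiag.1 hp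
    refine ⟨?_, ?_, ?_, fun hw => ⟨?_, ?_⟩⟩
    · rw [card_unexposed_next_main hn hs' hp]
      omega
    · rw [unexposed_next_main hn hs' hp'.2.2]
      exact Finset.sdiff_subset.trans ih2
    · intro v hv
      obtain ⟨e, he, hve⟩ := mem_failedVerts.1 hv
      rw [mem_failed, exposures_next_main hn hs', List.mem_cons] at he
      rcases he with he | he
      · rw [Prod.mk.injEq] at he
        rw [he.1, coe_toEdge e₀ hp'.2.2, Sym2.mem_iff] at hve
        rw [Finset.mem_union]
        right
        rcases hve with rfl | rfl
        exacts [ih2 hp'.1, ih2 hp'.2.1]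
      · exact ih3 (mem_failedVerts.2 ⟨e, mem_failed.2 he, hve⟩)
    · rw [exposures_next_main hn hs', List.pairwise_cons]
      refine ⟨fun q hq v hv => ?_, (ih4 hw).disjoint⟩
      rw [coe_toEdge e₀ hp'.2.2, Sym2.mem_iff] at hv
      rcases hv with rfl | rfl
      exacts [mem_unexposed.1 hp'.1 q hq, mem_unexposed.1 hp'.2.1 q hq]
    · intro q hq hq2
      rw [exposures_next_main hn hs', List.mem_cons] at hq
      rcases hq with rfl | hq
      · simp only [decide_eq_true_eq, mem_freeEdges] at hq2
        rw [hn.makerEdges_eq, if_neg hq2]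
        exact Finset.mem_insert_self _ _
      · exact hn.makerEdges_subset ((ih4 hw).owned q hq hq2)

theorem Ext.exposures_eq {σ : MakerStrategy n} {h h' : History n} {j : ℕ}
    (hx : Ext a b σ h j h') (hs : ∀ i < j, sched ((observation h).length + i) ≠ Phase.main) :
    exposures sched (observation h') = exposures sched (observation h) := by
  induction hx with
  | refl => rfl
  | @step j h₁ h₂ e hx he hn ih =>
    rw [exposures_next_of_ne hn, ih fun i hi => hs i (by omega)]
    rw [hx.length_observation]
    exact hs j (by omega)

theorem unexposed_congr {o o' : List (Edge n × Bool)} (h : exposures sched o' = exposures sched o) :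
    unexposed sched o' = unexposed sched o := by
  unfold unexposed; rw [h]

theorem failed_congr {o o' : List (Edge n × Bool)} (h : exposures sched o' = exposures sched o) :
    failed sched o' = failed sched o := by
  unfold failed; rw [h]

theorem failedVerts_congr {o o' : List (Edge n × Bool)}
    (h : exposures sched o' = exposures sched o) :
    failedVerts sched o' = failedVerts sched o := by
  unfold failedVerts; rw [failed_congr h]

theorem mate_congr {o o' : List (Edge n × Bool)} (h : exposures sched o' = exposures sched o) :
    mate sched o' = mate sched o := by
  have : IsMate sched o' = IsMate sched o := by
    unfold IsMate; rw [h]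
  unfold mate; rw [this]

theorem WellFormed.of_exposures_eq {h h' : History n} (hw : WellFormed sched h)
    (he : exposures sched (observation h') = exposures sched (observation h))
    (hm : makerEdges h ⊆ makerEdges h') : WellFormed sched h' :=
  ⟨by rw [he]; exact hw.disjoint, by rw [he]; exact fun p hp h2 => hm (hw.owned p hp h2)⟩

/-! ### Sums over pairs -/

theorem sum_offDiag_add (U : Finset (Fin n)) (f : Fin n → ℝ) :
    ∑ p ∈ U.offDiag, (f p.1 + f p.2) = 2 * (U.card - 1) * ∑ u ∈ U, f u := by
  have h1 : ∑ p ∈ U ×ˢ U, (f p.1 + f p.2) =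
      ∑ p ∈ U.diag, (f p.1 + f p.2) + ∑ p ∈ U.offDiag, (f p.1 + f p.2) := by
    rw [← Finset.diag_union_offDiag, Finset.sum_union (Finset.disjoint_diag_offDiag U)]
  have h2 : ∑ p ∈ U.diag, (f p.1 + f p.2) = 2 * ∑ u ∈ U, f u := by
    rw [Finset.diag, Finset.sum_map, Finset.mul_sum]
    exact Finset.sum_congr rfl fun u _ => (two_mul _).symm
  have h3 : ∑ p ∈ U ×ˢ U, (f p.1 + f p.2) = 2 * U.card * ∑ u ∈ U, f u := by
    rw [Finset.sum_product]
    simp only [Finset.sum_add_distrib, Finset.sum_const, nsmul_eq_mul, ← Finset.mul_sum]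
    ring
  linear_combination h3 - h1 - h2

theorem card_offDiag_real (U : Finset (Fin n)) :
    (U.offDiag.card : ℝ) = U.card * (U.card - 1) := by
  rw [Finset.offDiag_card, Nat.cast_sub (Nat.le_mul_self _)]
  push_cast
  ring

/-! ### The number of failures -/

/-- The total number of claimed edges at the unexposed vertices. -/
def load (sched : ℕ → Phase) (h : History n) : ℕ :=
  ∑ u ∈ unexposed sched (observation h), deg (claimed h) u

/-- The two exposed vertices leave the sum with their degrees, and at most `b + 1` new edges,
Maker's and Breaker's, contribute at most two each. -/
theorem load_next_main {h h' : History n} {p : Fin n × Fin n}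
    (hn : Next a b h (toEdge e₀ p) h') (hs : sched (observation h).length = Phase.main)
    (hp : p ∈ (unexposed sched (observation h)).offDiag) :
    (load sched h' : ℝ) ≤
      load sched h - (deg (claimed h) p.1 + deg (claimed h) p.2) + 2 * (b + 1) := by
  rw [Finset.mem_offDiag] at hp
  obtain ⟨r, hr, hc⟩ := hn.exists_claimed
  have h1 : load sched h' ≤
      ∑ u ∈ unexposed sched (observation h) \ {p.1, p.2}, deg (claimed h) u + 2 * (b + 1) := by
    unfold load
    rw [unexposed_next_main hn hs hp.2.2, hc]
    exact (sum_deg_union_le _ _ _).trans (by omega)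
  have h2 : ∑ u ∈ unexposed sched (observation h) \ {p.1, p.2}, deg (claimed h) u +
      (deg (claimed h) p.1 + deg (claimed h) p.2) = load sched h := by
    rw [← Finset.sum_pair hp.2.2]
    refine Finset.sum_sdiff fun v hv => ?_
    rw [Finset.mem_insert, Finset.mem_singleton] at hv
    rcases hv with rfl | rfl
    exacts [hp.1, hp.2.1]
  have h1' : (load sched h' : ℝ) ≤ (∑ u ∈ unexposed sched (observation h) \ {p.1, p.2},
      deg (claimed h) u : ℕ) + 2 * (b + 1) := by exact_mod_cast h1
  have h2' : ((∑ u ∈ unexposed sched (observation h) \ {p.1, p.2}, deg (claimed h) u : ℕ) : ℝ) +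
      (deg (claimed h) p.1 + deg (claimed h) p.2) = load sched h := by exact_mod_cast h2
  linarith

/-- Twice the harmonic number. -/
def weight (m : ℕ) : ℝ := ∑ i ∈ Finset.range m, 2 / ((i : ℝ) + 1)

theorem weight_nonneg (m : ℕ) : 0 ≤ weight m := Finset.sum_nonneg fun i _ => by positivity

theorem weight_add_two (m : ℕ) : weight (m + 2) = weight m + 2 / (m + 1) + 2 / (m + 2) := by
  unfold weight
  rw [Finset.sum_range_succ, Finset.sum_range_succ]
  push_cast
  ring

theorem weight_mono {m m' : ℕ} (h : m ≤ m') : weight m ≤ weight m' :=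
  Finset.sum_le_sum_of_subset_of_nonneg (by simpa using h) fun i _ _ => by positivity

/-- A supermartingale that bounds the number of failures in excess of `K`. -/
def failurePotential (b : ℕ) (sched : ℕ → Phase) (K : ℕ) (h : History n) : ℝ :=
  ((failed sched (observation h)).length - K) +
    weight (unexposed sched (observation h)).card *
      (load sched h / (unexposed sched (observation h)).card) +
    (b + 1) * weight (unexposed sched (observation h)).card ^ 2

/-- A supermartingale that bounds the average degree of the unexposed vertices. -/
def averagePotential (b : ℕ) (sched : ℕ → Phase) (h : History n) : ℝ :=
  load sched h / (unexposed sched (observation h)).card +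
    (b + 1) * weight (unexposed sched (observation h)).card

theorem deg_add_deg_le_load {h : History n} {p : Fin n × Fin n}
    (hp : p ∈ (unexposed sched (observation h)).offDiag) :
    (deg (claimed h) p.1 + deg (claimed h) p.2 : ℝ) ≤ load sched h := by
  rw [Finset.mem_offDiag] at hp
  have : deg (claimed h) p.1 + deg (claimed h) p.2 ≤ load sched h := by
    rw [← Finset.sum_pair hp.2.2]
    refine Finset.sum_le_sum_of_subset fun v hv => ?_
    rw [Finset.mem_insert, Finset.mem_singleton] at hv
    rcases hv with rfl | rfl
    exacts [hp.1, hp.2.1]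
  exact_mod_cast this

-- With `m + 2` unexposed vertices and load `D`, failure has probability at most `D / ((m + 2) (m +
-- 1))`; the drop of `weight` pays for it in the term linear in the average degree. New edges raise
-- the expected average degree by at most `2 (b + 1) / m`, which the drop of the squared weight pays
-- for.
open Classical in
theorem expect_failurePotential_le {τ : BreakerStrategy n b} {h : History n} {K : ℕ}
    (hK : K ≤ (failed sched (observation h)).length)
    (hs : sched (observation h).length = Phase.main)
    (hU : 2 ≤ (unexposed sched (observation h)).card) :
    expect (step a (strategy sched e₀) τ h) (fun h' => ENNReal.ofReal (failurePotential b sched K h'))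
      ≤ ENNReal.ofReal (failurePotential b sched K h) := by
  obtain ⟨m, hm⟩ : ∃ m, (unexposed sched (observation h)).card = m + 2 :=
    ⟨_, (Nat.sub_add_cancel hU).symm⟩
  set U := unexposed sched (observation h) with hUdef
  set F : ℝ := ((failed sched (observation h)).length : ℝ) - K with hF
  set D : ℝ := (load sched h : ℝ) with hD
  have hw := weight_nonneg m
  have hc0 : (0 : ℝ) ≤ weight m / m := by positivity
  -- When the last pair is exposed, `m = 0` and the quotient is `0` by convention; the identity
  -- survives because `weight 0 = 0`.
  have hcm : weight m / m * m = weight m := by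
    rcases Nat.eq_zero_or_pos m with rfl | hm0
    · simp [weight]
    · field_simp
  refine expect_step_le (offDiag_nonempty hU) (by rw [strategy, moveSet_main hs])
    (ψ := fun p => F + (if Joined (claimed h) p.1 p.2 then 1 else 0) +
      weight m / m * (D - (deg (claimed h) p.1 + deg (claimed h) p.2) + 2 * (b + 1)) +
      (b + 1) * weight m ^ 2) ?_ ?_ ?_
  · intro p hp h' hn
    have hp' := Finset.mem_offDiag.1 hp
    have h1 := load_next_main hn hs hp
    have h2 := card_unexposed_next_main hn hs hp
    rw [← hUdef, hm, Nat.add_sub_cancel] at h2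
    unfold failurePotential
    rw [h2, failed_next_main hn hs]
    have hmem := toEdge_mem_iff (e₀ := e₀) (s := claimed h) hp'.2.2
    have h3 : weight m * (load sched h' / m) ≤
        weight m / m * (D - (deg (claimed h) p.1 + deg (claimed h) p.2) + 2 * (b + 1)) := by
      calc weight m * (load sched h' / m) = weight m / m * load sched h' := by ring
        _ ≤ _ := by gcongr
    by_cases hj : Joined (claimed h) p.1 p.2
    · rw [if_pos hj, if_pos (hmem.2 hj), List.length_cons]
      push_cast
      linarith
    · rw [if_neg hj, if_neg fun h => hj (hmem.1 h)]
      linarith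
  · intro p hp
    have h1 := deg_add_deg_le_load hp
    rw [← hD] at h1
    have h2 : 0 ≤ weight m / m * (D - (deg (claimed h) p.1 + deg (claimed h) p.2) + 2 * (b + 1)) :=
      mul_nonneg hc0 (by linarith [show (0 : ℝ) ≤ 2 * (b + 1) by positivity])
    have h3 : (0 : ℝ) ≤ if Joined (claimed h) p.1 p.2 then 1 else 0 := by split_ifs <;> norm_num
    have h4 : 0 ≤ F := sub_nonneg.2 (by exact_mod_cast hK)
    positivity
  · have hI : ∑ p ∈ U.offDiag, (if Joined (claimed h) p.1 p.2 then (1 : ℝ) else 0) ≤ D := by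
      rw [Finset.sum_boole, hD]
      exact_mod_cast card_filter_joined_le (claimed h) U U.offDiag
        fun p hp => (Finset.mem_offDiag.1 hp).1
    have hS := sum_offDiag_add U (fun u => (deg (claimed h) u : ℝ))
    have hDs : ∑ u ∈ U, (deg (claimed h) u : ℝ) = D := by
      rw [hD, load]; push_cast; rfl
    rw [hDs] at hS
    have hcard := card_offDiag_real U
    rw [hm] at hS hcard
    push_cast at hS hcard
    have hD0 : 0 ≤ D := by positivity
    simp only [Finset.sum_add_distrib, ← Finset.mul_sum, Finset.sum_sub_distrib, Finset.sum_const,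
      nsmul_eq_mul] at hS ⊢
    rw [hS, hcard]
    unfold failurePotential
    rw [← hUdef, hm, ← hF, ← hD, weight_add_two]
    push_cast
    set c := weight m / m with hc
    set w := weight m with hwdef
    have hM : (0 : ℝ) ≤ m := by positivity
    -- the weight grows fast enough to pay for the expected failures and for Breaker's edges
    have key1 : D + c * (((m : ℝ) + 2) * (m + 2 - 1) * D - 2 * (m + 2 - 1) * D) ≤
        (w + 2 / (m + 1) + 2 / (m + 2)) * (D / (m + 2)) * (((m : ℝ) + 2) * (m + 2 - 1)) := by
      have e1 : c * (((m : ℝ) + 2) * (m + 2 - 1) * D - 2 * (m + 2 - 1) * D) = w * (m + 1) * D := by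
        rw [← hcm]; ring
      have e2 : (w + 2 / ((m : ℝ) + 1) + 2 / (m + 2)) * (D / (m + 2)) * (((m : ℝ) + 2) * (m + 2 - 1))
          = w * (m + 1) * D + 2 * D + 2 * D * ((m + 1) / (m + 2)) := by
        field_simp
        ring
      rw [e1, e2]
      have : 0 ≤ 2 * D * (((m : ℝ) + 1) / (m + 2)) := by positivity
      linarith
    -- The cross term of the square is at least `2 * w * (4 / (m + 2))`, which is at least `2 * c`
    -- since `m + 2 ≤ 4 * m` for `m ≥ 1`.
    have key2 : 2 * c + w ^ 2 ≤ (w + 2 / (m + 1) + 2 / (m + 2)) ^ 2 := by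
      have e1 : c ≤ w * (4 / (m + 2)) := by
        rw [← hcm]
        rcases Nat.eq_zero_or_pos m with h0 | hm0
        · have : c = 0 := by rw [hc, h0]; simp
          rw [this]; simp
        · have hm1 : (1 : ℝ) ≤ m := by exact_mod_cast hm0
          rw [mul_assoc]
          refine le_mul_of_one_le_right hc0 ?_
          rw [mul_div_assoc', le_div_iff₀ (by positivity)]
          linarith
      have e2 : 2 / ((m : ℝ) + 2) ≤ 2 / (m + 1) := by gcongr; norm_num
      have e3 : w * (4 / (m + 2)) ≤ w * (2 / (m + 1) + 2 / (m + 2)) := by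
        gcongr
        calc 4 / ((m : ℝ) + 2) = 2 / (m + 2) + 2 / (m + 2) := by ring
          _ ≤ _ := by linarith
      nlinarith [sq_nonneg (2 / ((m : ℝ) + 1) + 2 / (m + 2))]
    have key3 : (2 * c + w ^ 2) * ((b + 1) * (((m : ℝ) + 2) * (m + 2 - 1))) ≤
        (w + 2 / (m + 1) + 2 / (m + 2)) ^ 2 * ((b + 1) * (((m : ℝ) + 2) * (m + 2 - 1))) := by
      refine mul_le_mul_of_nonneg_right key2 (mul_nonneg (by positivity) ?_)
      exact mul_nonneg (by positivity) (by linarith)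
    linarith

/-- A uniformly random pair has average degrees, so removing it leaves the expected average
unchanged. Only the new edges count, at most `2 (b + 1)` in degree, spread over the `m` remaining
vertices. -/
theorem expect_averagePotential_le {τ : BreakerStrategy n b} {h : History n}
    (hs : sched (observation h).length = Phase.main)
    (hU : 4 ≤ (unexposed sched (observation h)).card) :
    expect (step a (strategy sched e₀) τ h) (fun h' => ENNReal.ofReal (averagePotential b sched h'))
      ≤ ENNReal.ofReal (averagePotential b sched h) := by
  obtain ⟨m, hm⟩ : ∃ m, (unexposed sched (observation h)).card = m + 2 :=
    ⟨_, (Nat.sub_add_cancel (by omega)).symm⟩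
  have hm2 : 2 ≤ m := by omega
  set U := unexposed sched (observation h) with hUdef
  set D : ℝ := (load sched h : ℝ) with hD
  have hw := weight_nonneg m
  have hM : (2 : ℝ) ≤ m := by exact_mod_cast hm2
  have hM0 : (0 : ℝ) < m := by linarith
  refine expect_step_le (offDiag_nonempty (show 2 ≤ U.card by omega)) (by rw [strategy, moveSet_main hs])
    (ψ := fun p => 1 / m * (D - (deg (claimed h) p.1 + deg (claimed h) p.2) + 2 * (b + 1)) +
      (b + 1) * weight m) ?_ ?_ ?_
  · intro p hp h' hn
    have h1 := load_next_main hn hs hp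
    have h2 := card_unexposed_next_main hn hs hp
    rw [← hUdef, hm, Nat.add_sub_cancel] at h2
    unfold averagePotential
    rw [h2]
    have h3 : (load sched h' / m : ℝ) ≤
        1 / m * (D - (deg (claimed h) p.1 + deg (claimed h) p.2) + 2 * (b + 1)) := by
      calc (load sched h' / m : ℝ) = 1 / m * load sched h' := by ring
        _ ≤ _ := by gcongr
    linarith
  · intro p hp
    have h1 := deg_add_deg_le_load hp
    rw [← hD] at h1
    have h2 : 0 ≤ 1 / m * (D - (deg (claimed h) p.1 + deg (claimed h) p.2) + 2 * (b + 1)) :=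
      mul_nonneg (by positivity) (by linarith [show (0 : ℝ) ≤ 2 * (b + 1) by positivity])
    positivity
  · have hS := sum_offDiag_add U (fun u => (deg (claimed h) u : ℝ))
    have hDs : ∑ u ∈ U, (deg (claimed h) u : ℝ) = D := by
      rw [hD, load]; push_cast; rfl
    rw [hDs] at hS
    have hcard := card_offDiag_real U
    rw [hm] at hS hcard
    push_cast at hS hcard
    have hD0 : 0 ≤ D := by positivity
    simp only [Finset.sum_add_distrib, ← Finset.mul_sum, Finset.sum_sub_distrib, Finset.sum_const,
      nsmul_eq_mul] at hS ⊢
    rw [hS, hcard]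
    unfold averagePotential
    rw [← hUdef, hm, ← hD, weight_add_two]
    push_cast
    have key1 : 1 / (m : ℝ) * (((m : ℝ) + 2) * (m + 2 - 1) * D - 2 * (m + 2 - 1) * D) =
        D / (m + 2) * (((m : ℝ) + 2) * (m + 2 - 1)) := by
      field_simp
      ring
    -- This amounts to `2 ≤ m ^ 2`, hence the demand for four unexposed vertices.
    have key2 : 2 * (1 / (m : ℝ)) ≤ 2 / (m + 1) + 2 / (m + 2) := by
      rw [div_add_div _ _ (by positivity) (by positivity), mul_one_div,
        div_le_div_iff₀ hM0 (by positivity)]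
      nlinarith
    have key3 : 2 * (1 / (m : ℝ)) * ((b + 1) * (((m : ℝ) + 2) * (m + 2 - 1))) ≤
        (2 / (m + 1) + 2 / (m + 2)) * ((b + 1) * (((m : ℝ) + 2) * (m + 2 - 1))) := by
      refine mul_le_mul_of_nonneg_right key2 (mul_nonneg (by positivity) ?_)
      exact mul_nonneg (by positivity) (by linarith)
    linarith

/-! ### The probability that a set of vertices is exposed -/

/-- A lower bound for the probability that `c` given vertices are exposed in `r` attempts. -/
def hitBound (n r c : ℕ) : ℝ := (r.choose c : ℝ) / (n : ℝ) ^ c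

theorem choose_succ_le (r c : ℕ) : r.choose (c + 1) ≤ r.choose c * r := by
  have h1 := Nat.choose_succ_right_eq r c
  have h2 : r.choose (c + 1) ≤ r.choose (c + 1) * (c + 1) := Nat.le_mul_of_pos_right _ (by omega)
  exact (h2.trans_eq h1).trans (Nat.mul_le_mul_left _ (Nat.sub_le _ _))

theorem hitBound_antitone {n r : ℕ} (hn : 0 < n) (hr : r ≤ n) : Antitone (hitBound n r) := by
  refine antitone_nat_of_succ_le fun c => ?_
  have hn' : (0 : ℝ) < n := by exact_mod_cast hn
  unfold hitBound
  rw [div_le_div_iff₀ (by positivity) (by positivity), pow_succ]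
  have h1 : ((r.choose (c + 1) : ℕ) : ℝ) ≤ r.choose c * n := by
    exact_mod_cast (choose_succ_le r c).trans (Nat.mul_le_mul_left _ hr)
  calc (r.choose (c + 1) : ℝ) * (n : ℝ) ^ c ≤ r.choose c * n * (n : ℝ) ^ c := by gcongr
    _ = _ := by ring

/-- By Pascal's rule the two sides differ by `(n * r.choose c - 2 * r.choose (c + 1)) / n ^ (c +
2)`, which is nonnegative because `r.choose (c + 1) ≤ r * r.choose c` and `2 * r ≤ n`. -/
theorem hitBound_succ_le {n r c : ℕ} (hn : 0 < n) (hr : 2 * r ≤ n) :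
    hitBound n (r + 1) (c + 1) ≤
      2 / n * hitBound n r c + (1 - 2 / n) * hitBound n r (c + 1) := by
  have hn' : (0 : ℝ) < n := by exact_mod_cast hn
  unfold hitBound
  rw [Nat.choose_succ_succ]
  push_cast
  have h1 : 2 * (r.choose (c + 1) : ℝ) ≤ r.choose c * n := by
    have := choose_succ_le r c
    have h2 : 2 * r.choose (c + 1) ≤ r.choose c * n := by nlinarith
    exact_mod_cast h2
  have e1 : 2 / (n : ℝ) * (r.choose c / n ^ c) + (1 - 2 / n) * (r.choose (c + 1) / n ^ (c + 1)) -
      (r.choose c + r.choose (c + 1)) / n ^ (c + 1) =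
      (r.choose c * n - 2 * r.choose (c + 1)) / n ^ (c + 2) := by
    field_simp
    ring
  have e2 : 0 ≤ ((r.choose c : ℝ) * n - 2 * r.choose (c + 1)) / n ^ (c + 2) :=
    div_nonneg (by linarith) (by positivity)
  linarith

theorem hitBound_le_one {n r : ℕ} (hn : 0 < n) (hr : r ≤ n) (c : ℕ) : hitBound n r c ≤ 1 :=
  (hitBound_antitone hn hr (Nat.zero_le c)).trans (by simp [hitBound])

/-- It suffices to follow a single target `v`: the draw exposes it with probability `2 / |U|`, at
least `2 / n`, and then at most `c` of `c + 1` targets remain. Further targets hit by the same pair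
only help, as `hitBound` is antitone. -/
theorem expect_hit_le {τ : BreakerStrategy n b} {h : History n} {r : ℕ} (C : Finset (Fin n))
    (hs : sched (observation h).length = Phase.main)
    (hU : 2 * (r + 1) ≤ (unexposed sched (observation h)).card) :
    expect (step a (strategy sched e₀) τ h) (fun h' => ENNReal.ofReal
        (1 - hitBound n r (C ∩ unexposed sched (observation h')).card))
      ≤ ENNReal.ofReal (1 - hitBound n (r + 1) (C ∩ unexposed sched (observation h)).card) := by
  classical
  set U := unexposed sched (observation h) with hUdef
  have hUn : U.card ≤ n := by simpa using Finset.card_le_univ U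
  have hn : 0 < n := by omega
  have hsub : ∀ p ∈ U.offDiag, ∀ h', Next a b h (toEdge e₀ p) h' →
      C ∩ unexposed sched (observation h') = (C ∩ U) \ {p.1, p.2} := by
    intro p hp h' hn
    rw [unexposed_next_main hn hs (Finset.mem_offDiag.1 hp).2.2, Finset.inter_sdiff_assoc]
  rcases Finset.eq_empty_or_nonempty (C ∩ U) with h0 | ⟨v, hv⟩
  · refine expect_step_le (offDiag_nonempty (show 2 ≤ U.card by omega)) (by rw [strategy, moveSet_main hs])
      (ψ := fun _ => 0) ?_ (fun _ _ => le_rfl) ?_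
    · intro p hp h' hn
      rw [hsub p hp h' hn, h0]
      simp [hitBound]
    · rw [h0]
      simp [hitBound]
  · obtain ⟨c, hc⟩ : ∃ c, (C ∩ U).card = c + 1 :=
      ⟨_, (Nat.sub_add_cancel (Finset.card_pos.2 ⟨v, hv⟩)).symm⟩
    have hvU : v ∈ U := (Finset.mem_inter.1 hv).2
    have hanti := hitBound_antitone hn (show r ≤ n by omega)
    refine expect_step_le (offDiag_nonempty (show 2 ≤ U.card by omega)) (by rw [strategy, moveSet_main hs])
      -- The coordinates are distinct, so the two indicators add up to the indicator that the pair
      -- contains `v`; the additive form makes `sum_offDiag_add` applicable.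
      (ψ := fun p => 1 - hitBound n r (c + 1) - (hitBound n r c - hitBound n r (c + 1)) *
        ((if p.1 = v then 1 else 0) + (if p.2 = v then 1 else 0))) ?_ ?_ ?_
    · intro p hp h' hn'
      rw [hsub p hp h' hn']
      have hpne := (Finset.mem_offDiag.1 hp).2.2
      have hle : ((C ∩ U) \ {p.1, p.2}).card ≤ c + 1 := hc ▸ Finset.card_le_card Finset.sdiff_subset
      by_cases hvp : p.1 = v ∨ p.2 = v
      · have hlt : ((C ∩ U) \ {p.1, p.2}).card ≤ c := by
          have : ((C ∩ U) \ {p.1, p.2}).card < (C ∩ U).card := by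
            refine Finset.card_lt_card ⟨Finset.sdiff_subset, fun hh => ?_⟩
            have := hh hv
            simp only [Finset.mem_sdiff, Finset.mem_insert, Finset.mem_singleton] at this
            rcases hvp with rfl | rfl <;> tauto
          omega
        have h1 : ((if p.1 = v then 1 else 0) + (if p.2 = v then 1 else 0) : ℝ) = 1 := by
          rcases hvp with rfl | rfl
          · rw [if_pos rfl, if_neg (Ne.symm hpne), add_zero]
          · rw [if_pos rfl, if_neg hpne, zero_add]
        rw [h1]
        linarith [hanti hlt]
      · push Not at hvp
        rw [if_neg hvp.1, if_neg hvp.2]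
        linarith [hanti hle]
    · intro p hp
      have hpne := (Finset.mem_offDiag.1 hp).2.2
      have h1 : ((if p.1 = v then 1 else 0) + (if p.2 = v then 1 else 0) : ℝ) ≤ 1 := by
        split_ifs with h1 h2
        · exact absurd (h1.trans h2.symm) hpne
        all_goals norm_num
      have h2 := hitBound_le_one hn (show r ≤ n by omega) c
      have h3 := hanti (Nat.le_succ c)
      simp only [Nat.succ_eq_add_one] at h3
      nlinarith [mul_le_mul_of_nonneg_left h1 (sub_nonneg.2 h3)]
    · have hS := sum_offDiag_add U (fun u => if u = v then (1 : ℝ) else 0)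
      rw [Finset.sum_ite_eq' U v, if_pos hvU] at hS
      rw [Finset.sum_sub_distrib, ← Finset.mul_sum, hS, Finset.sum_const, nsmul_eq_mul,
        card_offDiag_real, hc]
      have hm : (2 : ℝ) ≤ U.card := by exact_mod_cast (by omega : 2 ≤ U.card)
      have hmn : (U.card : ℝ) ≤ n := by exact_mod_cast hUn
      have hn' : (0 : ℝ) < n := by exact_mod_cast hn
      have h1 := hitBound_succ_le (c := c) hn (show 2 * r ≤ n by omega)
      have h3 : hitBound n r (c + 1) ≤ hitBound n r c := hanti (Nat.le_succ c)
      have h4 : (U.card : ℝ) * hitBound n (r + 1) (c + 1) ≤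
          2 * (hitBound n r c - hitBound n r (c + 1)) + U.card * hitBound n r (c + 1) := by
        have h5 : (U.card : ℝ) * (2 / n) ≤ 2 := by
          rw [mul_div_assoc', div_le_iff₀ hn']; linarith
        calc (U.card : ℝ) * hitBound n (r + 1) (c + 1)
            ≤ U.card * (2 / n * hitBound n r c + (1 - 2 / n) * hitBound n r (c + 1)) := by gcongr
          _ = U.card * (2 / n) * (hitBound n r c - hitBound n r (c + 1)) +
              U.card * hitBound n r (c + 1) := by ring
          _ ≤ _ := by gcongr
      nlinarith

end

/-! ### Tail bounds for a segment of exposures, and gaining edges at the failed vertices -/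

section

variable {n a b : ℕ} {sched : ℕ → Phase} {e₀ : Edge n}

theorem expect_const_mul {α : Type*} (p : PMF α) (c : ℝ≥0∞) (f : α → ℝ≥0∞) :
    expect p (fun x => c * f x) = c * expect p f := by
  unfold expect
  rw [← ENNReal.tsum_mul_left]
  exact tsum_congr fun x => mul_left_comm _ _ _

/-- Markov's inequality for a supermartingale. -/
theorem run_le_of_potential {σ : MakerStrategy n} {τ : BreakerStrategy n b} {h : History n}
    {j : ℕ} {S : Set (History n)} {t : ℝ} (ht : 0 < t) (Φ : ℕ → History n → ℝ)
    (hΦ : ∀ i < j, ∀ h', Ext a b σ h i h' →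
      expect (step a σ τ h') (fun h'' => ENNReal.ofReal (Φ (i + 1) h'')) ≤
        ENNReal.ofReal (Φ i h'))
    (hS : ∀ h', Ext a b σ h j h' → h' ∈ S → t ≤ Φ j h') :
    (run a σ τ j h).toOuterMeasure S ≤ ENNReal.ofReal (Φ 0 h / t) := by
  calc (run a σ τ j h).toOuterMeasure S
      ≤ expect (run a σ τ j h) fun h' => (ENNReal.ofReal t)⁻¹ * ENNReal.ofReal (Φ j h') := by
        refine toOuterMeasure_le_expect fun h' hh hS' => ?_
        rw [mul_comm, ← ENNReal.div_eq_inv_mul.trans (mul_comm _ _),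
          ENNReal.le_div_iff_mul_le (by simp [ht]) (by simp), one_mul]
        exact ENNReal.ofReal_le_ofReal (hS h' (ext_of_mem_support hh) hS')
    _ = (ENNReal.ofReal t)⁻¹ * expect (run a σ τ j h) fun h' => ENNReal.ofReal (Φ j h') :=
        expect_const_mul _ _ _
    _ ≤ (ENNReal.ofReal t)⁻¹ * ENNReal.ofReal (Φ 0 h) := by
        gcongr
        exact expect_run_le (fun i h' => ENNReal.ofReal (Φ i h')) hΦ
    _ = ENNReal.ofReal (Φ 0 h / t) := by
        rw [← ENNReal.div_eq_inv_mul, ENNReal.ofReal_div_of_pos ht]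

theorem ofReal_one_sub_add_le {x y : ℝ} (hx : 0 ≤ x) (hy : 0 ≤ y) :
    ENNReal.ofReal (1 - (x + y)) ≤ ENNReal.ofReal (1 - x) * ENNReal.ofReal (1 - y) := by
  by_cases h1 : x ≤ 1
  · rw [← ENNReal.ofReal_mul (by linarith)]
    exact ENNReal.ofReal_le_ofReal (by nlinarith)
  · rw [ENNReal.ofReal_of_nonpos (by linarith)]
    exact zero_le

theorem ofReal_one_sub_le_of_compl_le {α : Type*} (p : PMF α) {s : Set α} {ε : ℝ}
    (hε : 0 ≤ ε) (h : p.toOuterMeasure sᶜ ≤ ENNReal.ofReal ε) :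
    ENNReal.ofReal (1 - ε) ≤ p.toOuterMeasure s := by
  rw [ENNReal.ofReal_sub _ hε, ENNReal.ofReal_one]
  exact one_sub_le_toOuterMeasure p h

/-! ### A segment of exposures -/

theorem Next.length_failed_le {h h' : History n} {e : Edge n} (hn : Next a b h e h') :
    (failed sched (observation h)).length ≤ (failed sched (observation h')).length := by
  by_cases hs : sched (observation h).length = Phase.main
  · rw [failed_next_main hn hs]
    split_ifs <;> simp
  · rw [failed_congr (exposures_next_of_ne hn hs)]

theorem Ext.length_failed_le {σ : MakerStrategy n} {h h' : History n} {j : ℕ}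
    (hx : Ext a b σ h j h') :
    (failed sched (observation h)).length ≤ (failed sched (observation h')).length := by
  induction hx with
  | refl => exact le_rfl
  | step _ _ hn ih => exact ih.trans hn.length_failed_le

theorem run_failed_le {τ : BreakerStrategy n b} {h : History n} {j φ : ℕ} (hφ : 0 < φ)
    (hs : ∀ i < j, sched ((observation h).length + i) = Phase.main)
    (hU : 2 * j ≤ (unexposed sched (observation h)).card) :
    (run a (strategy sched e₀) τ j h).toOuterMeasure
      {h' | (failed sched (observation h)).length + φ ≤ (failed sched (observation h')).length} ≤
    ENNReal.ofReal ((weight (unexposed sched (observation h)).card *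
      (load sched h / (unexposed sched (observation h)).card) +
      (b + 1) * weight (unexposed sched (observation h)).card ^ 2) / φ) := by
  have h1 := run_le_of_potential (a := a) (τ := τ) (h := h) (j := j) (σ := strategy sched e₀)
    (S := {h' | (failed sched (observation h)).length + φ ≤ (failed sched (observation h')).length})
    (t := φ) (by exact_mod_cast hφ)
    (fun _ => failurePotential b sched (failed sched (observation h)).length) ?_ ?_
  · refine h1.trans_eq ?_
    rw [failurePotential, sub_self, zero_add]
  · intro i hi h' hx
    have h2 := hx.main_segment (fun i' hi' => hs i' (by omega)) (by omega)
    refine expect_failurePotential_le hx.length_failed_le ?_ (by omega)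
    rw [hx.length_observation]
    exact hs i hi
  · intro h' hx hh
    have hh' : ((failed sched (observation h)).length : ℝ) + φ ≤
      (failed sched (observation h')).length := by exact_mod_cast hh
    unfold failurePotential
    have := weight_nonneg (unexposed sched (observation h')).card
    have h2 : 0 ≤ weight (unexposed sched (observation h')).card *
      (load sched h' / (unexposed sched (observation h')).card) := by positivity
    have h3 : 0 ≤ ((b : ℝ) + 1) * weight (unexposed sched (observation h')).card ^ 2 := by positivity
    linarith

/-- The two spare vertices guarantee four unexposed vertices before each exposure, as the
supermartingale needs, and a nonzero denominator at the end. -/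
theorem run_load_le {τ : BreakerStrategy n b} {h : History n} {j : ℕ} {Δ : ℝ} (hΔ : 0 < Δ)
    (hs : ∀ i < j, sched ((observation h).length + i) = Phase.main)
    (hU : 2 * j + 2 ≤ (unexposed sched (observation h)).card) :
    (run a (strategy sched e₀) τ j h).toOuterMeasure
      {h' | Δ * (unexposed sched (observation h')).card ≤ load sched h'} ≤
    ENNReal.ofReal ((load sched h / (unexposed sched (observation h)).card +
      (b + 1) * weight (unexposed sched (observation h)).card) / Δ) := by
  refine run_le_of_potential hΔ (fun _ => averagePotential b sched) ?_ ?_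
  · intro i hi h' hx
    have h2 := hx.main_segment (fun i' hi' => hs i' (by omega)) (by omega)
    refine expect_averagePotential_le ?_ (by omega)
    rw [hx.length_observation]
    exact hs i hi
  · intro h' hx hh
    have h2 := hx.main_segment hs (by omega)
    have hpos : (0 : ℝ) < (unexposed sched (observation h')).card := by
      exact_mod_cast (by omega : 0 < (unexposed sched (observation h')).card)
    unfold averagePotential
    have := weight_nonneg (unexposed sched (observation h')).card
    have h3 : Δ ≤ load sched h' / (unexposed sched (observation h')).card := by
      rw [le_div_iff₀ hpos]
      exact hh
    have h4 : 0 ≤ ((b : ℝ) + 1) * weight (unexposed sched (observation h')).card := by positivity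
    linarith

theorem run_hit_le {τ : BreakerStrategy n b} {h : History n} {j : ℕ} (C : Finset (Fin n))
    (hs : ∀ i < j, sched ((observation h).length + i) = Phase.main)
    (hU : 2 * j ≤ (unexposed sched (observation h)).card) :
    (run a (strategy sched e₀) τ j h).toOuterMeasure
      {h' | (C ∩ unexposed sched (observation h')).Nonempty} ≤
    ENNReal.ofReal (1 - hitBound n j (C ∩ unexposed sched (observation h)).card) := by
  have h1 := run_le_of_potential (a := a) (τ := τ) (h := h) (j := j) (σ := strategy sched e₀)
    (S := {h' | (C ∩ unexposed sched (observation h')).Nonempty}) one_pos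
    (fun i h' => 1 - hitBound n (j - i) (C ∩ unexposed sched (observation h')).card) ?_ ?_
  · simpa using h1
  · intro i hi h' hx
    have h2 := hx.main_segment (fun i' hi' => hs i' (by omega)) (by omega)
    have h3 : j - i = (j - (i + 1)) + 1 := by omega
    rw [h3]
    refine expect_hit_le C ?_ (by omega)
    rw [hx.length_observation]
    exact hs i hi
  · intro h' hx hh
    obtain ⟨c, hc⟩ : ∃ c, (C ∩ unexposed sched (observation h')).card = c + 1 :=
      ⟨_, (Nat.sub_add_cancel (Finset.card_pos.2 hh)).symm⟩
    -- No draws remain and a target is left, so the binomial coefficient vanishes and the potential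
    -- equals `1` on the bad event.
    rw [hc]
    simp [hitBound]

/-! ### Gaining edges at a vertex -/

theorem deg_insert_of_mem {s : Finset (Edge n)} {e : Edge n} {v : Fin n} (he : e ∉ s)
    (hv : v ∈ (e : Sym2 (Fin n))) : deg (insert e s) v = deg s v + 1 := by
  unfold deg
  rw [Finset.filter_insert, if_pos hv, Finset.card_insert_of_notMem]
  simp [he]

/-- A supermartingale that bounds the probability of not gaining `k` edges at `v`. -/
def attachPotential (k : ℕ) (q : ℝ) (v : Fin n) (r : ℕ) (h : History n) : ℝ :=
  if k ≤ deg (makerEdges h) v then 0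
  else 2 ^ k * (1 / 2) ^ deg (makerEdges h) v * (1 - q / 2) ^ r

-- While Maker has fewer than `k` edges at `v`, at most `(1 - q) * (n - 1)` edges of the star are
-- claimed. A random one is free with probability at least `q`, and success halves the potential, so
-- the expected factor is at most `q / 2 + (1 - q) = 1 - q / 2`.
open Classical in
theorem expect_attachPotential_le {τ : BreakerStrategy n b} {h : History n} {k i r : ℕ} {q : ℝ}
    {v : Fin n} (hn2 : 2 ≤ n) (hq : q ≤ 1) (hs : sched (observation h).length = Phase.attach i)
    (hv : (failedVerts sched (observation h)).toList[i]? = some v)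
    (hd : k ≤ deg (makerEdges h) v ∨
      (deg (breakerEdges h) v : ℝ) + k ≤ (1 - q) * (n - 1)) :
    expect (step a (strategy sched e₀) τ h)
        (fun h' => ENNReal.ofReal (attachPotential k q v r h'))
      ≤ ENNReal.ofReal (attachPotential k q v (r + 1) h) := by
  have hcard : (Finset.univ.erase v).card = n - 1 := by
    rw [Finset.card_erase_of_mem (Finset.mem_univ v), Finset.card_univ, Fintype.card_fin]
  have hne : (({v} : Finset (Fin n)) ×ˢ Finset.univ.erase v).Nonempty := by
    rw [Finset.nonempty_product]
    exact ⟨Finset.singleton_nonempty v, Finset.card_pos.1 (by omega)⟩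
  have hσ : strategy sched e₀ (observation h) = sample e₀ ({v} ×ˢ Finset.univ.erase v) := by
    rw [strategy, moveSet_attach hs hv]
  have hq2 : 0 ≤ 1 - q / 2 := by linarith
  by_cases hk : k ≤ deg (makerEdges h) v
  · refine expect_step_le hne hσ (ψ := fun _ => 0) ?_ (fun _ _ => le_rfl) ?_
    · intro p hp h' hn
      rw [attachPotential, if_pos (hk.trans (deg_mono hn.makerEdges_subset v))]
    · rw [attachPotential, if_pos hk]; simp
  · set A : ℝ := 2 ^ k * (1 / 2) ^ deg (makerEdges h) v * (1 - q / 2) ^ r with hA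
    have hA0 : 0 ≤ A := by positivity
    refine expect_step_le hne hσ
      (ψ := fun p => A * (1 / 2 + 1 / 2 * if Joined (claimed h) p.1 p.2 then 1 else 0)) ?_ ?_ ?_
    · intro p hp h' hn
      rw [Finset.mem_product, Finset.mem_singleton, Finset.mem_erase] at hp
      have hpne : p.1 ≠ p.2 := fun h => hp.2.1 (h.symm.trans hp.1)
      have hmem := toEdge_mem_iff (e₀ := e₀) (s := claimed h) hpne
      by_cases hj : Joined (claimed h) p.1 p.2
      · rw [if_pos hj, attachPotential, hn.makerEdges_eq, if_pos (hmem.2 hj), if_neg hk]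
        linarith
      · rw [if_neg hj, attachPotential, hn.makerEdges_eq, if_neg (fun h => hj (hmem.1 h)),
          deg_insert_of_mem]
        · split_ifs
          · linarith
          · rw [pow_succ, hA]
            exact le_of_eq (by ring)
        · exact fun hh => hj (hmem.1 (Finset.mem_union_left _ hh))
        · rw [coe_toEdge e₀ hpne, ← hp.1]
          exact Sym2.mem_mk_left _ _
    · intro p hp
      have h3 : (0 : ℝ) ≤ if Joined (claimed h) p.1 p.2 then 1 else 0 := by split_ifs <;> norm_num
      positivity
    · have hI : ∑ p ∈ ({v} : Finset (Fin n)) ×ˢ Finset.univ.erase v,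
          (if Joined (claimed h) p.1 p.2 then (1 : ℝ) else 0) ≤ deg (claimed h) v := by
        rw [Finset.sum_boole]
        have := card_filter_joined_le (claimed h) {v} (({v} : Finset (Fin n)) ×ˢ Finset.univ.erase v)
          fun p hp => (Finset.mem_product.1 hp).1
        rw [Finset.sum_singleton] at this
        exact_mod_cast this
      have hd2 : (deg (claimed h) v : ℝ) ≤ (1 - q) * (n - 1) := by
        have h1 : deg (claimed h) v ≤ deg (makerEdges h) v + deg (breakerEdges h) v :=
          deg_union_le _ _ _
        have h2 : deg (claimed h) v ≤ k + deg (breakerEdges h) v := by omega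
        have h3 : (deg (claimed h) v : ℝ) ≤ k + deg (breakerEdges h) v := by exact_mod_cast h2
        rcases hd with hd | hd
        · exact absurd hd hk
        · linarith
      rw [← Finset.mul_sum, Finset.sum_add_distrib, ← Finset.mul_sum, Finset.sum_const,
        Finset.card_product, Finset.card_singleton, one_mul, hcard, nsmul_eq_mul,
        Nat.cast_sub (by omega), attachPotential, if_neg hk, pow_succ, Nat.cast_one]
      have h5 : 2 ^ k * (1 / 2) ^ deg (makerEdges h) v * ((1 - q / 2) ^ r * (1 - q / 2)) =
        A * (1 - q / 2) := by rw [hA]; ring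
      rw [h5, mul_assoc A]
      exact mul_le_mul_of_nonneg_left (by linarith) hA0

theorem run_attach_le {τ : BreakerStrategy n b} {h : History n} {k i T : ℕ} {q : ℝ}
    {v : Fin n} (hn2 : 2 ≤ n) (hq : q ≤ 1)
    (hs : ∀ j < T, sched ((observation h).length + j) = Phase.attach i)
    (hv : (failedVerts sched (observation h)).toList[i]? = some v)
    (hd : k ≤ deg (makerEdges h) v ∨
      ((deg (breakerEdges h) v + b * T : ℕ) : ℝ) + k ≤ (1 - q) * (n - 1)) :
    (run a (strategy sched e₀) τ T h).toOuterMeasure {h' | ¬ k ≤ deg (makerEdges h') v} ≤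
      ENNReal.ofReal (2 ^ k * (1 - q / 2) ^ T) := by
  have hq2 : 0 ≤ 1 - q / 2 := by linarith
  have h1 := run_le_of_potential (a := a) (τ := τ) (h := h) (j := T) (σ := strategy sched e₀)
    (S := {h' | ¬ k ≤ deg (makerEdges h') v}) one_pos
    (fun j h' => attachPotential k q v (T - j) h') ?_ ?_
  · refine h1.trans (ENNReal.ofReal_le_ofReal ?_)
    rw [div_one, Nat.sub_zero, attachPotential]
    split_ifs
    · positivity
    · calc (2 : ℝ) ^ k * (1 / 2) ^ deg (makerEdges h) v * (1 - q / 2) ^ T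
          ≤ 2 ^ k * 1 * (1 - q / 2) ^ T := by
            gcongr
            exact pow_le_one₀ (by norm_num) (by norm_num)
        _ = _ := by ring
  · intro j hj h' hx
    have h3 : T - j = (T - (j + 1)) + 1 := by omega
    rw [h3]
    refine expect_attachPotential_le (i := i) hn2 hq ?_ ?_ ?_
    · rw [hx.length_observation]
      exact hs j hj
    · rw [failedVerts_congr (hx.exposures_eq fun i' hi' => by rw [hs i' (by omega)]; simp)]
      exact hv
    · rcases hd with hd | hd
      · exact Or.inl (hd.trans (deg_mono hx.makerEdges_subset v))
      · right
        have h4 : deg (breakerEdges h') v ≤ deg (breakerEdges h) v + b * T :=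
          (hx.deg_breakerEdges_le v).trans (by gcongr)
        have h5 : (deg (breakerEdges h') v : ℝ) ≤ ((deg (breakerEdges h) v + b * T : ℕ) : ℝ) := by
          exact_mod_cast h4
        linarith
  · intro h' hx hh
    have hh' : ¬ k ≤ deg (makerEdges h') v := hh
    rw [attachPotential, if_neg hh', Nat.sub_self, pow_zero, mul_one]
    have h6 : deg (makerEdges h') v ≤ k := by omega
    calc (1 : ℝ) = (2 * (1 / 2)) ^ k := by norm_num
      _ = 2 ^ k * (1 / 2) ^ k := mul_pow _ _ _
      _ ≤ 2 ^ k * (1 / 2) ^ deg (makerEdges h') v := by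
        gcongr 2 ^ k * ?_
        exact pow_le_pow_of_le_one (by norm_num) (by norm_num) h6

/-- The failed vertices are served one after another, `T` attempts each. The hypothesis `hd` already
allows for all edges that Breaker can add in the whole segment, so it is inherited by later slots;
vertices that had `k` edges from earlier windows satisfy its first alternative. -/
theorem le_run_attach_aux {τ : BreakerStrategy n b} {h : History n} {k T S : ℕ} {q : ℝ}
    (hn2 : 2 ≤ n) (hq : q ≤ 1)
    (hs : ∀ i < S, ∀ j < T, sched ((observation h).length + (T * i + j)) = Phase.attach i)
    (hd : ∀ v ∈ failedVerts sched (observation h), k ≤ deg (makerEdges h) v ∨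
      ((deg (breakerEdges h) v + b * (T * S) : ℕ) : ℝ) + k ≤ (1 - q) * (n - 1)) (s : ℕ)
    (hsS : s ≤ S) :
    ENNReal.ofReal (1 - s * (2 ^ k * (1 - q / 2) ^ T)) ≤
      (run a (strategy sched e₀) τ (T * s) h).toOuterMeasure {h' | ∀ i < s, ∀ v,
        (failedVerts sched (observation h)).toList[i]? = some v → k ≤ deg (makerEdges h') v} := by
  have hq2 : 0 ≤ 1 - q / 2 := by linarith
  have hns : ∀ x < T * S, sched ((observation h).length + x) ≠ Phase.main := by
    intro x hx
    have hT : 0 < T := Nat.pos_of_ne_zero fun h0 => by simp [h0] at hx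
    have := hs (x / T) (Nat.div_lt_of_lt_mul hx) (x % T) (Nat.mod_lt _ hT)
    rw [Nat.div_add_mod] at this
    rw [this]
    simp
  induction s with
  | zero =>
    simp only [mul_zero, run, CharP.cast_eq_zero, zero_mul, sub_zero, ENNReal.ofReal_one]
    rw [PMF.toOuterMeasure_pure_apply, if_pos]
    intro i hi
    omega
  | succ s ih =>
    have e1 : (((s + 1 : ℕ) : ℝ)) * (2 ^ k * (1 - q / 2) ^ T) =
      s * (2 ^ k * (1 - q / 2) ^ T) + 2 ^ k * (1 - q / 2) ^ T := by push_cast; ring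
    rw [e1, mul_add, mul_one]
    refine (ofReal_one_sub_add_le (by positivity) (by positivity)).trans
      (mul_le_run_add (ih (by omega)) fun h₁ hx hh₁ => ?_)
    have hTs : T * s + T ≤ T * S := by
      calc T * s + T = T * (s + 1) := by ring
        _ ≤ T * S := Nat.mul_le_mul_left _ hsS
    have hexp := hx.exposures_eq (sched := sched) fun i hi => hns i (by omega)
    have hold : ∀ h₂, Ext a b (strategy sched e₀) h₁ T h₂ → ∀ i < s, ∀ v,
        (failedVerts sched (observation h)).toList[i]? = some v → k ≤ deg (makerEdges h₂) v :=
      fun h₂ hx₂ i hi v hv => (hh₁ i hi v hv).trans (deg_mono hx₂.makerEdges_subset v)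
    -- A slot beyond the list of failed vertices has an empty move set; the dummy attempts at `e₀`
    -- destroy nothing.
    rcases hv : (failedVerts sched (observation h)).toList[s]? with _ | v
    · refine (ENNReal.ofReal_le_ofReal (sub_le_self _ (by positivity))).trans ?_
      rw [ENNReal.ofReal_one]
      refine ((PMF.toOuterMeasure_apply_eq_one_iff _ _).2 fun h₂ hh₂ i hi v hv' => ?_).ge
      rcases Nat.lt_succ_iff_lt_or_eq.1 hi with hi | rfl
      · exact hold h₂ (ext_of_mem_support hh₂) i hi v hv'
      · rw [hv] at hv'; simp at hv'
    · have hmem : v ∈ failedVerts sched (observation h) :=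
        Finset.mem_toList.1 (List.mem_of_getElem? hv)
      have hr : (run a (strategy sched e₀) τ T h₁).toOuterMeasure
          {h' | ¬ k ≤ deg (makerEdges h') v} ≤ ENNReal.ofReal (2 ^ k * (1 - q / 2) ^ T) := by
        refine run_attach_le (i := s) hn2 hq ?_ ?_ ?_
        · intro j hj
          rw [hx.length_observation, add_assoc]
          exact hs s (by omega) j hj
        · rw [failedVerts_congr hexp]; exact hv
        · rcases hd v hmem with hd | hd
          · exact Or.inl (hd.trans (deg_mono hx.makerEdges_subset v))
          · right
            have h4 : deg (breakerEdges h₁) v + b * T ≤ deg (breakerEdges h) v + b * (T * S) := by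
              have := hx.deg_breakerEdges_le v
              nlinarith
            have h5 : ((deg (breakerEdges h₁) v + b * T : ℕ) : ℝ) ≤
              ((deg (breakerEdges h) v + b * (T * S) : ℕ) : ℝ) := by exact_mod_cast h4
            linarith
      refine le_run_of_subset (ofReal_one_sub_le_of_compl_le _ (by positivity)
        (s := {h' | k ≤ deg (makerEdges h') v}) hr) fun h₂ hx₂ hk i hi v' hv' => ?_
      rcases Nat.lt_succ_iff_lt_or_eq.1 hi with hi | rfl
      · exact hold h₂ hx₂ i hi v' hv'
      · rw [hv, Option.some.injEq] at hv'
        exact hv' ▸ hk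

/-- A segment of attempts at the vertices whose exposure failed: Maker gains `k` edges at each of
them. -/
theorem le_run_attach {τ : BreakerStrategy n b} {h : History n} {k T S : ℕ} {q : ℝ}
    (hn2 : 2 ≤ n) (hq : q ≤ 1)
    (hs : ∀ i < S, ∀ j < T, sched ((observation h).length + (T * i + j)) = Phase.attach i)
    (hS : (failedVerts sched (observation h)).card ≤ S)
    (hd : ∀ v ∈ failedVerts sched (observation h), k ≤ deg (makerEdges h) v ∨
      ((deg (breakerEdges h) v + b * (T * S) : ℕ) : ℝ) + k ≤ (1 - q) * (n - 1)) :
    ENNReal.ofReal (1 - S * (2 ^ k * (1 - q / 2) ^ T)) ≤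
      (run a (strategy sched e₀) τ (T * S) h).toOuterMeasure
        {h' | ∀ v ∈ failedVerts sched (observation h), k ≤ deg (makerEdges h') v} := by
  refine le_run_of_subset (le_run_attach_aux hn2 hq hs hd S le_rfl) fun h' _ hh v hv => ?_
  obtain ⟨i, hi⟩ := List.mem_iff_getElem?.1 (Finset.mem_toList.2 hv)
  refine hh i ?_ v hi
  have h1 := (List.getElem?_eq_some_iff.1 hi).1
  rw [Finset.length_toList] at h1
  omega

end

/-! ### Augmenting paths that repair the failed pairs -/

section

variable {n a b : ℕ} {sched : ℕ → Phase} {e₀ : Edge n}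

/-! ### The pairs that were claimed when they were exposed -/

theorem WellFormed.eq_of_mem {h : History n} (hw : WellFormed sched h)
    {p q : Edge n × Bool} (hp : p ∈ exposures sched (observation h))
    (hq : q ∈ exposures sched (observation h)) {v : Fin n} (hvp : v ∈ (p.1 : Sym2 (Fin n)))
    (hvq : v ∈ (q.1 : Sym2 (Fin n))) : p = q := by
  by_contra hne
  obtain ⟨i, hi, rfl⟩ := List.getElem_of_mem hp
  obtain ⟨j, hj, rfl⟩ := List.getElem_of_mem hq
  have hpw := List.pairwise_iff_getElem.1 hw.disjoint
  rcases lt_trichotomy i j with hlt | rfl | hlt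
  · exact hpw i j hi hj hlt v hvp hvq
  · exact hne rfl
  · exact hpw j i hj hi hlt v hvq hvp

theorem WellFormed.mate_eq {h : History n} (hw : WellFormed sched h) {x y : Fin n}
    (hxy : IsMate sched (observation h) x y) : mate sched (observation h) x = y := by
  have hex : ∃ y, IsMate sched (observation h) x y := ⟨y, hxy⟩
  rw [mate, dif_pos hex]
  obtain ⟨p, hp, -, hpx⟩ := hex.choose_spec
  obtain ⟨q, hq, -, hqx⟩ := hxy
  have := hw.eq_of_mem hp hq (v := x) (by rw [hpx]; exact Sym2.mem_mk_left _ _)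
    (by rw [hqx]; exact Sym2.mem_mk_left _ _)
  rw [this, hqx] at hpx
  exact (Sym2.congr_right.1 hpx).symm

theorem IsMate.symm {o : List (Edge n × Bool)} {x y : Fin n} (h : IsMate sched o x y) :
    IsMate sched o y x := by
  obtain ⟨p, hp, h2, hpx⟩ := h
  exact ⟨p, hp, h2, hpx.trans Sym2.eq_swap⟩

theorem isMate_mate {o : List (Edge n × Bool)} {x : Fin n} (h : ∃ y, IsMate sched o x y) :
    IsMate sched o x (mate sched o x) := by
  rw [mate, dif_pos h]
  exact h.choose_spec

theorem WellFormed.mate_mate {h : History n} (hw : WellFormed sched h) (x : Fin n) :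
    mate sched (observation h) (mate sched (observation h) x) = x := by
  by_cases hex : ∃ y, IsMate sched (observation h) x y
  · exact hw.mate_eq (isMate_mate hex).symm
  · have : mate sched (observation h) x = x := by rw [mate, dif_neg hex]
    rw [this, this]

theorem WellFormed.mate_of_mem_failedVerts {h : History n} (hw : WellFormed sched h) {x : Fin n}
    (hx : x ∈ failedVerts sched (observation h)) : mate sched (observation h) x = x := by
  obtain ⟨e, he, hxe⟩ := mem_failedVerts.1 hx
  rw [mate, dif_neg]
  rintro ⟨y, p, hp, h2, hpx⟩
  have := hw.eq_of_mem hp (mem_failed.1 he) (v := x) (by rw [hpx]; exact Sym2.mem_mk_left _ _) hxe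
  rw [this] at h2
  simp at h2

theorem mem_failedVerts_of_mate_eq {h : History n}
    (hU : unexposed sched (observation h) = ∅) {x : Fin n}
    (hx : mate sched (observation h) x = x) : x ∈ failedVerts sched (observation h) := by
  have hnu : x ∉ unexposed sched (observation h) := by simp [hU]
  rw [mem_unexposed] at hnu
  push Not at hnu
  obtain ⟨⟨e, c⟩, hp, hxp⟩ := hnu
  cases c with
  | false => exact mem_failedVerts.2 ⟨e, mem_failed.2 hp, hxp⟩
  | true =>
    exfalso
    obtain ⟨y, hy⟩ := hxp
    have h1 := isMate_mate (sched := sched) (o := observation h) (x := x) ⟨y, (e, true), hp, rfl, hy⟩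
    rw [hx] at h1
    obtain ⟨p, -, -, hpx⟩ := h1
    have := p.1.2
    rw [hpx] at this
    simp at this

theorem WellFormed.joined_mate {h : History n} (hw : WellFormed sched h) {x : Fin n}
    (hx : mate sched (observation h) x ≠ x) :
    Joined (makerEdges h) x (mate sched (observation h) x) := by
  have hex : ∃ y, IsMate sched (observation h) x y := by
    by_contra hex
    exact hx (by rw [mate, dif_neg hex])
  obtain ⟨p, hp, h2, hpx⟩ := isMate_mate hex
  exact ⟨p.1, hw.owned p hp h2, hpx⟩

theorem WellFormed.failed_index_eq {h : History n} (hw : WellFormed sched h) {i j : ℕ}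
    {e f : Edge n} (hi : (failed sched (observation h))[i]? = some e)
    (hj : (failed sched (observation h))[j]? = some f) {v : Fin n}
    (hve : v ∈ (e : Sym2 (Fin n))) (hvf : v ∈ (f : Sym2 (Fin n))) : i = j := by
  have hpw : (failed sched (observation h)).Pairwise
      fun e f : Edge n => ∀ v, v ∈ (e : Sym2 (Fin n)) → v ∉ (f : Sym2 (Fin n)) := by
    rw [failed, List.pairwise_map]
    exact hw.disjoint.filter _
  rw [List.pairwise_iff_getElem] at hpw
  obtain ⟨hi', rfl⟩ := List.getElem?_eq_some_iff.1 hi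
  obtain ⟨hj', rfl⟩ := List.getElem?_eq_some_iff.1 hj
  rcases lt_trichotomy i j with hlt | heq | hlt
  · exact absurd hvf (hpw i j hi' hj' hlt v hve)
  · exact heq
  · exact absurd hve (hpw j i hj' hi' hlt v hvf)

/-! ### Repairing the failures -/

/-- Maker's edges contain a matching that covers all the vertices but those of the failed pairs
with an index at least `j`, and that agrees with the exposed pairs as far as possible. -/
def PartialRepair (sched : ℕ → Phase) (j : ℕ) (h : History n) : Prop :=
  ∃ ν : Fin n → Fin n, (∀ y, ν (ν y) = y) ∧ (∀ y, ν y ≠ y → Joined (makerEdges h) y (ν y)) ∧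
    (∀ y, ν y = y → ∃ i e, j ≤ i ∧ (failed sched (observation h))[i]? = some e ∧
      y ∈ (e : Sym2 (Fin n))) ∧
    (∀ i e, j ≤ i → (failed sched (observation h))[i]? = some e →
      ∀ y ∈ (e : Sym2 (Fin n)), ν y = y) ∧
    ∀ y, Available sched (observation h) y → ν y = mate sched (observation h) y

/-- Once all vertices are exposed, those fixed by `mate` are exactly the failed ones, so the claimed
pairs themselves are the initial matching. -/
theorem partialRepair_zero {h : History n} (hw : WellFormed sched h)
    (hU : unexposed sched (observation h) = ∅) : PartialRepair sched 0 h := by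
  refine ⟨mate sched (observation h), hw.mate_mate, fun y => hw.joined_mate, ?_, ?_, fun _ _ => rfl⟩
  · intro y hy
    obtain ⟨e, he, hye⟩ := mem_failedVerts.1 (mem_failedVerts_of_mate_eq hU hy)
    obtain ⟨i, hi⟩ := List.mem_iff_getElem?.1 he
    exact ⟨i, e, Nat.zero_le _, hi, hye⟩
  · intro i e _ hi y hy
    exact hw.mate_of_mem_failedVerts (mem_failedVerts.2 ⟨e, List.mem_of_getElem? hi, hy⟩)

theorem available_mono {o o' : List (Edge n × Bool)} (he : exposures sched o' = exposures sched o)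
    (ht : touched sched o ⊆ touched sched o') {y : Fin n} (hy : Available sched o' y) :
    Available sched o y := by
  refine ⟨?_, fun h => hy.2.1 (ht h), fun h => hy.2.2 (ht ?_)⟩
  · rw [← failedVerts_congr he]; exact hy.1
  · rw [mate_congr he]; exact h

theorem PartialRepair.mono {h h' : History n} {j : ℕ} (hr : PartialRepair sched j h)
    (he : exposures sched (observation h') = exposures sched (observation h))
    (ht : touched sched (observation h) ⊆ touched sched (observation h'))
    (hm : makerEdges h ⊆ makerEdges h') : PartialRepair sched j h' := by
  obtain ⟨ν, h1, h2, h3, h4, h5⟩ := hr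
  rw [PartialRepair, failed_congr he, mate_congr he]
  exact ⟨ν, h1, fun y hy => (h2 y hy).mono hm, h3, h4, fun y hy => h5 y (available_mono he ht hy)⟩

theorem PartialRepair.succ_of_length_le {h : History n} {j : ℕ} (hr : PartialRepair sched j h)
    (hj : (failed sched (observation h)).length ≤ j) : PartialRepair sched (j + 1) h := by
  obtain ⟨ν, h1, h2, h3, h4, h5⟩ := hr
  refine ⟨ν, h1, h2, fun y hy => ?_, fun i e hi => h4 i e (by omega), h5⟩
  obtain ⟨i, e, hi, hie, -⟩ := h3 y hy
  have := (List.getElem?_eq_some_iff.1 hie).1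
  omega

theorem out_spec (e : Edge n) :
    (e : Sym2 (Fin n)) = s((e : Sym2 (Fin n)).out.1, (e : Sym2 (Fin n)).out.2) :=
  (Quot.out_eq (e : Sym2 (Fin n))).symm

theorem out_ne (e : Edge n) : (e : Sym2 (Fin n)).out.1 ≠ (e : Sym2 (Fin n)).out.2 := by
  have h1 := e.2
  rw [out_spec e] at h1
  simpa using h1

theorem touched_next_fix {h h' : History n} {e : Edge n} (hn : Next a b h e h') {i : ℕ}
    (hs : sched (observation h).length = Phase.fix i) :
    touched sched (observation h') =
      Finset.univ.filter (fun v => v ∈ (e : Sym2 (Fin n))) ∪ touched sched (observation h) := by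
  rw [hn.observation_eq, touched_cons_fix _ hs]

theorem card_touched_next_fix {h h' : History n} {e : Edge n} (hn : Next a b h e h') {i : ℕ}
    (hs : sched (observation h).length = Phase.fix i) :
    (touched sched (observation h')).card ≤ (touched sched (observation h)).card + 2 := by
  rw [touched_next_fix hn hs]
  refine (Finset.card_union_le _ _).trans ?_
  rw [add_comm]
  gcongr
  rw [out_spec e]
  refine (Finset.card_le_card
    (t := {(e : Sym2 (Fin n)).out.1, (e : Sym2 (Fin n)).out.2}) fun v hv => ?_).trans
    Finset.card_le_two
  simpa using (Finset.mem_filter.1 hv).2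

theorem mem_repairSet {o : List (Edge n × Bool)} {v w : Fin n} {p : Fin n × Fin n} :
    p ∈ repairSet sched o v w ↔ p.1 ≠ p.2 ∧ mate sched o p.1 ≠ p.2 ∧
      Available sched o p.1 ∧ Available sched o p.2 ∧
      Joined (won o) v (mate sched o p.1) ∧ Joined (won o) w (mate sched o p.2) := by
  classical
  simp [repairSet]

/-- A successful repair: the matching is augmented along a path with five edges. -/
theorem PartialRepair.succ_of_claim {h h' : History n} {j : ℕ} (hr : PartialRepair sched j h)
    (hw : WellFormed sched h) (hU : unexposed sched (observation h) = ∅) {e : Edge n}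
    (he : (failed sched (observation h))[j]? = some e) {pr : Fin n × Fin n}
    (hpr : pr ∈ repairSet sched (observation h) (e : Sym2 (Fin n)).out.1 (e : Sym2 (Fin n)).out.2)
    (hn : Next a b h (toEdge e₀ pr) h') (hs : sched (observation h).length = Phase.fix j)
    (hc : ¬ Joined (claimed h) pr.1 pr.2) : PartialRepair sched (j + 1) h' := by
  obtain ⟨ν, h1, h2, h3, h4, h5⟩ := hr
  obtain ⟨p, q⟩ := pr
  rw [mem_repairSet] at hpr
  obtain ⟨hpq, hxq, hap, haq, hjp, hjq⟩ := hpr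
  simp only at hpq hxq hap haq hjp hjq hc
  have hnm : sched (observation h).length ≠ Phase.main := by rw [hs]; simp
  have hexp := exposures_next_of_ne hn hnm
  have hvw := out_ne e
  set v := (e : Sym2 (Fin n)).out.1 with hvdef
  set w := (e : Sym2 (Fin n)).out.2 with hwdef
  set μ := mate sched (observation h) with hμ
  have hve : v ∈ (e : Sym2 (Fin n)) := Sym2.out_fst_mem _
  have hwe : w ∈ (e : Sym2 (Fin n)) := Sym2.out_snd_mem _
  have hvF : v ∈ failedVerts sched (observation h) :=
    mem_failedVerts.2 ⟨e, List.mem_of_getElem? he, hve⟩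
  have hwF : w ∈ failedVerts sched (observation h) :=
    mem_failedVerts.2 ⟨e, List.mem_of_getElem? he, hwe⟩
  have hνv : ν v = v := h4 j e le_rfl he v hve
  have hνw : ν w = w := h4 j e le_rfl he w hwe
  have hμμ : ∀ y, μ (μ y) = y := hw.mate_mate
  have hμF : ∀ y, y ∉ failedVerts sched (observation h) →
      μ y ∉ failedVerts sched (observation h) := by
    intro y hy hμy
    have h6 := hw.mate_of_mem_failedVerts hμy
    rw [← hμ, hμμ] at h6
    exact hy (by rw [h6]; exact hμy)
  have hμne : ∀ y, y ∉ failedVerts sched (observation h) → μ y ≠ y :=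
    fun y hy hyy => hy (mem_failedVerts_of_mate_eq hU hyy)
  have hpF := hap.1
  have hqF := haq.1
  have hxF := hμF p hpF
  have hzF := hμF q hqF
  have hxp := hμne p hpF
  have hzq := hμne q hqF
  have hνp : ν p = μ p := h5 p hap
  have hνq : ν q = μ q := h5 q haq
  have hνx : ν (μ p) = p := by rw [← hνp, h1]
  have hνz : ν (μ q) = q := by rw [← hνq, h1]
  -- The two inequalities in `repairSet` rule out coincidences among `p`, `q` and their mates; as
  -- failed vertices are never available, the path `v x p q z w` has six distinct vertices.
  have hpz : p ≠ μ q := fun hh => hxq (by rw [hh, hμμ])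
  have hxz : μ p ≠ μ q := fun hh => hpq (by rw [← hμμ p, hh, hμμ])
  generalize hx : μ p = x at *
  generalize hz : μ q = z at *
  have ne_of : ∀ {y y' : Fin n}, y ∈ failedVerts sched (observation h) →
      y' ∉ failedVerts sched (observation h) → y ≠ y' := fun hy hy' hh => hy' (hh ▸ hy)
  have hvp := ne_of hvF hpF
  have hvq := ne_of hvF hqF
  have hvx := ne_of hvF hxF
  have hvz := ne_of hvF hzF
  have hwp := ne_of hwF hpF
  have hwq := ne_of hwF hqF
  have hwx := ne_of hwF hxF
  have hwz := ne_of hwF hzF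
  have hmsub := hn.makerEdges_subset
  have hclaim : Joined (makerEdges h') p q := by
    rw [hn.makerEdges_eq, if_neg fun hh => hc ((toEdge_mem_iff (p := (p, q)) hpq).1 hh)]
    exact ⟨_, Finset.mem_insert_self _ _, coe_toEdge e₀ (p := (p, q)) hpq⟩
  rw [won_observation] at hjp hjq
  have hjv := hjp.mono hmsub
  have hjw := hjq.mono hmsub
  classical
  -- The matching edges `xp` and `qz` are exchanged for `vx`, `pq` and `zw`.
  let ν' : Fin n → Fin n := fun y => if y = v then x else if y = x then v else if y = w then z
    else if y = z then w else if y = p then q else if y = q then p else ν y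
  have e1 : ν' v = x := by simp [ν']
  have e2 : ν' x = v := by simp [ν', hvx.symm]
  have e3 : ν' w = z := by simp [ν', hvw.symm, hwx]
  have e4 : ν' z = w := by simp [ν', hvz.symm, hxz.symm, hwz.symm]
  have e5 : ν' p = q := by simp [ν', hvp.symm, hxp.symm, hwp.symm, hpz]
  have e6 : ν' q = p := by
    simp [ν', hvq.symm, Ne.symm hxq, hwq.symm, hzq.symm, hpq.symm]
  have e7 : ∀ y, y ≠ v → y ≠ x → y ≠ w → y ≠ z → y ≠ p → y ≠ q → ν' y = ν y := by
    intro y g1 g2 g3 g4 g5 g6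
    simp [ν', g1, g2, g3, g4, g5, g6]
  clear_value ν'
  have cases6 : ∀ y, y = v ∨ y = x ∨ y = w ∨ y = z ∨ y = p ∨ y = q ∨
      (y ≠ v ∧ y ≠ x ∧ y ≠ w ∧ y ≠ z ∧ y ≠ p ∧ y ≠ q) := by
    intro y; tauto
  rw [PartialRepair, failed_congr hexp, mate_congr hexp]
  refine ⟨ν', ?_, ?_, ?_, ?_, ?_⟩
  · intro y
    rcases cases6 y with rfl | rfl | rfl | rfl | rfl | rfl | ⟨g1, g2, g3, g4, g5, g6⟩
    · rw [e1, e2]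
    · rw [e2, e1]
    · rw [e3, e4]
    · rw [e4, e3]
    · rw [e5, e6]
    · rw [e6, e5]
    · rw [e7 y g1 g2 g3 g4 g5 g6, e7 (ν y), h1]
      · exact fun hh => g1 (by rw [← h1 y, hh, hνv])
      · exact fun hh => g5 (by rw [← h1 y, hh, hνx])
      · exact fun hh => g3 (by rw [← h1 y, hh, hνw])
      · exact fun hh => g6 (by rw [← h1 y, hh, hνz])
      · exact fun hh => g2 (by rw [← h1 y, hh, hνp])
      · exact fun hh => g4 (by rw [← h1 y, hh, hνq])
  · intro y hy
    rcases cases6 y with rfl | rfl | rfl | rfl | rfl | rfl | ⟨g1, g2, g3, g4, g5, g6⟩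
    · rw [e1]; exact hjv
    · rw [e2]; exact hjv.symm
    · rw [e3]; exact hjw
    · rw [e4]; exact hjw.symm
    · rw [e5]; exact hclaim
    · rw [e6]; exact hclaim.symm
    · rw [e7 y g1 g2 g3 g4 g5 g6] at hy ⊢
      exact (h2 y hy).mono hmsub
  · intro y hy
    rcases cases6 y with rfl | rfl | rfl | rfl | rfl | rfl | ⟨g1, g2, g3, g4, g5, g6⟩
    · exact absurd (e1.symm.trans hy) hvx.symm
    · exact absurd (e2.symm.trans hy) hvx
    · exact absurd (e3.symm.trans hy) hwz.symm
    · exact absurd (e4.symm.trans hy) hwz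
    · exact absurd (e5.symm.trans hy) hpq.symm
    · exact absurd (e6.symm.trans hy) hpq
    · rw [e7 y g1 g2 g3 g4 g5 g6] at hy
      obtain ⟨i, f, hi, hif, hyf⟩ := h3 y hy
      refine ⟨i, f, ?_, hif, hyf⟩
      rcases Nat.eq_or_lt_of_le hi with rfl | hlt
      · rw [he, Option.some.injEq] at hif
        rw [← hif, out_spec e, Sym2.mem_iff] at hyf
        rcases hyf with hh | hh
        exacts [absurd hh g1, absurd hh g3]
      · exact hlt
  · intro i f hi hif y hyf
    have hyF : y ∈ failedVerts sched (observation h) :=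
      mem_failedVerts.2 ⟨f, List.mem_of_getElem? hif, hyf⟩
    rw [e7 y ?_ (ne_of hyF hxF) ?_ (ne_of hyF hzF) (ne_of hyF hpF) (ne_of hyF hqF)]
    · exact h4 i f (by omega) hif y hyf
    · rintro rfl
      have := hw.failed_index_eq he hif hve hyf
      omega
    · rintro rfl
      have := hw.failed_index_eq he hif hwe hyf
      omega
  · intro y hy
    have hold : Available sched (observation h) y :=
      available_mono hexp (by rw [touched_next_fix hn hs]; exact Finset.subset_union_right) hy
    -- Touching `p` and `q` makes them and their mates `x`, `z` unavailable, so the rearranged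
    -- vertices are exempt from agreeing with `mate`.
    have hpt : ∀ y', y' = p ∨ y' = q → y' ∈ touched sched (observation h') := by
      intro y' hy'
      rw [touched_next_fix hn hs, coe_toEdge e₀ (p := (p, q)) hpq]
      refine Finset.mem_union_left _ ?_
      simpa using hy'
    rw [e7 y]
    · exact h5 y hold
    · rintro rfl; exact hold.1 hvF
    · rintro rfl
      refine hy.2.2 (hpt _ (Or.inl ?_))
      rw [mate_congr hexp, ← hμ, ← hx, hμμ]
    · rintro rfl; exact hold.1 hwF
    · rintro rfl
      refine hy.2.2 (hpt _ (Or.inr ?_))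
      rw [mate_congr hexp, ← hμ, ← hz, hμμ]
    · rintro rfl; exact hy.2.1 (hpt _ (Or.inl rfl))
    · rintro rfl; exact hy.2.1 (hpt _ (Or.inr rfl))

-- As `mate` is an involution, each Maker neighbour `x` of `v` yields its own candidate `mate x`. It
-- is lost only if `x` is failed, or if `x` or its mate is touched.
open Classical in
theorem card_available_joined {h : History n} (hw : WellFormed sched h)
    (v : Fin n) : deg (makerEdges h) v ≤
      (Finset.univ.filter fun p => Available sched (observation h) p ∧
        Joined (won (observation h)) v (mate sched (observation h) p)).card +
      (failedVerts sched (observation h)).card + 2 * (touched sched (observation h)).card := by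
  set μ := mate sched (observation h) with hμ
  set FV := failedVerts sched (observation h) with hFV
  set t := touched sched (observation h) with ht
  have hμμ : ∀ y, μ (μ y) = y := hw.mate_mate
  have hinj : Function.Injective μ := fun y y' hh => by rw [← hμμ y, hh, hμμ]
  rw [← card_joined]
  have hsub : Finset.univ.filter (Joined (makerEdges h) v) ⊆
      ((Finset.univ.filter fun p => Available sched (observation h) p ∧
        Joined (won (observation h)) v (μ p)).image μ) ∪ FV ∪ (t ∪ t.image μ) := by
    intro x hx
    by_cases h1 : x ∈ FV
    · exact Finset.mem_union_left _ (Finset.mem_union_right _ h1)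
    by_cases h2 : x ∈ t
    · exact Finset.mem_union_right _ (Finset.mem_union_left _ h2)
    by_cases h3 : μ x ∈ t
    · exact Finset.mem_union_right _ (Finset.mem_union_right _
        (Finset.mem_image.2 ⟨μ x, h3, hμμ x⟩))
    refine Finset.mem_union_left _ (Finset.mem_union_left _ (Finset.mem_image.2 ⟨μ x, ?_, hμμ x⟩))
    rw [Finset.mem_filter, won_observation, hμμ]
    refine ⟨Finset.mem_univ _, ⟨?_, h3, ?_⟩, (Finset.mem_filter.1 hx).2⟩
    · intro h4
      have h5 := hw.mate_of_mem_failedVerts h4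
      rw [← hμ, hμμ] at h5
      exact h1 (by rw [h5]; exact h4)
    · rw [← hμ, hμμ]; exact h2
  refine (Finset.card_le_card hsub).trans ((Finset.card_union_le _ _).trans ?_)
  have g1 := Finset.card_union_le ((Finset.univ.filter fun p => Available sched (observation h) p ∧
        Joined (won (observation h)) v (μ p)).image μ) FV
  have g2 := Finset.card_union_le t (t.image μ)
  have g3 := Finset.card_image_le (s := t) (f := μ)
  have g4 := Finset.card_image_le (s := Finset.univ.filter fun p =>
    Available sched (observation h) p ∧ Joined (won (observation h)) v (μ p)) (f := μ)
  omega

-- Of all pairs of candidates for `v` and `w`, only those with `q = p` or `q = mate p` are excluded,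
-- at most two for each `p`; the summand `2` in the degree hypotheses pays for them.
open Classical in
theorem card_repairSet {h : History n} (hw : WellFormed sched h) {v w : Fin n} {κ : ℕ}
    (hv : κ + (failedVerts sched (observation h)).card +
      2 * (touched sched (observation h)).card + 2 ≤ deg (makerEdges h) v)
    (hw' : κ + (failedVerts sched (observation h)).card +
      2 * (touched sched (observation h)).card + 2 ≤ deg (makerEdges h) w) :
    κ * κ ≤ (repairSet sched (observation h) v w).card := by
  set X : Fin n → Finset (Fin n) := fun v => Finset.univ.filter fun p =>
    Available sched (observation h) p ∧
      Joined (won (observation h)) v (mate sched (observation h) p) with hX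
  have h1 : κ + 2 ≤ (X v).card := by
    have := card_available_joined hw v
    simp only [hX]
    omega
  have h2 : κ + 2 ≤ (X w).card := by
    have := card_available_joined hw w
    simp only [hX]
    omega
  have hsub : X v ×ˢ X w ⊆ repairSet sched (observation h) v w ∪
      ((X v).image (fun p => (p, p)) ∪
        (X v).image fun p => (p, mate sched (observation h) p)) := by
    rintro ⟨p, q⟩ hpq
    rw [Finset.mem_product] at hpq
    simp only [hX, Finset.mem_filter, Finset.mem_univ, true_and] at hpq
    simp only [hX, Finset.mem_union, mem_repairSet, Finset.mem_filter, Finset.mem_univ, true_and,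
      Finset.mem_image, Prod.mk.injEq]
    by_cases g1 : p = q
    · exact Or.inr (Or.inl ⟨p, hpq.1, rfl, g1⟩)
    by_cases g2 : mate sched (observation h) p = q
    · exact Or.inr (Or.inr ⟨p, hpq.1, rfl, g2⟩)
    exact Or.inl ⟨g1, g2, hpq.1.1, hpq.2.1, hpq.1.2, hpq.2.2⟩
  have h3 := Finset.card_le_card hsub
  rw [Finset.card_product] at h3
  have g1 := Finset.card_union_le (repairSet sched (observation h) v w)
    ((X v).image (fun p => (p, p)) ∪ (X v).image fun p => (p, mate sched (observation h) p))
  have g2 := Finset.card_union_le ((X v).image (fun p => (p, p)))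
    ((X v).image fun p => (p, mate sched (observation h) p))
  have g3 := Finset.card_image_le (s := X v) (f := fun p => (p, p))
  have g4 := Finset.card_image_le (s := X v) (f := fun p => (p, mate sched (observation h) p))
  have h4 : (X v).card * (κ + 2) ≤ (X v).card * (X w).card := Nat.mul_le_mul_left _ h2
  have h5 : κ * κ ≤ (X v).card * κ := Nat.mul_le_mul_right _ (by omega)
  nlinarith

/-- A single attempt to repair a failure is likely to succeed. -/
theorem le_step_fix {τ : BreakerStrategy n b} {h : History n} {j κ Q : ℕ} (hκ : 0 < κ)
    (hs : sched (observation h).length = Phase.fix j) (hw : WellFormed sched h)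
    (hU : unexposed sched (observation h) = ∅) (hr : PartialRepair sched j h)
    (hQ : (claimed h).card ≤ Q)
    (hd : ∀ v ∈ failedVerts sched (observation h),
      κ + (failedVerts sched (observation h)).card +
        2 * (touched sched (observation h)).card + 2 ≤ deg (makerEdges h) v) :
    ENNReal.ofReal (1 - 2 * Q / κ ^ 2) ≤
      (step a (strategy sched e₀) τ h).toOuterMeasure {h' | PartialRepair sched (j + 1) h'} := by
  classical
  have hnm : sched (observation h).length ≠ Phase.main := by rw [hs]; simp
  have hκ' : (0 : ℝ) < κ := by exact_mod_cast hκ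
  have hε : (0 : ℝ) ≤ 2 * Q / κ ^ 2 := by positivity
  -- If there is no failed pair with index `j`, the dummy attempt at `e₀` merely touches two
  -- vertices, which weakens availability and nothing else.
  rcases he : (failed sched (observation h))[j]? with _ | e
  · refine (ENNReal.ofReal_le_ofReal (sub_le_self _ hε)).trans ?_
    rw [ENNReal.ofReal_one]
    refine ((PMF.toOuterMeasure_apply_eq_one_iff _ _).2 fun h' hh => ?_).ge
    rw [← run_one] at hh
    have hx := ext_of_mem_support hh
    have hexp := hx.exposures_eq (sched := sched) fun i hi => by
      obtain rfl : i = 0 := by omega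
      exact hnm
    refine PartialRepair.succ_of_length_le ?_ (by rw [failed_congr hexp]; simpa using he)
    refine hr.mono hexp ?_ hx.makerEdges_subset
    cases hx with
    | @step _ h₁ _ e hx' _ hn =>
      cases hx'
      rw [touched_next_fix hn hs]
      exact Finset.subset_union_right
  · refine ofReal_one_sub_le_of_compl_le _ hε ?_
    have hmem : ∀ v ∈ (e : Sym2 (Fin n)), v ∈ failedVerts sched (observation h) :=
      fun v hv => mem_failedVerts.2 ⟨e, List.mem_of_getElem? he, hv⟩
    have hcard := card_repairSet hw
      (hd _ (hmem (e : Sym2 (Fin n)).out.1 (Sym2.out_fst_mem _)))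
      (hd _ (hmem (e : Sym2 (Fin n)).out.2 (Sym2.out_snd_mem _)))
    set R := repairSet sched (observation h) (e : Sym2 (Fin n)).out.1 (e : Sym2 (Fin n)).out.2
      with hR
    have hne : R.Nonempty := Finset.card_pos.1 (lt_of_lt_of_le (by positivity) hcard)
    refine (toOuterMeasure_le_expect (f := fun h' => ENNReal.ofReal
      (if PartialRepair sched (j + 1) h' then 0 else 1)) ?_).trans
      (expect_step_le hne (by rw [strategy, moveSet_fix hs he])
        (ψ := fun p => if Joined (claimed h) p.1 p.2 then 1 else 0) ?_ ?_ ?_)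
    · intro h' _ hh
      have hh' : ¬ PartialRepair sched (j + 1) h' := hh
      rw [if_neg hh', ENNReal.ofReal_one]
    · intro p hp h' hn
      by_cases hj : Joined (claimed h) p.1 p.2
      · rw [if_pos hj]
        split_ifs <;> norm_num
      · rw [if_pos (hr.succ_of_claim hw hU he hp hn hs hj), if_neg hj]
    · intro p _
      split_ifs <;> norm_num
    · rw [Finset.sum_boole]
      -- A claimed edge spoils at most two ordered pairs, so at most `2 * Q` of at least `κ ^ 2`
      -- choices fail.
      have h1 := card_filter_joined_le (claimed h) Finset.univ R fun p _ => Finset.mem_univ _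
      have h2 := h1.trans (sum_deg_le _ _)
      have h3 : (((R.filter fun p => Joined (claimed h) p.1 p.2).card : ℕ) : ℝ) ≤ 2 * Q := by
        exact_mod_cast h2.trans (Nat.mul_le_mul_left 2 hQ)
      have h4 : (κ : ℝ) ^ 2 ≤ R.card := by
        rw [sq]; exact_mod_cast hcard
      refine h3.trans ?_
      calc (2 * Q : ℝ) = 2 * Q / κ ^ 2 * κ ^ 2 := by field_simp
        _ ≤ 2 * Q / κ ^ 2 * R.card := by gcongr

theorem Ext.card_touched_le {σ : MakerStrategy n} {h h' : History n} {j : ℕ}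
    (hx : Ext a b σ h j h') (hs : ∀ i < j, ∃ i', sched ((observation h).length + i) = Phase.fix i') :
    (touched sched (observation h')).card ≤ (touched sched (observation h)).card + 2 * j := by
  induction hx with
  | refl => simp
  | @step j h₁ h₂ e hx _ hn ih =>
    have ih' := ih fun i hi => hs i (by omega)
    obtain ⟨i', hi'⟩ := hs j (by omega)
    rw [← hx.length_observation] at hi'
    have := card_touched_next_fix hn hi'
    omega

theorem Ext.touched_eq {σ : MakerStrategy n} {h h' : History n} {j : ℕ}
    (hx : Ext a b σ h j h') (hs : ∀ i < j, ∀ i', sched ((observation h).length + i) ≠ Phase.fix i') :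
    touched sched (observation h') = touched sched (observation h) := by
  induction hx with
  | refl => rfl
  | @step j h₁ h₂ e hx _ hn ih =>
    rw [hn.observation_eq, touched_cons_of_ne, ih fun i hi => hs i (by omega)]
    intro i'
    rw [hx.length_observation]
    exact hs j (by omega) i'

/-- At most `2 * S` vertices get touched and each may spoil itself and its mate, whence the `4 * S`
in `hk`; the failed vertices, at most `2 * S`, account for the rest of the `6 * S` in `le_run_fix`.
-/
theorem le_run_fix_aux {τ : BreakerStrategy n b} {h : History n} {S κ k Q : ℕ} (hκ : 0 < κ)
    (hs : ∀ i < S, sched ((observation h).length + i) = Phase.fix i) (hw : WellFormed sched h)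
    (hU : unexposed sched (observation h) = ∅) (ht : touched sched (observation h) = ∅)
    (hQ : (claimed h).card + (b + 1) * S ≤ Q)
    (hd : ∀ v ∈ failedVerts sched (observation h), k ≤ deg (makerEdges h) v)
    (hk : κ + (failedVerts sched (observation h)).card + 4 * S + 2 ≤ k) (s : ℕ) (hsS : s ≤ S) :
    ENNReal.ofReal (1 - s * (2 * Q / κ ^ 2)) ≤
      (run a (strategy sched e₀) τ s h).toOuterMeasure {h' | PartialRepair sched s h'} := by
  have hκ' : (0 : ℝ) < κ := by exact_mod_cast hκ
  induction s with
  | zero =>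
    simp only [run, CharP.cast_eq_zero, zero_mul, sub_zero, ENNReal.ofReal_one]
    rw [PMF.toOuterMeasure_pure_apply, if_pos]
    exact partialRepair_zero hw hU
  | succ s ih =>
    have e1 : (((s + 1 : ℕ) : ℝ)) * (2 * Q / κ ^ 2) =
      s * (2 * Q / κ ^ 2) + 2 * Q / κ ^ 2 := by push_cast; ring
    rw [e1]
    refine (ofReal_one_sub_add_le (by positivity) (by positivity)).trans
      (mul_le_run_add (ih (by omega)) fun h₁ hx hh₁ => ?_)
    rw [run_one]
    have hexp := hx.exposures_eq (sched := sched) fun i hi => by rw [hs i (by omega)]; simp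
    have htc := hx.card_touched_le (sched := sched) fun i hi => ⟨i, hs i (by omega)⟩
    rw [ht, Finset.card_empty, zero_add] at htc
    refine le_step_fix hκ ?_ (hw.of_exposures_eq hexp hx.makerEdges_subset)
      (by rw [unexposed_congr hexp]; exact hU) hh₁ ?_ ?_
    · rw [hx.length_observation]
      exact hs s (by omega)
    · obtain ⟨r, hr, hc⟩ := hx.exists_claimed
      rw [hc]
      refine (Finset.card_union_le _ _).trans (le_trans ?_ hQ)
      have : (b + 1) * s ≤ (b + 1) * S := Nat.mul_le_mul_left _ (by omega)
      omega
    · rw [failedVerts_congr hexp]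
      intro v hv
      have := (hd v hv).trans (deg_mono hx.makerEdges_subset v)
      omega

/-- A matching that covers all vertices. -/
theorem hasPerfectMatching_of_involution {h : History n} {ν : Fin n → Fin n}
    (h1 : ∀ y, ν (ν y) = y) (h2 : ∀ y, Joined (makerEdges h) y (ν y)) : HasPerfectMatching h := by
  refine ⟨{
    verts := Set.univ
    Adj := fun x y => ν x = y
    adj_sub := ?_
    edge_vert := ?_
    symm := ?_ }, ⟨?_, ?_⟩, ?_⟩
  · rintro x y rfl
    exact (h2 x).ne
  · intros; trivial
  · refine ⟨?_⟩
    rintro x y rfl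
    exact h1 x
  · intro x _
    exact ⟨ν x, rfl, fun y hy => Eq.symm (show ν x = y from hy)⟩
  · intro x
    trivial
  · rintro ⟨e, he'⟩ he
    induction e with
    | _ x y =>
      have hxy : ν x = y := by simpa using he
      obtain ⟨f, hf, hfe⟩ := h2 x
      rw [hxy] at hfe
      rwa [show (⟨s(x, y), he'⟩ : Edge n) = f from Subtype.ext hfe.symm]

theorem PartialRepair.hasPerfectMatching {h : History n} {j : ℕ} (hr : PartialRepair sched j h)
    (hj : (failed sched (observation h)).length ≤ j) : HasPerfectMatching h := by
  obtain ⟨ν, h1, h2, h3, -, -⟩ := hr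
  refine hasPerfectMatching_of_involution h1 fun y => h2 y fun hy => ?_
  obtain ⟨i, e, hi, hie, -⟩ := h3 y hy
  have := (List.getElem?_eq_some_iff.1 hie).1
  omega

theorem Ext.hasPerfectMatching {σ : MakerStrategy n} {h h' : History n} {j : ℕ}
    (hx : Ext a b σ h j h') (hh : HasPerfectMatching h) : HasPerfectMatching h' := by
  obtain ⟨M, hM, hMe⟩ := hh
  exact ⟨M, hM, fun e he => hx.makerEdges_subset (hMe e he)⟩

/-- A segment of attempts to repair the failures completes a perfect matching. -/
theorem le_run_fix {τ : BreakerStrategy n b} {h : History n} {S κ k Q : ℕ} (hκ : 0 < κ)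
    (hs : ∀ i < S, sched ((observation h).length + i) = Phase.fix i) (hw : WellFormed sched h)
    (hU : unexposed sched (observation h) = ∅) (ht : touched sched (observation h) = ∅)
    (hS : (failed sched (observation h)).length ≤ S)
    (hQ : (claimed h).card + (b + 1) * S ≤ Q)
    (hd : ∀ v ∈ failedVerts sched (observation h), k ≤ deg (makerEdges h) v)
    (hk : κ + 6 * S + 2 ≤ k) :
    ENNReal.ofReal (1 - S * (2 * Q / κ ^ 2)) ≤
      (run a (strategy sched e₀) τ S h).toOuterMeasure {h' | HasPerfectMatching h'} := by
  have hF := card_failedVerts_le (sched := sched) (observation h)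
  refine le_run_of_subset (le_run_fix_aux hκ hs hw hU ht hQ hd (by omega) S le_rfl)
    fun h' hx hh => PartialRepair.hasPerfectMatching hh ?_
  rw [failed_congr (hx.exposures_eq fun i hi => by rw [hs i hi]; simp)]
  exact hS

end

/-! ### Composing segments along the schedule -/

section

variable {n a b : ℕ} {sched : ℕ → Phase} {e₀ : Edge n}

/-! ### The schedule -/

/-- From time `t` on, the schedule proceeds according to the list `L`. -/
def Follows (sched : ℕ → Phase) (t : ℕ) (L : List Phase) : Prop :=
  ∀ i (hi : i < L.length), sched (t + i) = L[i]

theorem Follows.left {t : ℕ} {L M : List Phase} (h : Follows sched t (L ++ M)) :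
    Follows sched t L := by
  intro i hi
  rw [h i (by rw [List.length_append]; omega), List.getElem_append_left hi]

theorem Follows.right {t : ℕ} {L M : List Phase} (h : Follows sched t (L ++ M)) :
    Follows sched (t + L.length) M := by
  intro i hi
  rw [add_assoc, h (L.length + i) (by rw [List.length_append]; omega),
    List.getElem_append_right (by omega)]
  congr 1
  omega

/-- A number of exposures, followed by attempts at the vertices whose exposure failed. -/
def window (T S ℓ : ℕ) : List Phase :=
  List.replicate ℓ Phase.main ++ (List.range (T * S)).map fun x => Phase.attach (x / T)

theorem length_window (T S ℓ : ℕ) : (window T S ℓ).length = ℓ + T * S := by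
  simp [window]

theorem Follows.window_main {t T S ℓ : ℕ} (h : Follows sched t (window T S ℓ)) :
    ∀ i < ℓ, sched (t + i) = Phase.main := by
  intro i hi
  rw [h.left i (by simpa using hi), List.getElem_replicate]

theorem Follows.window_attach {t T S ℓ : ℕ} (h : Follows sched t (window T S ℓ)) :
    ∀ i < S, ∀ j < T, sched (t + ℓ + (T * i + j)) = Phase.attach i := by
  intro i hi j hj
  have h1 := h.right
  rw [List.length_replicate] at h1
  have hlt : T * i + j < T * S := by
    calc T * i + j < T * i + T := by omega
      _ = T * (i + 1) := by ring
      _ ≤ T * S := Nat.mul_le_mul_left _ hi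
  rw [h1 (T * i + j) (by simpa using hlt), List.getElem_map, List.getElem_range,
    Nat.mul_add_div (by omega), Nat.div_eq_of_lt hj, add_zero]

theorem Follows.attach_cases {t T S ℓ : ℕ} (h : Follows sched t (window T S ℓ)) :
    ∀ x < T * S, ∃ i, sched (t + ℓ + x) = Phase.attach i := by
  intro x hx
  have hT : 0 < T := Nat.pos_of_ne_zero fun h0 => by simp [h0] at hx
  have := h.window_attach (x / T) (Nat.div_lt_of_lt_mul hx) (x % T) (Nat.mod_lt _ hT)
  rw [Nat.div_add_mod] at this
  exact ⟨_, this⟩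

/-! ### A window of the play -/

/-- The situation after a window: there are `m` unexposed vertices and at most `f` failures, and
Maker has gained `k` edges at each vertex whose exposure failed. -/
structure Progress (sched : ℕ → Phase) (k f m : ℕ) (h : History n) : Prop where
  wellFormed : WellFormed sched h
  touched_eq : touched sched (observation h) = ∅
  card_unexposed : (unexposed sched (observation h)).card = m
  length_failed : (failed sched (observation h)).length ≤ f
  attached : ∀ v ∈ failedVerts sched (observation h), k ≤ deg (makerEdges h) v

theorem progress_nil (k : ℕ) : Progress sched k 0 n ([] : History n) := by
  refine ⟨wellFormed_nil, rfl, ?_, by rw [failed_nil]; simp, ?_⟩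
  · rw [unexposed_nil, Finset.card_univ, Fintype.card_fin]
  · intro v hv
    obtain ⟨e, he, -⟩ := mem_failedVerts.1 hv
    rw [failed_nil] at he
    simp at he

/-- The event `G` describes the state between exposing and attaching. It is handed on with its
witness `h₁`, because degree information about the unexposed vertices obtained there is needed in
the next window. -/
theorem le_run_window {τ : BreakerStrategy n b} {h : History n} {k f m φ T S ℓ : ℕ} {q : ℝ}
    {c : ℝ≥0∞} (hn2 : 2 ≤ n) (hq : q ≤ 1) (hp : Progress sched k f m h)
    (hF : Follows sched (observation h).length (window T S ℓ)) (hm : 2 * ℓ ≤ m)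
    (hS : 2 * (f + φ) ≤ S) (G : Set (History n))
    (hG : c ≤ (run a (strategy sched e₀) τ ℓ h).toOuterMeasure G)
    (hGf : ∀ h₁ ∈ G, Ext a b (strategy sched e₀) h ℓ h₁ →
      (failed sched (observation h₁)).length ≤ f + φ ∧
      ∀ v ∈ failedVerts sched (observation h₁), k ≤ deg (makerEdges h₁) v ∨
        ((deg (breakerEdges h₁) v + b * (T * S) : ℕ) : ℝ) + k ≤ (1 - q) * (n - 1)) :
    c * ENNReal.ofReal (1 - S * (2 ^ k * (1 - q / 2) ^ T)) ≤
      (run a (strategy sched e₀) τ (ℓ + T * S) h).toOuterMeasure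
        {h' | Progress sched k (f + φ) (m - 2 * ℓ) h' ∧ ∃ h₁ ∈ G,
          Ext a b (strategy sched e₀) h ℓ h₁ ∧ Ext a b (strategy sched e₀) h₁ (T * S) h' ∧
          unexposed sched (observation h') = unexposed sched (observation h₁)} := by
  refine mul_le_run_add hG fun h₁ hx hh => ?_
  obtain ⟨h1, h2⟩ := hGf h₁ hh hx
  have hseg := hx.main_segment hF.window_main (by rw [hp.card_unexposed]; exact hm)
  have hl := hx.length_observation
  refine le_run_of_subset (le_run_attach hn2 hq ?_ ?_ h2) fun h' hx' hh' => ?_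
  · rw [hl]
    exact hF.window_attach
  · have := card_failedVerts_le (sched := sched) (observation h₁)
    omega
  · have hexp := hx'.exposures_eq (sched := sched) fun i hi => by
      obtain ⟨i', hi'⟩ := hF.attach_cases i hi
      rw [hl, hi']
      simp
    have ht1 := hx.touched_eq (sched := sched) fun i hi i' => by
      rw [hF.window_main i hi]; simp
    have ht2 := hx'.touched_eq (sched := sched) fun i hi i' => by
      obtain ⟨i'', hi''⟩ := hF.attach_cases i hi
      rw [hl, hi'']
      simp
    refine ⟨⟨(hseg.2.2.2 hp.wellFormed).of_exposures_eq hexp hx'.makerEdges_subset, ?_, ?_, ?_, ?_⟩,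
      h₁, hh, hx, hx', unexposed_congr hexp⟩
    · rw [ht2, ht1, hp.touched_eq]
    · rw [unexposed_congr hexp]
      have := hp.card_unexposed
      omega
    · rw [failed_congr hexp]
      exact h1
    · rw [failedVerts_congr hexp]
      exact hh'

theorem le_run_repair {τ : BreakerStrategy n b} {h : History n} {k f S κ Q : ℕ} (hκ : 0 < κ)
    (hp : Progress sched k f 0 h)
    (hF : Follows sched (observation h).length ((List.range S).map Phase.fix)) (hS : f ≤ S)
    (hQ : (claimed h).card + (b + 1) * S ≤ Q) (hk : κ + 6 * S + 2 ≤ k) :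
    ENNReal.ofReal (1 - S * (2 * Q / κ ^ 2)) ≤
      (run a (strategy sched e₀) τ S h).toOuterMeasure {h' | HasPerfectMatching h'} := by
  refine le_run_fix hκ ?_ hp.wellFormed (Finset.card_eq_zero.1 hp.card_unexposed) hp.touched_eq
    (hp.length_failed.trans hS) hQ hp.attached hk
  intro i hi
  rw [hF i (by simpa using hi), List.getElem_map, List.getElem_range]

/-- Maker never loses edges, so a perfect matching owned after `N` attempts is still owned after `a
* t` of them. -/
theorem le_winProbWithin (ha : 0 < a) {σ : MakerStrategy n} {τ : BreakerStrategy n b} {N t : ℕ}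
    {p : ℝ} (hN : N ≤ a * t)
    (hp : ENNReal.ofReal p ≤ (run a σ τ N []).toOuterMeasure {h | HasPerfectMatching h}) :
    p ≤ winProbWithin a σ τ t := by
  unfold winProbWithin
  rw [← ENNReal.ofReal_le_iff_le_toReal ((toOuterMeasure_le_one _ _).trans_lt (by simp)).ne,
    play_eq_run ha]
  obtain ⟨j, hj⟩ := Nat.exists_eq_add_of_le hN
  rw [hj, ← mul_one (ENNReal.ofReal p)]
  refine mul_le_run_add hp fun h hx hh => ?_
  exact ((PMF.toOuterMeasure_apply_eq_one_iff _ _).2 fun h' hh' =>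
    (ext_of_mem_support hh').hasPerfectMatching hh).ge

/-- The failing probability of a segment of attempts at a vertex. -/
theorem two_pow_mul_pow_le {k T : ℕ} {q : ℝ} (hk : 0 < k) (hq : q ≤ 1) (hqT : 4 * k ≤ q * T) :
    2 ^ k * (1 - q / 2) ^ T ≤ 1 / (k : ℝ) := by
  have hk' : (0 : ℝ) < k := by exact_mod_cast hk
  have h1 : (1 - q / 2) ^ T ≤ Real.exp (-(q / 2)) ^ T := by
    refine pow_le_pow_left₀ (by linarith) ?_ T
    have := Real.add_one_le_exp (-(q / 2))
    linarith
  have h2 : (2 : ℝ) ^ k ≤ Real.exp 1 ^ k := by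
    refine pow_le_pow_left₀ (by norm_num) ?_ k
    have := Real.add_one_le_exp (1 : ℝ)
    linarith
  rw [← Real.exp_nat_mul] at h1 h2
  calc 2 ^ k * (1 - q / 2) ^ T ≤ Real.exp (k * 1) * Real.exp (T * (-(q / 2))) :=
        mul_le_mul h2 h1 (pow_nonneg (by linarith) _) (by positivity)
    _ = Real.exp (k * 1 + T * (-(q / 2))) := (Real.exp_add _ _).symm
    _ ≤ Real.exp (-k) := by
        gcongr
        linarith
    _ = 1 / Real.exp k := by rw [Real.exp_neg, one_div]
    _ ≤ 1 / k := by
        gcongr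
        have := Real.add_one_le_exp (k : ℝ)
        linarith

end

/-! ### Parameters as powers of `s`, and the win with high probability -/

section

variable {n a b : ℕ} {sched : ℕ → Phase} {e₀ : Edge n}

/-! ### The parameters -/

/-- The number `s` is of order `n ^ (1 / 100)`, and large in terms of the bias `b`, the number `W`
of windows and the constant `c`. -/
structure Scale (b W c s n : ℕ) : Prop where
  pow_le : s ^ 100 ≤ n
  le_pow : n ≤ c * s ^ 100
  weight_le : weight n ≤ s
  large : 400 * (b + 1) ^ 2 * W ^ 2 * c ≤ s
  two_le : 2 ≤ W
  one_le : 1 ≤ c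

namespace Scale

variable {W c s : ℕ}

theorem large_of_le (h : Scale b W c s n) {x : ℕ} (hx : x ≤ (b + 1) ^ 2 * W ^ 2 * c) :
    400 * x ≤ s := by
  have := h.large
  nlinarith

theorem sq_mul_le (h : Scale b W c s n) : 400 * ((b + 1) ^ 2 * W ^ 2) ≤ s :=
  h.large_of_le (Nat.le_mul_of_pos_right _ h.one_le)

theorem W_sq_le (h : Scale b W c s n) : 400 * ((b + 1) * W ^ 2) ≤ s := by
  refine le_trans ?_ h.sq_mul_le
  have : b + 1 ≤ (b + 1) ^ 2 := Nat.le_self_pow (by norm_num) _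
  gcongr

theorem W_le (h : Scale b W c s n) : 400 * ((b + 1) * W) ≤ s := by
  refine le_trans ?_ h.W_sq_le
  have : W ≤ W ^ 2 := Nat.le_self_pow (by norm_num) _
  gcongr

theorem W_le' (h : Scale b W c s n) : 400 * W ≤ s :=
  le_trans (Nat.mul_le_mul_left _ (Nat.le_mul_of_pos_left _ (by omega))) h.W_le

theorem b_sq_le (h : Scale b W c s n) : 400 * (b + 1) ^ 2 ≤ s :=
  le_trans (Nat.mul_le_mul_left _ (Nat.le_mul_of_pos_right _ (pow_pos (by have := h.two_le; omega) _)))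
    h.sq_mul_le

theorem b_le (h : Scale b W c s n) : 400 * (b + 1) ≤ s :=
  le_trans (Nat.mul_le_mul_left _ (Nat.le_self_pow (by norm_num) _)) h.b_sq_le

theorem s_large (h : Scale b W c s n) : 400 ≤ s := by
  have := h.b_le
  omega

/-- Used throughout to absorb a constant factor into one additional power of `s`. -/
theorem _root_.PhantomGame.mul_pow_le_pow_succ {s x i : ℕ} (hx : x ≤ s) : x * s ^ i ≤ s ^ (i + 1) := by
  rw [pow_succ, mul_comm]
  exact Nat.mul_le_mul_left _ hx

theorem pow_mono (h : Scale b W c s n) {i j : ℕ} (hij : i ≤ j) : s ^ i ≤ s ^ j :=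
  Nat.pow_le_pow_right (by have := h.s_large; omega) hij

theorem pow_pos (h : Scale b W c s n) (i : ℕ) : 0 < s ^ i :=
  Nat.pow_pos (by have := h.s_large; omega)

/-- The total length of the segments spent on the vertices whose exposure failed. -/
theorem attach_le (h : Scale b W c s n) :
    40 * ((b + 1) * W * (s ^ 75 * (2 * W * s ^ 4))) ≤ s ^ 80 := by
  calc 40 * ((b + 1) * W * (s ^ 75 * (2 * W * s ^ 4))) = 80 * ((b + 1) * W ^ 2) * s ^ 79 := by ring
    _ ≤ s ^ 80 := mul_pow_le_pow_succ (by have := h.W_sq_le; omega)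

theorem attach_le' (h : Scale b W c s n) :
    40 * ((b + 1) * (s ^ 75 * (2 * W * s ^ 4))) ≤ s ^ 80 := by
  refine le_trans (Nat.mul_le_mul_left _ ?_) h.attach_le
  exact Nat.mul_le_mul_right _ (Nat.le_mul_of_pos_right _ (by have := h.two_le; omega))

theorem k_le (h : Scale b W c s n) : 40 * s ^ 54 ≤ s ^ 80 :=
  (mul_pow_le_pow_succ (by have := h.s_large; omega)).trans (h.pow_mono (by norm_num))

theorem fix_le (h : Scale b W c s n) : 40 * (W * s ^ 4) ≤ s ^ 80 := by
  rw [← mul_assoc]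
  exact (mul_pow_le_pow_succ (by have := h.W_le'; omega)).trans (h.pow_mono (by norm_num))

theorem pow_eighty_le (h : Scale b W c s n) {x : ℕ} (hx : x ≤ s) : x * s ^ 80 ≤ n :=
  ((mul_pow_le_pow_succ hx).trans (h.pow_mono (by norm_num))).trans h.pow_le

theorem total_le (h : Scale b W c s n) :
    W * (s ^ 75 * (2 * W * s ^ 4)) + W * s ^ 4 ≤ s ^ 80 := by
  have h1 := h.attach_le
  have h2 := h.fix_le
  have h3 : W * (s ^ 75 * (2 * W * s ^ 4)) ≤ (b + 1) * W * (s ^ 75 * (2 * W * s ^ 4)) :=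
    Nat.mul_le_mul_right _ (Nat.le_mul_of_pos_left _ (by omega))
  omega

theorem s_pos (h : Scale b W c s n) : (0 : ℝ) < s := by
  have := h.s_large
  exact_mod_cast (by omega : 0 < s)

theorem n_pos (h : Scale b W c s n) : 0 < n := lt_of_lt_of_le (h.pow_pos 100) h.pow_le

theorem n_large (h : Scale b W c s n) : 400 ≤ n := by
  have h1 := h.pow_eighty_le h.s_large
  have h2 := h.pow_pos 80
  nlinarith

theorem q_le (h : Scale b W c s n) : (s : ℝ) ^ 80 / (2 * n) ≤ 1 := by
  have hn : (0 : ℝ) < n := by exact_mod_cast h.n_pos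
  have h1 : ((1 * s ^ 80 : ℕ) : ℝ) ≤ n := by
    exact_mod_cast h.pow_eighty_le (x := 1) (by have := h.s_large; omega)
  push_cast at h1
  rw [div_le_one (by positivity)]
  linarith

/-- With `q = s ^ 80 / (2 * n)`, the reserve `2 * s ^ 80` covers the `q` fraction of the star, at
most `s ^ 80`, and also Breaker's edges during attaching and the target `k = s ^ 54`, each at most
`s ^ 80 / 40`. -/
theorem degree_le (h : Scale b W c s n) {x : ℕ} (hx : x + 2 * s ^ 80 ≤ n) :
    ((x + b * (s ^ 75 * (2 * W * s ^ 4)) : ℕ) : ℝ) + (s ^ 54 : ℕ) ≤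
      (1 - (s : ℝ) ^ 80 / (2 * n)) * (n - 1) := by
  have hn : (0 : ℝ) < n := by exact_mod_cast h.n_pos
  have h1 := h.attach_le'
  have h2 := h.k_le
  have h3 : b * (s ^ 75 * (2 * W * s ^ 4)) ≤ (b + 1) * (s ^ 75 * (2 * W * s ^ 4)) :=
    Nat.mul_le_mul_right _ (by omega)
  have h4 : 1 ≤ s ^ 54 := h.pow_pos 54
  have h5 : x + b * (s ^ 75 * (2 * W * s ^ 4)) + s ^ 54 + s ^ 80 + 1 ≤ n := by omega
  have h6 : ((x + b * (s ^ 75 * (2 * W * s ^ 4)) : ℕ) : ℝ) + (s ^ 54 : ℕ) + (s : ℝ) ^ 80 + 1 ≤ n := by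
    exact_mod_cast h5
  have h7 : (s : ℝ) ^ 80 / (2 * n) * (n - 1) ≤ (s : ℝ) ^ 80 := by
    rw [div_mul_eq_mul_div, div_le_iff₀ (by positivity)]
    have : (0 : ℝ) ≤ (s : ℝ) ^ 80 := by positivity
    nlinarith
  linarith

/-- With `T = s ^ 75` and `n ≤ c * s ^ 100`, the product `q * T` exceeds `4 * s ^ 54`, so one vertex
fails to gain its `k` edges with probability at most `1 / s ^ 54`. That beats the number `2 * W * s
^ 4` of slots. -/
theorem attach_error_le (h : Scale b W c s n) :
    ((2 * W * s ^ 4 : ℕ) : ℝ) *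
      (2 ^ (s ^ 54) * (1 - (s : ℝ) ^ 80 / (2 * n) / 2) ^ (s ^ 75)) ≤ 1 / s := by
  have hn : (0 : ℝ) < n := by exact_mod_cast h.n_pos
  have hs := h.s_pos
  have h1 := two_pow_mul_pow_le (T := s ^ 75) (h.pow_pos 54) h.q_le (by
    have h2 : 8 * c * s ^ 54 * s ^ 100 ≤ s ^ 155 := by
      have h3 : 8 * c ≤ s := by
        have := h.large_of_le (x := c) (Nat.le_mul_of_pos_left _ (by
          have := h.two_le
          positivity))
        omega
      calc 8 * c * s ^ 54 * s ^ 100 = (8 * c) * s ^ 154 := by ring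
        _ ≤ s ^ 155 := mul_pow_le_pow_succ h3
    have h4 : 8 * s ^ 54 * n ≤ s ^ 155 := by
      calc 8 * s ^ 54 * n ≤ 8 * s ^ 54 * (c * s ^ 100) := Nat.mul_le_mul_left _ h.le_pow
        _ = 8 * c * s ^ 54 * s ^ 100 := by ring
        _ ≤ _ := h2
    have h5 : (8 : ℝ) * s ^ 54 * n ≤ s ^ 155 := by exact_mod_cast h4
    push_cast
    rw [div_mul_eq_mul_div, le_div_iff₀ (by positivity), ← pow_add]
    norm_num
    linarith)
  refine (mul_le_mul_of_nonneg_left h1 (by positivity)).trans ?_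
  push_cast
  rw [mul_one_div, div_le_div_iff₀ (by positivity) hs]
  have h6 : 2 * W * s ^ 4 * s ≤ 1 * s ^ 54 := by
    calc 2 * W * s ^ 4 * s = 2 * W * s ^ 5 := by ring
      _ ≤ s ^ 6 := mul_pow_le_pow_succ (by have := h.W_le'; omega)
      _ ≤ s ^ 54 := h.pow_mono (by norm_num)
      _ = _ := (one_mul _).symm
  exact_mod_cast h6

/-- Here `κ = s ^ 53`, so `κ ^ 2 = s ^ 106`, while the `W * s ^ 4` repairs each face at most `(b +
1) * n` claimed edges, of order `s ^ 100`. -/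
theorem repair_error_le (h : Scale b W c s n) :
    ((W * s ^ 4 : ℕ) : ℝ) * (2 * ((b + 1) * n : ℕ) / ((s ^ 53 : ℕ) : ℝ) ^ 2) ≤ 1 / s := by
  have hs := h.s_pos
  push_cast
  rw [mul_div_assoc', div_le_div_iff₀ (by positivity) hs]
  have h1 : W * s ^ 4 * (2 * ((b + 1) * n)) * s ≤ 1 * (s ^ 53) ^ 2 := by
    calc W * s ^ 4 * (2 * ((b + 1) * n)) * s
        ≤ W * s ^ 4 * (2 * ((b + 1) * (c * s ^ 100))) * s := by
          gcongr
          exact h.le_pow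
      _ = 2 * ((b + 1) * W * c) * s ^ 105 := by ring
      _ ≤ s ^ 106 := by
        refine mul_pow_le_pow_succ ?_
        have : 400 * ((b + 1) * W * c) ≤ s := by
          refine h.large_of_le ?_
          gcongr
          · exact Nat.le_self_pow (by norm_num) _
          · exact Nat.le_self_pow (by norm_num) _
        omega
      _ = _ := by ring
  exact_mod_cast h1

theorem repair_size (h : Scale b W c s n) : s ^ 53 + 6 * (W * s ^ 4) + 2 ≤ s ^ 54 := by
  have h1 : 6 * (W * s ^ 4) ≤ s ^ 53 := by
    rw [← mul_assoc]
    exact (mul_pow_le_pow_succ (by have := h.W_le'; omega)).trans (h.pow_mono (by norm_num))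
  have h2 : 400 * s ^ 53 ≤ s ^ 54 := mul_pow_le_pow_succ h.s_large
  have h3 := h.pow_pos 53
  omega

end Scale

theorem Ext.length_failed_le_add {σ : MakerStrategy n} {h h' : History n} {j : ℕ}
    (hx : Ext a b σ h j h') : (failed sched (observation h')).length ≤
      (failed sched (observation h)).length + j := by
  induction hx with
  | refl => simp
  | @step j h₁ h₂ e _ _ hn ih =>
    by_cases hs : sched (observation h₁).length = Phase.main
    · rw [failed_next_main hn hs]
      split_ifs
      · rw [List.length_cons]; omega
      · omega
    · rw [failed_congr (exposures_next_of_ne hn hs)]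
      omega

theorem Ext.length_eq {σ : MakerStrategy n} {h : History n} {t : ℕ} (hx : Ext a b σ [] t h) :
    (observation h).length = t := by
  simpa [observation] using hx.length_observation

/-- Markov's inequality against `s ^ 4` new failures, where `x` is the average degree at the start
of the window. The bound `hx` serves three situations at once: `0` at the start of the game, `s ^ 2
+ 1` in the short window, and `16 * (b + 1) ^ 2` in the long windows. -/
theorem failure_error_le {W c s m : ℕ} {x : ℝ} (h : Scale b W c s n) (hm : m ≤ n) (hx0 : 0 ≤ x)
    (hx : x ≤ s ^ 2 + 1 + 16 * (b + 1) ^ 2) :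
    (weight m * x + (b + 1) * weight m ^ 2) / ((s ^ 4 : ℕ) : ℝ) ≤ 2 / s := by
  have hs := h.s_pos
  have hw : weight m ≤ s := (weight_mono hm).trans h.weight_le
  have hw0 := weight_nonneg m
  push_cast
  rw [div_le_div_iff₀ (by positivity) hs]
  have h1 : (400 * (b + 1) ^ 2 : ℝ) ≤ s := by exact_mod_cast h.b_sq_le
  have h2 : (1 : ℝ) ≤ (b + 1) ^ 2 := one_le_pow₀ (by linarith [(Nat.cast_nonneg b : (0 : ℝ) ≤ b)])
  have h3 : (400 * (b + 1) : ℝ) ≤ s := by exact_mod_cast h.b_le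
  have h4 : weight m * x ≤ s * (s ^ 2 + s) := by
    refine mul_le_mul hw ?_ hx0 hs.le
    linarith
  have h6 : weight m * x + (b + 1) * weight m ^ 2 ≤ 2 * s ^ 3 := by
    have hs1 : (400 : ℝ) ≤ s := by exact_mod_cast h.s_large
    have h9 : (b + 1) * weight m ^ 2 ≤ (s / 400) * s ^ 2 := by
      refine mul_le_mul (by linarith) (by gcongr) (by positivity) (by positivity)
    nlinarith [mul_nonneg hs.le hs.le, mul_nonneg (mul_nonneg hs.le hs.le) (sub_nonneg.2 hs1)]
  calc (weight m * x + (b + 1) * weight m ^ 2) * s ≤ 2 * (s : ℝ) ^ 3 * s := by gcongr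
    _ = 2 * (s : ℝ) ^ 4 := by ring

theorem Scale.le_run_window {W c s k' m ℓ f φ : ℕ} (h : Scale b W c s n) {τ : BreakerStrategy n b}
    {h₀ : History n} {p : ℝ≥0∞} (hk : k' = s ^ 54) (hp : Progress sched k' f m h₀)
    (hF : Follows sched (observation h₀).length (window (s ^ 75) (2 * W * s ^ 4) ℓ))
    (hm : 2 * ℓ ≤ m) (hφ : f + φ ≤ W * s ^ 4) (G : Set (History n))
    (hG : p ≤ (run a (strategy sched e₀) τ ℓ h₀).toOuterMeasure G)
    (hGf : ∀ h₁ ∈ G, Ext a b (strategy sched e₀) h₀ ℓ h₁ →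
      (failed sched (observation h₁)).length ≤ f + φ ∧
      ∀ v ∈ failedVerts sched (observation h₁), k' ≤ deg (makerEdges h₁) v ∨
        deg (breakerEdges h₁) v + 2 * s ^ 80 ≤ n) :
    p * ENNReal.ofReal (1 - 1 / s) ≤
      (run a (strategy sched e₀) τ (ℓ + s ^ 75 * (2 * W * s ^ 4)) h₀).toOuterMeasure
        {h' | Progress sched k' (f + φ) (m - 2 * ℓ) h' ∧ ∃ h₁ ∈ G,
          Ext a b (strategy sched e₀) h₀ ℓ h₁ ∧
          Ext a b (strategy sched e₀) h₁ (s ^ 75 * (2 * W * s ^ 4)) h' ∧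
          unexposed sched (observation h') = unexposed sched (observation h₁)} := by
  subst hk
  have hn400 := h.n_large
  refine le_trans (mul_le_mul_right (ENNReal.ofReal_le_ofReal ?_) p)
    (PhantomGame.le_run_window (by omega) h.q_le hp hF hm (by rw [mul_assoc]; omega) G hG
      fun h₁ hh hx => ⟨(hGf h₁ hh hx).1, fun v hv =>
        ((hGf h₁ hh hx).2 v hv).imp_right fun hd => h.degree_le hd⟩)
  linarith [h.attach_error_le]

theorem Scale.le_run_repair {W c s f : ℕ} (h : Scale b W c s n) {τ : BreakerStrategy n b}
    {h₀ : History n} {t : ℕ} (hp : Progress sched (s ^ 54) f 0 h₀) (hf : f ≤ W * s ^ 4)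
    (hF : Follows sched (observation h₀).length ((List.range (W * s ^ 4)).map Phase.fix))
    (hx : Ext a b (strategy sched e₀) [] t h₀) (ht : t + W * s ^ 4 ≤ n) :
    ENNReal.ofReal (1 - 1 / s) ≤ (run a (strategy sched e₀) τ (W * s ^ 4) h₀).toOuterMeasure
      {h' | HasPerfectMatching h'} := by
  refine le_trans (ENNReal.ofReal_le_ofReal ?_)
    (PhantomGame.le_run_repair (Q := (b + 1) * n) (h.pow_pos 53) hp hF hf ?_ h.repair_size)
  · linarith [h.repair_error_le]
  · refine (Nat.add_le_add_right hx.card_claimed_le _).trans ?_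
    rw [← mul_add]
    exact Nat.mul_le_mul_left _ ht

/-! ### The game with `b ≤ 2 a` -/

/-- The last `2 * s ^ 80` unexposed vertices have total degree of order `s ^ 82`, far below `n`, so
each single one of them has degree at most `n / 2` and still has room when it fails. -/
theorem le_run_short_window {W c s f t : ℕ} (h : Scale b W c s n) {τ : BreakerStrategy n b}
    {h' : History n} (hx' : Ext a b (strategy sched e₀) [] t h')
    (hp' : Progress sched (s ^ 54) f (2 * s ^ 80) h')
    (hF : Follows sched t
      (window (s ^ 75) (2 * W * s ^ 4) (s ^ 80) ++ (List.range (W * s ^ 4)).map Phase.fix))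
    (hf : f + s ^ 4 ≤ W * s ^ 4)
    (ht : t + (s ^ 80 + s ^ 75 * (2 * W * s ^ 4)) + W * s ^ 4 ≤ n)
    (hload' : (load sched h' : ℝ) ≤ (s ^ 2 + 1) * (2 * s ^ 80 : ℕ)) :
    ENNReal.ofReal (1 - (2 / s + 1 / s + 1 / s)) ≤
      (run a (strategy sched e₀) τ
        ((s ^ 80 + s ^ 75 * (2 * W * s ^ 4)) + W * s ^ 4) h').toOuterMeasure
        {h | HasPerfectMatching h} := by
  have hspos := h.s_pos
  have hs80' := h.pow_pos 80
  have hF2 := hF.left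
  rw [← hx'.length_eq] at hF2
  have hdeg' : ∀ v ∈ unexposed sched (observation h'), 2 * deg (claimed h') v ≤ n := by
    intro v hv
    have g1 : deg (claimed h') v ≤ load sched h' :=
      Finset.single_le_sum (f := fun u => deg (claimed h') u) (fun _ _ => Nat.zero_le _) hv
    have g2 : load sched h' ≤ (s ^ 2 + 1) * (2 * s ^ 80) := by exact_mod_cast hload'
    have g3 : 2 * ((s ^ 2 + 1) * (2 * s ^ 80)) ≤ s ^ 100 := by
      calc 2 * ((s ^ 2 + 1) * (2 * s ^ 80)) = 4 * s ^ 82 + 4 * s ^ 80 := by ring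
        _ ≤ 4 * s ^ 82 + 4 * s ^ 82 :=
          Nat.add_le_add_left (Nat.mul_le_mul_left _ (h.pow_mono (by norm_num))) _
        _ = 8 * s ^ 82 := by ring
        _ ≤ s ^ 83 := mul_pow_le_pow_succ (by have := h.s_large; omega)
        _ ≤ s ^ 100 := h.pow_mono (by norm_num)
    have := h.pow_le
    omega
  have hG2 : ENNReal.ofReal (1 - 2 / s) ≤
      (run a (strategy sched e₀) τ (s ^ 80) h').toOuterMeasure
        {h₂ | (failed sched (observation h₂)).length <
          (failed sched (observation h')).length + s ^ 4} := by
    refine ofReal_one_sub_le_of_compl_le _ (by positivity) ?_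
    have hA := run_failed_le (a := a) (b := b) (τ := τ) (e₀ := e₀) (h.pow_pos 4) hF2.window_main
      (by rw [hp'.card_unexposed])
    have hset : {h₂ : History n | (failed sched (observation h₂)).length <
          (failed sched (observation h')).length + s ^ 4}ᶜ =
        {h₂ | (failed sched (observation h')).length + s ^ 4 ≤
          (failed sched (observation h₂)).length} := by
      ext h₂
      simp
    rw [hset]
    refine hA.trans (ENNReal.ofReal_le_ofReal ?_)
    have hm : 2 * s ^ 80 ≤ n := h.pow_eighty_le (by have := h.s_large; omega)
    refine failure_error_le h (by rw [hp'.card_unexposed]; exact hm) (by positivity) ?_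
    rw [hp'.card_unexposed, div_le_iff₀ (by positivity)]
    refine hload'.trans (mul_le_mul_of_nonneg_right ?_ (by positivity))
    have : (0 : ℝ) ≤ 16 * (b + 1) ^ 2 := by positivity
    linarith
  have hwin2 := h.le_run_window rfl hp' hF2 le_rfl hf _ hG2 (by
    intro h₂ hh hx
    have g0 := hp'.length_failed
    have g1 : (failed sched (observation h₂)).length <
      (failed sched (observation h')).length + s ^ 4 := hh
    refine ⟨by omega, fun v hv => ?_⟩
    have hseg := hx.main_segment hF2.window_main (by rw [hp'.card_unexposed])
    rcases Finset.mem_union.1 (hseg.2.2.1 hv) with hv | hv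
    · exact Or.inl ((hp'.attached v hv).trans (deg_mono hx.makerEdges_subset v))
    · refine Or.inr ?_
      have g2 := hdeg' v hv
      have g3 : deg (claimed h₂) v ≤ deg (claimed h') v + (b + 1) * s ^ 80 := hx.deg_claimed_le v
      have g4 : deg (breakerEdges h₂) v ≤ deg (claimed h₂) v :=
        deg_mono Finset.subset_union_right v
      have g10 : 400 * ((b + 1) * s ^ 80) ≤ n := by
        rw [← mul_assoc]; exact h.pow_eighty_le h.b_le
      have g11 : s ^ 80 ≤ (b + 1) * s ^ 80 := Nat.le_mul_of_pos_left _ (by omega)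
      omega)
  refine (ofReal_one_sub_add_le (by positivity) (by positivity)).trans
    (mul_le_run_add (((ofReal_one_sub_add_le (by positivity) (by positivity))).trans hwin2) ?_)
  rintro h'' hx'' ⟨hp'', -⟩
  have hx := hx'.trans hx''
  have hF3 := hF.right
  rw [length_window, ← hx.length_eq] at hF3
  rw [Nat.sub_self] at hp''
  exact h.le_run_repair hp'' hf hF3 hx ht

/-- The first window stops `s ^ 80` pairs early, which leaves about `2 * s ^ 80` edges at every
vertex out of Breaker's reach. At that moment the average degree of the unexposed vertices is likely
below `s ^ 2`, which prepares the short second window. -/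
theorem le_run_of_le_two_mul {W c s : ℕ} (h : Scale b W c s n) (hn : Even n) (hab : b ≤ 2 * a)
    (hsched : Follows sched 0 (window (s ^ 75) (2 * W * s ^ 4) (n / 2 - s ^ 80) ++
      (window (s ^ 75) (2 * W * s ^ 4) (s ^ 80) ++ (List.range (W * s ^ 4)).map Phase.fix)))
    (τ : BreakerStrategy n b) :
    ENNReal.ofReal (1 - (b + 10) / s) ≤
      (run a (strategy sched e₀) τ ((n / 2 - s ^ 80 + s ^ 75 * (2 * W * s ^ 4)) +
        ((s ^ 80 + s ^ 75 * (2 * W * s ^ 4)) + W * s ^ 4)) []).toOuterMeasure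
        {h | HasPerfectMatching h} := by
  have hspos := h.s_pos
  have hn400 := h.n_large
  obtain ⟨N, hN⟩ := hn
  have hN2 : n / 2 = N := by omega
  have hs80 := h.pow_eighty_le h.s_large
  have hs80' := h.pow_pos 80
  have hw0 := weight_nonneg n
  have hb0 : (0 : ℝ) ≤ b := Nat.cast_nonneg b
  have htot := h.total_le
  obtain ⟨T, hT⟩ : ∃ T, T = s ^ 75 * (2 * W * s ^ 4) := ⟨_, rfl⟩
  set ℓ := n / 2 - s ^ 80 with hℓ
  have hW2 : 2 * s ^ 4 ≤ W * s ^ 4 := Nat.mul_le_mul_right _ h.two_le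
  have hTS := h.attach_le'
  rw [← hT] at hTS htot ⊢
  have hTS' : T ≤ (b + 1) * (T) := Nat.le_mul_of_pos_left _ (by omega)
  have hWTS : 2 * (T) ≤ W * (T) := Nat.mul_le_mul_right _ h.two_le
  have hF1 : Follows sched (observation ([] : History n)).length (window (s ^ 75) (2 * W * s ^ 4) ℓ) := hsched.left
  have hmain1 := hF1.window_main
  have hU1 : (unexposed sched (observation ([] : History n))).card = n :=
    (progress_nil (sched := sched) (n := n) 0).card_unexposed
  have hload : (load sched ([] : History n) : ℝ) = 0 := by
    simp [load, deg, claimed, makerEdges, breakerEdges]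
  have hG1 : ENNReal.ofReal (1 - (2 / s + (b + 1) / s)) ≤
      (run a (strategy sched e₀) τ ℓ []).toOuterMeasure
        {h₁ | (failed sched (observation h₁)).length < s ^ 4 ∧
          (load sched h₁ : ℝ) < s ^ 2 * (unexposed sched (observation h₁)).card} := by
    refine ofReal_one_sub_le_of_compl_le _ (by positivity) ?_
    have hA := run_failed_le (a := a) (b := b) (τ := τ) (e₀ := e₀) (h.pow_pos 4) hmain1
      (by rw [hU1]; omega)
    have hB := run_load_le (a := a) (b := b) (τ := τ) (e₀ := e₀) (Δ := (s : ℝ) ^ 2)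
      (by positivity) hmain1 (by rw [hU1]; omega)
    rw [hU1, hload, zero_div] at hA hB
    rw [ENNReal.ofReal_add (by positivity) (by positivity)]
    refine (MeasureTheory.measure_mono ?_).trans ((MeasureTheory.measure_union_le _ _).trans
      (add_le_add (hA.trans ?_) (hB.trans ?_)))
    · intro h₁ hh
      rw [Set.mem_compl_iff, Set.mem_ofPred_eq, not_and_or, not_lt, not_lt] at hh
      rcases hh with hh | hh
      · left
        rw [Set.mem_ofPred_eq, failed_nil]
        simpa using hh
      · right
        exact hh
    · exact ENNReal.ofReal_le_ofReal (failure_error_le h le_rfl le_rfl (by positivity))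
    · refine ENNReal.ofReal_le_ofReal ?_
      rw [div_le_div_iff₀ (by positivity) hspos, zero_add]
      calc (b + 1) * weight n * s ≤ (b + 1) * s * s := by gcongr; exact h.weight_le
        _ = (b + 1) * s ^ 2 := by ring
  have hwin1 := h.le_run_window (f := 0) (φ := s ^ 4) rfl (progress_nil (s ^ 54)) hF1
    (show 2 * ℓ ≤ n by omega) (by omega) _ hG1 (by
      intro h₁ hh hx
      refine ⟨by have := hh.1; omega, fun v _ => Or.inr ?_⟩
      have h1 := (deg_le_card (breakerEdges h₁) v).trans hx.card_breakerEdges_le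
      -- Here `b ≤ 2 * a` enters: even if Breaker put all his edges at one vertex, its Breaker
      -- degree would be at most `2 * ℓ ≤ n - 2 * s ^ 80`.
      have h2 : b * (ℓ / a) ≤ 2 * ℓ := by
        calc b * (ℓ / a) ≤ 2 * a * (ℓ / a) := Nat.mul_le_mul_right _ hab
          _ = 2 * (a * (ℓ / a)) := by ring
          _ ≤ 2 * ℓ := Nat.mul_le_mul_left _ (Nat.mul_div_le _ _)
      omega)
  rw [← hT] at hwin1
  -- The two parentheses collect the losses in the first window and in the rest of the play, `(b +
  -- 8) / s` together.
  have e1 : (1 : ℝ) - (b + 10) / s ≤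
      1 - ((2 / s + (b + 1) / s + 1 / s) + (2 / s + 1 / s + 1 / s)) := by
    have : (b + 10 : ℝ) / s =
        (2 / s + (b + 1) / s + 1 / s) + (2 / s + 1 / s + 1 / s) + 2 / s := by
      ring
    have : (0 : ℝ) ≤ 2 / s := by positivity
    linarith
  refine (ENNReal.ofReal_le_ofReal e1).trans ((ofReal_one_sub_add_le (by positivity)
    (by positivity)).trans (mul_le_run_add ((ofReal_one_sub_add_le (by positivity)
    (by positivity)).trans hwin1) ?_))
  rintro h' hx' ⟨hp', h₁, hh₁, hx₁, hx₂, hUeq⟩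
  have hF2 := hsched.right
  rw [length_window, zero_add, ← hT] at hF2
  have hm' : n - 2 * ℓ = 2 * s ^ 80 := by omega
  rw [hm', zero_add] at hp'
  have hcard1 : (unexposed sched (observation h₁)).card = 2 * s ^ 80 := by
    rw [← hUeq]; exact hp'.card_unexposed
  rw [hT]
  refine le_run_short_window h hx' hp' hF2 (by omega) (by omega) ?_
  obtain ⟨r, hr, hc⟩ := hx₂.exists_claimed
  -- Attaching adds at most `(b + 1) * T ≤ s ^ 80` edges, so the average over `2 * s ^ 80` vertices
  -- grows by at most `1`, from `s ^ 2` to `s ^ 2 + 1`.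
  have g1 : load sched h' ≤ load sched h₁ + 2 * ((b + 1) * T) := by
    unfold load
    rw [hUeq, hc]
    exact (sum_deg_union_le _ _ _).trans (by omega)
  have g2 : load sched h' ≤ load sched h₁ + 2 * s ^ 80 := by omega
  have g3 : (load sched h' : ℝ) ≤ load sched h₁ + (2 * s ^ 80 : ℕ) := by exact_mod_cast g2
  have g4 := hh₁.2
  rw [hcard1] at g4
  linarith

end

/-! ### The win with constant probability -/

section

variable {n a b : ℕ} {sched : ℕ → Phase} {e₀ : Edge n}

/-! ### The game with `b > 2 a` -/

/-- A lower bound for the probability that all vertices of large degree are exposed within one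
of the windows. -/
def hitChance (b : ℕ) : ℝ :=
  1 / ((16 * (b + 1)) ^ (8 * (b + 1)) * (8 * (b + 1)).factorial)

theorem hitChance_pos (b : ℕ) : 0 < hitChance b := by
  unfold hitChance
  positivity

/-- With `K = 8 * (b + 1)`, one has `(ℓ + 1 - K) ^ K ≤ K! * ℓ.choose K`, and the hypothesis on `ℓ`
says `n ≤ 16 * (b + 1) * (ℓ + 1 - K)`. -/
theorem hitChance_le_hitBound {ℓ : ℕ} (hn : 0 < n)
    (hℓ : n + 16 * (b + 1) * (8 * (b + 1)) ≤ 16 * (b + 1) * (ℓ + 1)) :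
    hitChance b ≤ hitBound n ℓ (8 * (b + 1)) := by
  set K := 8 * (b + 1) with hK
  have hn' : (0 : ℝ) < n := by exact_mod_cast hn
  have h0 : n ≤ 16 * (b + 1) * (ℓ + 1 - K) := by
    rw [Nat.mul_sub]
    omega
  have h1 : n ^ K ≤ (16 * (b + 1)) ^ K * (K.factorial * ℓ.choose K) := by
    calc n ^ K ≤ (16 * (b + 1) * (ℓ + 1 - K)) ^ K := Nat.pow_le_pow_left h0 K
      _ = (16 * (b + 1)) ^ K * (ℓ + 1 - K) ^ K := mul_pow _ _ _
      _ ≤ _ := by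
        refine Nat.mul_le_mul_left _ ?_
        rw [← Nat.descFactorial_eq_factorial_mul_choose]
        exact Nat.pow_sub_le_descFactorial ℓ K
  have h2 : (n : ℝ) ^ K ≤ (16 * (b + 1)) ^ K * (K.factorial * ℓ.choose K) := by
    exact_mod_cast h1
  unfold hitChance hitBound
  rw [← hK, div_le_div_iff₀ (by positivity) (by positivity)]
  linarith

/-- The degrees of the unexposed vertices are at most `n / 2`. -/
def HalfBounded (sched : ℕ → Phase) (h : History n) : Prop :=
  ∀ u ∈ unexposed sched (observation h), 2 * deg (claimed h) u ≤ n

/-- At most `(b + 1) * n` edges are claimed, so at most `8 * (b + 1)` unexposed vertices have degree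
above `n / 4`. This number does not depend on `n`, which makes exposing all of them an event of
probability bounded below. -/
theorem le_run_long_exposures {W c s f m ℓ t : ℕ} (h : Scale b W c s n)
    {τ : BreakerStrategy n b} {h₀ : History n} (hx : Ext a b (strategy sched e₀) [] t h₀)
    (hp : Progress sched (s ^ 54) f m h₀) (hs : 8 ≤ hitChance b * s)
    (hmain : ∀ i < ℓ, sched ((observation h₀).length + i) = Phase.main)
    (hm : 2 * ℓ ≤ m) (hmn : m ≤ n) (ht : t ≤ n)
    (hℓ : n + 16 * (b + 1) * (8 * (b + 1)) ≤ 16 * (b + 1) * (ℓ + 1)) :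
    ENNReal.ofReal (hitChance b / 2) ≤ (run a (strategy sched e₀) τ ℓ h₀).toOuterMeasure
      {h₁ | (failed sched (observation h₁)).length <
          (failed sched (observation h₀)).length + s ^ 4 ∧
        ∀ u ∈ unexposed sched (observation h₁), 4 * deg (claimed h₀) u ≤ n} := by
  have hspos := h.s_pos
  have hn := h.n_pos
  set C : Finset (Fin n) := (unexposed sched (observation h₀)).filter
    fun u => n < 4 * deg (claimed h₀) u with hC
  have hcard : C.card ≤ 8 * (b + 1) := by
    have h1 : C.card * n ≤ ∑ u ∈ C, 4 * deg (claimed h₀) u :=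
      Finset.card_nsmul_le_sum _ _ _ fun u hu => (Finset.mem_filter.1 hu).2.le
    rw [← Finset.mul_sum] at h1
    have h2 := sum_deg_le C (claimed h₀)
    have h3 := hx.card_claimed_le
    have h4 : (b + 1) * t ≤ (b + 1) * n := Nat.mul_le_mul_left _ ht
    refine Nat.le_of_mul_le_mul_right (c := n) ?_ hn
    rw [mul_assoc]
    omega
  have hCU : C ∩ unexposed sched (observation h₀) = C :=
    Finset.inter_eq_left.2 (Finset.filter_subset _ _)
  have hA := run_failed_le (a := a) (b := b) (τ := τ) (e₀ := e₀) (h.pow_pos 4) hmain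
    (by rw [hp.card_unexposed]; exact hm)
  have hB := run_hit_le (a := a) (b := b) (τ := τ) (e₀ := e₀) C hmain
    (by rw [hp.card_unexposed]; exact hm)
  rw [hCU] at hB
  rw [hp.card_unexposed] at hA
  -- The length of the window forces a linear number of unexposed vertices, so their average degree
  -- is at most `16 * (b + 1) ^ 2`.
  have hm0 : n ≤ 8 * (b + 1) * m := by
    have h5 : 16 * (b + 1) * (ℓ + 1) = 8 * (b + 1) * (2 * ℓ) + 16 * (b + 1) := by ring
    have h6 : 8 * (b + 1) * (2 * ℓ) ≤ 8 * (b + 1) * m := Nat.mul_le_mul_left _ hm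
    have h7 : 16 * (b + 1) ≤ 16 * (b + 1) * (8 * (b + 1)) := Nat.le_mul_of_pos_right _ (by omega)
    omega
  have hmpos : 0 < m := Nat.pos_of_ne_zero fun h0 => by
    rw [h0, mul_zero] at hm0
    omega
  have hload : (load sched h₀ : ℝ) / m ≤ s ^ 2 + 1 + 16 * (b + 1) ^ 2 := by
    have h1 : load sched h₀ ≤ 16 * (b + 1) ^ 2 * m := by
      calc load sched h₀ ≤ 2 * (claimed h₀).card := sum_deg_le _ _
        _ ≤ 2 * ((b + 1) * n) :=
          Nat.mul_le_mul_left _ (hx.card_claimed_le.trans (Nat.mul_le_mul_left _ ht))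
        _ ≤ 2 * ((b + 1) * (8 * (b + 1) * m)) :=
          Nat.mul_le_mul_left _ (Nat.mul_le_mul_left _ hm0)
        _ = 16 * (b + 1) ^ 2 * m := by ring
    rw [div_le_iff₀ (by exact_mod_cast hmpos)]
    have h2 : (load sched h₀ : ℝ) ≤ 16 * (b + 1) ^ 2 * m := by exact_mod_cast h1
    have h3 : (0 : ℝ) ≤ (s ^ 2 + 1) * m := by positivity
    linarith
  have hbound : hitChance b ≤ hitBound n ℓ C.card :=
    (hitChance_le_hitBound hn hℓ).trans (hitBound_antitone hn (by omega) hcard)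
  have hle1 := hitBound_le_one hn (show ℓ ≤ n by omega) C.card
  -- The scale is so large that too many failures cost at most half of the hitting probability.
  have h2s : 2 / (s : ℝ) ≤ hitChance b / 2 := by
    rw [div_le_div_iff₀ hspos two_pos]
    linarith
  refine le_trans (ENNReal.ofReal_le_ofReal (?_ : _ ≤ 1 - (2 / s + (1 - hitBound n ℓ C.card))))
    (ofReal_one_sub_le_of_compl_le _ (by have : (0 : ℝ) ≤ 2 / s := by positivity
                                         linarith) ?_)
  · linarith
  rw [ENNReal.ofReal_add (by positivity) (by linarith)]
  refine (PMF.toOuterMeasure_mono _ ?_).trans ((MeasureTheory.measure_union_le _ _).trans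
    (add_le_add (hA.trans (ENNReal.ofReal_le_ofReal
      (failure_error_le h hmn (by positivity) hload))) hB))
  rintro h₁ ⟨hh, hsupp⟩
  have hseg := (ext_of_mem_support hsupp).main_segment hmain
    (by rw [hp.card_unexposed]; exact hm)
  rw [Set.mem_compl_iff, Set.mem_ofPred_eq, not_and_or, not_lt] at hh
  rcases hh with hh | hh
  · exact Or.inl hh
  · right
    push Not at hh
    obtain ⟨u, hu, hd⟩ := hh
    exact ⟨u, Finset.mem_inter.2 ⟨Finset.mem_filter.2 ⟨hseg.2.1 hu, hd⟩, hu⟩⟩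

/-- The exposures of the window add at most `n / 8` to any degree, and attaching adds little. A
vertex that fails thus goes from at most `n / 2` to well below `n`, and one that stays unexposed
goes from at most `n / 4` to at most `n / 2`, which restores `HalfBounded`. -/
theorem le_run_long_window {W c s f m ℓ t : ℕ} (h : Scale b W c s n)
    {τ : BreakerStrategy n b} {h₀ : History n} (hx : Ext a b (strategy sched e₀) [] t h₀)
    (hp : Progress sched (s ^ 54) f m h₀) (hh : HalfBounded sched h₀)
    (hs : 8 ≤ hitChance b * s) (hF : Follows sched t (window (s ^ 75) (2 * W * s ^ 4) ℓ))
    (hm : 2 * ℓ ≤ m) (hmn : m ≤ n) (ht : t ≤ n) (hf : f + s ^ 4 ≤ W * s ^ 4)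
    (hℓ : n + 16 * (b + 1) * (8 * (b + 1)) ≤ 16 * (b + 1) * (ℓ + 1))
    (hℓ' : 8 * (b + 1) * ℓ ≤ n) :
    ENNReal.ofReal (hitChance b / 4) ≤
      (run a (strategy sched e₀) τ (ℓ + s ^ 75 * (2 * W * s ^ 4)) h₀).toOuterMeasure
        {h' | Progress sched (s ^ 54) (f + s ^ 4) (m - 2 * ℓ) h' ∧ HalfBounded sched h'} := by
  have hspos := h.s_pos
  have hTS := h.attach_le'
  have h80 := h.pow_eighty_le h.s_large
  rw [← hx.length_eq] at hF
  have hp0 := hitChance_pos b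
  have hc : hitChance b / 4 ≤ hitChance b / 2 * (1 - 1 / s) := by
    have h1 : 1 / (s : ℝ) ≤ 1 / 2 := by
      have : (400 : ℝ) ≤ s := by exact_mod_cast h.s_large
      exact one_div_le_one_div_of_le two_pos (by linarith)
    have h2 := mul_le_mul_of_nonneg_left h1 hp0.le
    linarith
  refine (ENNReal.ofReal_le_ofReal hc).trans ?_
  rw [ENNReal.ofReal_mul (by positivity)]
  refine le_run_of_subset (h.le_run_window rfl hp hF hm hf _
    (le_run_long_exposures h hx hp hs hF.window_main hm hmn ht hℓ) ?_) ?_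
  · intro h₁ hh₁ hx₁
    have g0 := hp.length_failed
    have g1 := hh₁.1
    refine ⟨by omega, fun v hv => ?_⟩
    have hseg := hx₁.main_segment hF.window_main (by rw [hp.card_unexposed]; exact hm)
    rcases Finset.mem_union.1 (hseg.2.2.1 hv) with hv | hv
    · exact Or.inl ((hp.attached v hv).trans (deg_mono hx₁.makerEdges_subset v))
    · refine Or.inr ?_
      have g2 := hh v hv
      have g3 := hx₁.deg_claimed_le v
      have g4 : deg (breakerEdges h₁) v ≤ deg (claimed h₁) v :=
        deg_mono Finset.subset_union_right v
      rw [mul_assoc] at hℓ'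
      omega
  · rintro h' - ⟨hp', h₁, hh₁, hx₁, hx₂, hU⟩
    refine ⟨hp', fun u hu => ?_⟩
    rw [hU] at hu
    have g1 := hh₁.2 u hu
    have g2 := hx₁.deg_claimed_le u
    have g3 := hx₂.deg_claimed_le u
    rw [mul_assoc] at hℓ'
    omega

theorem le_run_long_windows {W c s ℓ : ℕ} (h : Scale b W c s n) {τ : BreakerStrategy n b}
    (hs : 8 ≤ hitChance b * s)
    (hℓ : n + 16 * (b + 1) * (8 * (b + 1)) ≤ 16 * (b + 1) * (ℓ + 1))
    (hℓ' : 8 * (b + 1) * ℓ ≤ n) (r : ℕ)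
    (hF : ∀ i < r, Follows sched (i * (ℓ + s ^ 75 * (2 * W * s ^ 4)))
      (window (s ^ 75) (2 * W * s ^ 4) ℓ))
    (hr : r * (2 * ℓ) ≤ n) (hrW : r ≤ W) :
    ENNReal.ofReal (hitChance b / 4) ^ r ≤
      (run a (strategy sched e₀) τ (r * (ℓ + s ^ 75 * (2 * W * s ^ 4))) []).toOuterMeasure
        {h' | Progress sched (s ^ 54) (r * s ^ 4) (n - r * (2 * ℓ)) h' ∧
          HalfBounded sched h'} := by
  induction r with
  | zero =>
    rw [pow_zero, zero_mul, zero_mul, zero_mul, Nat.sub_zero]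
    refine ((PMF.toOuterMeasure_apply_eq_one_iff _ _).2 fun h' hh' => ?_).ge
    have : h' = [] := by simpa [run] using hh'
    subst this
    refine ⟨progress_nil _, fun u _ => ?_⟩
    simp [deg, claimed, makerEdges, breakerEdges]
  | succ r ih =>
    rw [add_one_mul] at hr
    rw [pow_succ, add_one_mul, add_one_mul, add_one_mul, Nat.sub_add_eq]
    refine mul_le_run_add (ih (fun i hi => hF i (by omega)) (by omega) (by omega)) ?_
    rintro h₀ hx ⟨hp, hh⟩
    refine le_run_long_window h hx hp hh hs (hF r (by omega)) (by omega) (by omega) ?_ ?_ hℓ hℓ'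
    · have h1 : r * (s ^ 75 * (2 * W * s ^ 4)) ≤ W * (s ^ 75 * (2 * W * s ^ 4)) :=
        Nat.mul_le_mul_right _ (by omega)
      have h2 := h.total_le
      have h3 := h.pow_eighty_le h.s_large
      have h4 : r * (2 * ℓ) = 2 * (r * ℓ) := by ring
      rw [mul_add]
      omega
    · have : (r + 1) * s ^ 4 ≤ W * s ^ 4 := Nat.mul_le_mul_right _ hrW
      rwa [add_one_mul] at this

theorem Follows.replicate {L M : List Phase} {r : ℕ}
    (h : Follows sched 0 ((List.replicate r L).flatten ++ M)) :
    (∀ i < r, Follows sched (i * L.length) L) ∧ Follows sched (r * L.length) M := by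
  have h1 : ∀ i, ((List.replicate i L).flatten).length = i * L.length := fun i => by simp
  refine ⟨fun i hi => ?_, ?_⟩
  · have h2 := h.left
    obtain ⟨j, rfl⟩ : ∃ j, r = i + (j + 1) := ⟨r - i - 1, by omega⟩
    rw [List.replicate_add, List.flatten_append, List.replicate_succ, List.flatten_cons] at h2
    have h3 := h2.right.left
    rwa [h1, zero_add] at h3
  · have h3 := h.right
    rwa [h1, zero_add] at h3

/-- Each of the `R = 4 * (b + 1)` long windows, of about `n / (8 * (b + 1))` exposures, succeeds
with constant probability, and `R` does not depend on `n`. The rounding leaves fewer than `R` pairs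
for one more window. -/
theorem le_run_of_two_mul_lt {R c s ℓ : ℕ} (h : Scale b (R + 1) c s n) (hn : Even n)
    (hR : R = 4 * (b + 1)) (hℓ : ℓ = n / 2 / R) (hs : 8 ≤ hitChance b * s)
    (hsched : Follows sched 0
      ((List.replicate R (window (s ^ 75) (2 * (R + 1) * s ^ 4) ℓ)).flatten ++
        (window (s ^ 75) (2 * (R + 1) * s ^ 4) (n / 2 - R * ℓ) ++
          (List.range ((R + 1) * s ^ 4)).map Phase.fix)))
    (τ : BreakerStrategy n b) :
    ENNReal.ofReal ((hitChance b / 4) ^ R * (1 / 4)) ≤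
      (run a (strategy sched e₀) τ (R * (ℓ + s ^ 75 * (2 * (R + 1) * s ^ 4)) +
        ((n / 2 - R * ℓ + s ^ 75 * (2 * (R + 1) * s ^ 4)) + (R + 1) * s ^ 4)) []).toOuterMeasure
        {h | HasPerfectMatching h} := by
  have hp0 := hitChance_pos b
  have hspos := h.s_pos
  have h80 := h.pow_eighty_le h.s_large
  have htot := h.total_le
  obtain ⟨hF1, hF2⟩ := hsched.replicate
  rw [length_window] at hF1 hF2
  have hRpos : 0 < R := by omega
  obtain ⟨ℓ', hℓ'⟩ : ∃ x, x = n / 2 - R * ℓ := ⟨_, rfl⟩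
  rw [← hℓ'] at hF2 ⊢
  have hdiv : R * ℓ ≤ n / 2 := by rw [hℓ]; exact Nat.mul_div_le _ _
  have hmod : ℓ' < R := by
    have h1 := Nat.div_add_mod (n / 2) R
    have h2 := Nat.mod_lt (n / 2) hRpos
    rw [← hℓ] at h1
    omega
  obtain ⟨N, hN⟩ := hn
  have hR16 : R * (2 * ℓ) = 2 * (R * ℓ) := by ring
  have hsize : 16 * (b + 1) * (8 * (b + 1)) + 16 * (b + 1) ≤ n := by
    have h1 := h.b_sq_le
    have h2 : s ≤ n := (Nat.le_self_pow (by norm_num) s).trans h.pow_le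
    have h3 : b + 1 ≤ (b + 1) ^ 2 := Nat.le_self_pow (by norm_num) _
    have h4 : 16 * (b + 1) * (8 * (b + 1)) = 128 * (b + 1) ^ 2 := by ring
    omega
  have hwin := le_run_long_windows (sched := sched) (e₀ := e₀) (a := a) (τ := τ) h hs
    (ℓ := ℓ) (by
      have h1 : 16 * (b + 1) * (ℓ + 1) = 4 * (R * ℓ) + 4 * R := by rw [hR]; ring
      omega) (by
      have h1 : 8 * (b + 1) * ℓ = 2 * (R * ℓ) := by rw [hR]; ring
      omega) R hF1 (by omega) (by omega)
  have hhalf : (1 / 2 : ℝ) ≤ 1 - 1 / s := by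
    have h1 : 1 / (s : ℝ) ≤ 1 / 2 := by
      have : (400 : ℝ) ≤ s := by exact_mod_cast h.s_large
      exact one_div_le_one_div_of_le two_pos (by linarith)
    linarith
  rw [ENNReal.ofReal_mul (by positivity), ENNReal.ofReal_pow (by positivity)]
  refine mul_le_run_add hwin ?_
  rintro h₀ hx ⟨hp, hh⟩
  have hm : n - R * (2 * ℓ) = 2 * ℓ' := by omega
  rw [hm] at hp
  have hF3 := hF2.left
  rw [← hx.length_eq] at hF3
  have hRs : R * (b + 1) ≤ s ^ 4 := by
    have h1 := h.b_sq_le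
    have h2 : s ≤ s ^ 4 := Nat.le_self_pow (by norm_num) s
    have h3 : R * (b + 1) = 4 * (b + 1) ^ 2 := by rw [hR]; ring
    omega
  have hRR : R ≤ R * (b + 1) := Nat.le_mul_of_pos_right _ (by omega)
  -- Even if all of the fewer than `R` remaining exposures fail, they stay within the allowance `s ^
  -- 4`, so the sure event suffices for `G`.
  have hlast := h.le_run_window (a := a) (τ := τ) (e₀ := e₀) rfl hp hF3 le_rfl
    (φ := s ^ 4) (by rw [add_one_mul]) Set.univ
    ((PMF.toOuterMeasure_apply_eq_one_iff _ _).2 (Set.subset_univ _)).ge (by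
      intro h₁ _ hx₁
      have g0 := hp.length_failed
      have g1 := hx₁.length_failed_le_add (sched := sched)
      refine ⟨by omega, fun v hv => ?_⟩
      have hseg := hx₁.main_segment hF3.window_main (by rw [hp.card_unexposed])
      rcases Finset.mem_union.1 (hseg.2.2.1 hv) with hv | hv
      · exact Or.inl ((hp.attached v hv).trans (deg_mono hx₁.makerEdges_subset v))
      · refine Or.inr ?_
        have g2 := hh v hv
        have g3 := hx₁.deg_claimed_le v
        have g4 : deg (breakerEdges h₁) v ≤ deg (claimed h₁) v :=
          deg_mono Finset.subset_union_right v
        have g5 : (b + 1) * ℓ' ≤ s ^ 4 :=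
          (Nat.mul_le_mul_left _ hmod.le).trans (by rwa [mul_comm])
        have g6 : s ^ 4 ≤ s ^ 80 := h.pow_mono (by norm_num)
        omega)
  rw [one_mul, Nat.sub_self] at hlast
  rw [show (1 / 4 : ℝ) = 1 / 2 * (1 / 2) by norm_num, ENNReal.ofReal_mul (by norm_num)]
  refine mul_le_run_add ((ENNReal.ofReal_le_ofReal hhalf).trans hlast) ?_
  rintro h₁ hx₁ ⟨hp₁, -⟩
  have hF4 := hF2.right
  have hx' := hx.trans hx₁
  rw [length_window, ← hx'.length_eq] at hF4
  refine (ENNReal.ofReal_le_ofReal hhalf).trans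
    (h.le_run_repair hp₁ (by rw [add_one_mul]) hF4 hx' ?_)
  have e1 : R * (ℓ + s ^ 75 * (2 * (R + 1) * s ^ 4)) =
      R * ℓ + R * (s ^ 75 * (2 * (R + 1) * s ^ 4)) := mul_add _ _ _
  have e2 : (R + 1) * (s ^ 75 * (2 * (R + 1) * s ^ 4)) =
      R * (s ^ 75 * (2 * (R + 1) * s ^ 4)) + s ^ 75 * (2 * (R + 1) * s ^ 4) := add_one_mul _ _
  omega

end

/-! ### The scale for given `n`, and the theorem -/

section

variable {n a b : ℕ} {sched : ℕ → Phase} {e₀ : Edge n}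

/-! ### Choice of the scale -/

/-- The integer part of `n ^ (1 / 100)`. -/
def rootScale (n : ℕ) : ℕ := Nat.findGreatest (fun s => s ^ 100 ≤ n) n

theorem tendsto_rootScale : Tendsto rootScale atTop atTop := by
  refine tendsto_atTop.2 fun K => ?_
  filter_upwards [eventually_ge_atTop (K ^ 100)] with n hn
  exact Nat.le_findGreatest ((Nat.le_self_pow (by norm_num) K).trans hn) hn

theorem rootScale_pow_le (n : ℕ) : rootScale n ^ 100 ≤ n :=
  Nat.findGreatest_spec (P := fun s => s ^ 100 ≤ n) (m := 0) (Nat.zero_le n) (by simp)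

theorem lt_rootScale_succ_pow (n : ℕ) : n < (rootScale n + 1) ^ 100 := by
  by_cases h : rootScale n + 1 ≤ n
  · exact not_le.1 (Nat.findGreatest_is_greatest (P := fun s => s ^ 100 ≤ n)
      (Nat.lt_succ_self _) h)
  · exact (not_le.1 h).trans_le (Nat.le_self_pow (by norm_num) _)

theorem weight_le_log (n : ℕ) : weight n ≤ 2 * (1 + Real.log n) := by
  have h1 : weight n = 2 * (harmonic n : ℝ) := by
    unfold weight harmonic
    push_cast
    rw [Finset.mul_sum]
    exact Finset.sum_congr rfl fun i _ => div_eq_mul_inv _ _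
  rw [h1]
  exact mul_le_mul_of_nonneg_left (harmonic_le_one_add_log n) two_pos.le

/-- The constant `2 ^ 100` comes from `n < (s + 1) ^ 100 ≤ (2 * s) ^ 100`; since `weight n` is at
most `2 * (1 + log n)`, it is of order `log s` and eventually below `s`. -/
theorem exists_scale (b W : ℕ) (hW : 2 ≤ W) :
    ∃ c, ∀ᶠ n in atTop, Scale b W c (rootScale n) n := by
  obtain ⟨c, hc⟩ : ∃ c, c = 2 ^ 100 := ⟨_, rfl⟩
  have hc1 : 1 ≤ c := hc ▸ Nat.one_le_two_pow
  have hlog : ∀ᶠ x : ℝ in atTop, 2 * (1 + 100 * (Real.log 2 + Real.log x)) ≤ x := by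
    have h1 := Real.isLittleO_log_id_atTop.bound (show (0 : ℝ) < 1 / 400 by norm_num)
    filter_upwards [h1, eventually_ge_atTop (2 * (2 + 200 * Real.log 2)), eventually_ge_atTop 0]
      with x hx1 hx2 hx3
    have h2 := (le_abs_self (Real.log x)).trans hx1
    rw [id, Real.norm_of_nonneg hx3] at h2
    linarith
  refine ⟨c, ?_⟩
  filter_upwards [tendsto_rootScale.eventually (tendsto_natCast_atTop_atTop.eventually hlog),
    tendsto_rootScale.eventually (eventually_ge_atTop (400 * (b + 1) ^ 2 * W ^ 2 * c + 1))]
    with n h1 h2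
  have hs : 0 < rootScale n := by omega
  have hle : n ≤ c * rootScale n ^ 100 := by
    rw [hc, ← mul_pow]
    exact (lt_rootScale_succ_pow n).le.trans (Nat.pow_le_pow_left (by omega) _)
  have hn : 0 < n := (Nat.pow_pos hs).trans_le (rootScale_pow_le n)
  refine ⟨rootScale_pow_le n, hle, (weight_le_log n).trans (le_trans ?_ h1), by omega, hW, hc1⟩
  have h3 : (n : ℝ) ≤ (2 * rootScale n) ^ 100 := by
    rw [mul_pow]
    have : ((2 : ℝ) ^ 100) = c := by rw [hc]; norm_num
    rw [this]
    exact_mod_cast hle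
  have hs' : (0 : ℝ) < rootScale n := by exact_mod_cast hs
  have h4 := Real.log_le_log (by exact_mod_cast hn) h3
  rw [Real.log_pow, Real.log_mul two_ne_zero hs'.ne'] at h4
  push_cast at h4
  linarith

/-! ### Conclusion -/

theorem exists_follows (L : List Phase) : ∃ sched, Follows sched 0 L :=
  ⟨fun i => L.getD i Phase.main, fun i hi => by simp [hi]⟩

theorem nonempty_edge (hn : 2 ≤ n) : Nonempty (Edge n) :=
  ⟨⟨s(⟨0, by omega⟩, ⟨1, by omega⟩), by simp⟩⟩

theorem le_mul_choose_two {N : ℕ} (ha : 0 < a) (hn : 3 ≤ n) (hN : N ≤ n) :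
    N ≤ a * n.choose 2 := by
  refine (hN.trans ?_).trans (Nat.le_mul_of_pos_left _ ha)
  rw [Nat.choose_two_right, Nat.le_div_iff_mul_le two_pos]
  exact Nat.mul_le_mul_left _ (by omega)

/-- Since `s ^ 80 ≤ n ^ 0.8`, one summand `n ^ 0.8` covers the attempts beyond `n / 2`, and the
other the rounding down to whole rounds of `a` attempts. -/
theorem Scale.le_mul_floor {W c s N : ℕ} (h : Scale b W c s n) (ha : 0 < a)
    (hN : N ≤ n / 2 + s ^ 80) :
    N ≤ a * ⌊(n : ℝ) / (2 * (a : ℝ)) + 2 * (n : ℝ) ^ (0.8 : ℝ)⌋₊ := by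
  have ha' : (0 : ℝ) < a := by exact_mod_cast ha
  have h1 : ((s ^ 80 : ℕ) : ℝ) ≤ (n : ℝ) ^ (0.8 : ℝ) := by
    have h2 : ((s ^ 100 : ℕ) : ℝ) ^ (0.8 : ℝ) ≤ (n : ℝ) ^ (0.8 : ℝ) :=
      Real.rpow_le_rpow (by positivity) (by exact_mod_cast h.pow_le) (by norm_num)
    refine le_of_eq_of_le ?_ h2
    push_cast
    rw [← Real.rpow_natCast (s : ℝ) 100, ← Real.rpow_mul (by positivity),
      ← Real.rpow_natCast (s : ℝ) 80]
    norm_num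
  have h2 : (1 : ℝ) ≤ ((s ^ 80 : ℕ) : ℝ) := by exact_mod_cast h.pow_pos 80
  have h3 := Nat.lt_floor_add_one ((n : ℝ) / (2 * (a : ℝ)) + 2 * (n : ℝ) ^ (0.8 : ℝ))
  set F := ⌊(n : ℝ) / (2 * (a : ℝ)) + 2 * (n : ℝ) ^ (0.8 : ℝ)⌋₊
  have h4 : ((n / 2 : ℕ) : ℝ) ≤ (n : ℝ) / 2 := Nat.cast_div_le
  have h5 : (N : ℝ) ≤ ((n / 2 : ℕ) : ℝ) + ((s ^ 80 : ℕ) : ℝ) := by exact_mod_cast hN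
  have h6 : a * ((n : ℝ) / (2 * (a : ℝ)) + 2 * (n : ℝ) ^ (0.8 : ℝ)) ≤ a * ((F : ℝ) + 1) :=
    mul_le_mul_of_nonneg_left h3.le ha'.le
  have h7 : a * ((n : ℝ) / (2 * (a : ℝ)) + 2 * (n : ℝ) ^ (0.8 : ℝ)) =
      n / 2 + 2 * (a * (n : ℝ) ^ (0.8 : ℝ)) := by
    field_simp
  have h8 : (1 : ℝ) ≤ a := by exact_mod_cast ha
  have h9 : (a : ℝ) * 1 ≤ a * (n : ℝ) ^ (0.8 : ℝ) :=
    mul_le_mul_of_nonneg_left (h2.trans h1) ha'.le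
  have h10 : 1 * (n : ℝ) ^ (0.8 : ℝ) ≤ a * (n : ℝ) ^ (0.8 : ℝ) :=
    mul_le_mul_of_nonneg_right h8 (by positivity)
  have h11 : (N : ℝ) ≤ a * (F : ℝ) := by linarith
  exact_mod_cast h11

theorem exists_le_winProb_of_two_mul_lt (b : ℕ) (ha : 0 < a) :
    ∃ c : ℝ, 0 < c ∧ ∃ N : ℕ, ∀ n : ℕ, N ≤ n → Even n →
      ∃ σ : MakerStrategy n, ∀ τ : BreakerStrategy n b, c ≤ winProb a σ τ := by
  obtain ⟨R, hR⟩ : ∃ R, R = 4 * (b + 1) := ⟨_, rfl⟩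
  have hp0 := hitChance_pos b
  obtain ⟨c, hc⟩ := exists_scale b (R + 1) (by omega)
  obtain ⟨N, hN⟩ := eventually_atTop.1 (hc.and ((tendsto_natCast_atTop_atTop.comp
    tendsto_rootScale).eventually (eventually_ge_atTop (8 / hitChance b))))
  refine ⟨(hitChance b / 4) ^ R * (1 / 4), by positivity, N, fun n hn he => ?_⟩
  obtain ⟨h, hs⟩ := hN n hn
  rw [Function.comp_apply, div_le_iff₀' hp0] at hs
  have hn400 := h.n_large
  obtain ⟨e₀⟩ := nonempty_edge (n := n) (by omega)
  generalize rootScale n = s at h hs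
  obtain ⟨sched, hsched⟩ := exists_follows
    ((List.replicate R (window (s ^ 75) (2 * (R + 1) * s ^ 4) (n / 2 / R))).flatten ++
      (window (s ^ 75) (2 * (R + 1) * s ^ 4) (n / 2 - R * (n / 2 / R)) ++
        (List.range ((R + 1) * s ^ 4)).map Phase.fix))
  refine ⟨strategy sched e₀, fun τ => le_winProbWithin ha
    (le_mul_choose_two ha (by omega) ?_) (le_run_of_two_mul_lt h he hR rfl hs hsched τ)⟩
  have h1 := h.total_le
  have h2 := h.pow_eighty_le h.s_large
  have h3 : R * (n / 2 / R) ≤ n / 2 := Nat.mul_div_le _ _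
  rw [add_one_mul R (s ^ 75 * (2 * (R + 1) * s ^ 4))] at h1
  rw [mul_add]
  omega

theorem exists_one_sub_le_winProb_of_le_two_mul (ha : 0 < a) (hab : b ≤ 2 * a) :
    ∃ C : ℝ, ∃ δ : ℕ → ℝ, Tendsto δ atTop (𝓝 0) ∧ ∃ N : ℕ, ∀ n : ℕ, N ≤ n → Even n →
      ∃ σ : MakerStrategy n, ∀ τ : BreakerStrategy n b,
        1 - δ n ≤ winProb a σ τ ∧
        1 - δ n ≤ winProbWithin a σ τ
          ⌊(n : ℝ) / (2 * (a : ℝ)) + C * (n : ℝ) ^ (0.8 : ℝ)⌋₊ := by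
  obtain ⟨c, hc⟩ := exists_scale b 2 le_rfl
  obtain ⟨N, hN⟩ := eventually_atTop.1 hc
  refine ⟨2, fun n => (b + 10) / rootScale n,
    (tendsto_natCast_atTop_atTop.comp tendsto_rootScale).const_div_atTop _, N, fun n hn he => ?_⟩
  have h := hN n hn
  have hn400 := h.n_large
  obtain ⟨e₀⟩ := nonempty_edge (n := n) (by omega)
  beta_reduce
  generalize rootScale n = s at h
  obtain ⟨sched, hsched⟩ := exists_follows
    (window (s ^ 75) (2 * 2 * s ^ 4) (n / 2 - s ^ 80) ++
      (window (s ^ 75) (2 * 2 * s ^ 4) (s ^ 80) ++ (List.range (2 * s ^ 4)).map Phase.fix))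
  have h1 := h.total_le
  have h2 := h.pow_eighty_le h.s_large
  have htotal : (n / 2 - s ^ 80 + s ^ 75 * (2 * 2 * s ^ 4)) +
      ((s ^ 80 + s ^ 75 * (2 * 2 * s ^ 4)) + 2 * s ^ 4) ≤ n / 2 + s ^ 80 := by
    rw [two_mul (s ^ 75 * (2 * 2 * s ^ 4))] at h1
    omega
  exact ⟨strategy sched e₀, fun τ =>
    ⟨le_winProbWithin ha (le_mul_choose_two ha (by omega) (htotal.trans (by omega)))
      (le_run_of_le_two_mul h he hab hsched τ),
    le_winProbWithin ha (h.le_mul_floor ha htotal) (le_run_of_le_two_mul h he hab hsched τ)⟩⟩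

end

end PhantomGame

end

theorem theorem1p4 (a b : ℕ) (ha : 0 < a) (hb : 0 < b) :
    (2 * a < b →
      ∃ c : ℝ, 0 < c ∧ ∃ N : ℕ, ∀ n : ℕ, N ≤ n → Even n →
        ∃ σ : PhantomGame.MakerStrategy n, ∀ τ : PhantomGame.BreakerStrategy n b,
          c ≤ PhantomGame.winProb a σ τ) ∧
    (b ≤ 2 * a →
      ∃ C : ℝ, ∃ δ : ℕ → ℝ, Tendsto δ atTop (𝓝 0) ∧ ∃ N : ℕ, ∀ n : ℕ, N ≤ n → Even n →
        ∃ σ : PhantomGame.MakerStrategy n, ∀ τ : PhantomGame.BreakerStrategy n b,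
          1 - δ n ≤ PhantomGame.winProb a σ τ ∧
          1 - δ n ≤ PhantomGame.winProbWithin a σ τ
            ⌊(n : ℝ) / (2 * (a : ℝ)) + C * (n : ℝ) ^ (0.8 : ℝ)⌋₊) :=
  ⟨fun _ => PhantomGame.exists_le_winProb_of_two_mul_lt b ha,
    PhantomGame.exists_one_sub_le_winProb_of_le_two_mul ha⟩
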